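/- Let $D=\{z\in\mathbb C:|z|<1\}$. Let $\hat H$ be the class of harmonic mappings $f=h+\overline g$ on $D$ with $h,g$ holomorphic in $D$, $h(z)=z+\sum_{n\ge2}A_nz^n$, $g(z)=\sum_{n\ge1}B_nz^n$, $|B_1|<1$. Let $K_{\hat H^o}$ be the class of all $f=h+\overline g\in\hat H$ that are univalent and sense-preserving in $D$ (the latter meaning $|g'(z)|<|h'(z)|$ for all $z\in D$), have $B_1=g'(0)=0$, and map $D$ onto a convex domain. For $0\le\alpha<1$ let $HS^*(\alpha)$ be the class of all $f\in\hat H$ such that, for every $0<r<1$ and every real $\theta$, $f(re^{i\theta})\ne0$ and $\frac{\partial}{\partial\theta}\arg f(re^{i\theta})>\alpha$. For real $a,c>0$ and $b,d\ge0$ with $b+d>0$ let $$W_{(a,b),(c,d)}(z)=z\,\Gamma(a)\Gamma(c)\sum_{n=0}^\infty\frac{z^n}{\Gamma(a+nb)\Gamma(c+nd)}$$ be the normalized four-parameter Wright function (the series converges for all $z\in\mathbb C$). **Theorem.** Let $0\le\alpha<1$; let $\alpha_1,\alpha_2,\gamma_1,\gamma_2>0$ and $\beta_1,\beta_2,\delta_1,\delta_2\ge0$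 be real with $\beta_1+\delta_1>0$ and $\beta_2+\delta_2>0$; and let $\sigma\in\mathbb C$, $|\sigma|<1$. Write $W_j=W_{(\alpha_j,\beta_j),(\gamma_j,\delta_j)}$ for $j=1,2$. Let $f=h+\overline g\in K_{\hat H^o}$ and $$L(f)=h*W_1+\overline{\sigma\,(g*W_2)},$$ where $*$ is the convolution (Hadamard product) of power series, $\big(\sum u_nz^n\big)*\big(\sum v_nz^n\big)=\sum u_nv_nz^n$. If $$W_1''(1)+(2-\alpha)\big(W_1'(1)-1\big)-\alpha\big(W_1(1)-1\big)+|\sigma|\Big(W_2''(1)+\alpha\big(W_2'(1)-W_2(1)\big)\Big)\le 2(1-\alpha),$$ then $L(f)\in HS^*(\alpha)$. -/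

import Mathlib

/-- The harmonic mapping `f = h + conj g` with analytic part `h` and co-analytic part `g`. -/
def harmonicMap (h g : ℂ → ℂ) (z : ℂ) : ℂ :=
  h z + (starRingEnd ℂ) (g z)

/-- `f = h + conj g` is a normalized harmonic mapping of the unit disk: `h`, `g` are holomorphic
there, `h(z) = z + ∑_{n ≥ 2} Aₙ zⁿ`, `g(z) = ∑_{n ≥ 1} Bₙ zⁿ` and `|B₁| < 1`.
As `g 0 = 0`, the pair `(h, g)` is determined by `f`. -/
structure IsNormalizedHarmonic (h g : ℂ → ℂ) : Prop where
  holo_h : DifferentiableOn ℂ h (Metric.ball 0 1)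
  holo_g : DifferentiableOn ℂ g (Metric.ball 0 1)
  h_zero : h 0 = 0
  deriv_h_zero : deriv h 0 = 1
  g_zero : g 0 = 0
  norm_deriv_g_zero : ‖deriv g 0‖ < 1

/-- The class of harmonic convex mappings with `B₁ = 0`: sense-preserving univalent normalized
harmonic mappings `f = h + conj g` of the unit disk with `g'(0) = 0` whose image is convex. -/
structure IsHarmonicConvexZero (h g : ℂ → ℂ) : Prop extends IsNormalizedHarmonic h g where
  sense_preserving : ∀ z ∈ Metric.ball (0 : ℂ) 1, ‖deriv g z‖ < ‖deriv h z‖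
  univalent : Set.InjOn (harmonicMap h g) (Metric.ball 0 1)
  deriv_g_zero : deriv g 0 = 0
  convex_image : Convex ℝ (harmonicMap h g '' Metric.ball 0 1)

/-- Harmonic starlike mappings of order `α`: `f = h + conj g` is a normalized harmonic mapping such
that, on every circle `|z| = r`, `0 < r < 1`, it does not vanish and
`∂/∂θ (arg f(r e^{iθ})) > α`. Here `φ` is a differentiable choice of `θ ↦ arg f(r e^{iθ})`. -/
structure IsHarmonicStarlike (α : ℝ) (h g : ℂ → ℂ) : Prop extends IsNormalizedHarmonic h g where
  arg_deriv : ∀ r : ℝ, 0 < r → r < 1 → ∃ φ : ℝ → ℝ, Differentiable ℝ φ ∧ ∀ θ : ℝ,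
    harmonicMap h g (circleMap 0 r θ) ≠ 0 ∧
    harmonicMap h g (circleMap 0 r θ) =
      (‖harmonicMap h g (circleMap 0 r θ)‖ : ℂ) * Complex.exp ((φ θ : ℂ) * Complex.I) ∧
    α < deriv φ θ

/-- The four-parameter Wright function `∑ₙ zⁿ / (Γ(α + nβ) Γ(γ + nδ))`. -/
noncomputable def wrightFun (α β γ δ : ℝ) (z : ℂ) : ℂ :=
  ∑' n : ℕ, z ^ n / ((Real.Gamma (α + n * β) * Real.Gamma (γ + n * δ) : ℝ) : ℂ)

/-- The normalized Wright function
`W(z) = z Γ(α) Γ(γ) ∑ₙ zⁿ / (Γ(α + nβ) Γ(γ + nδ))`. -/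
noncomputable def normWright (α β γ δ : ℝ) (z : ℂ) : ℂ :=
  z * ((Real.Gamma α * Real.Gamma γ : ℝ) : ℂ) * wrightFun α β γ δ z

/-- The `n`-th Taylor coefficient at `0`. -/
noncomputable def taylorCoeffZero (u : ℂ → ℂ) (n : ℕ) : ℂ :=
  iteratedDeriv n u 0 / (n.factorial : ℂ)

/-- Convolution (Hadamard product) of power series: `(u * v)(z) = ∑ₙ uₙ vₙ zⁿ`. -/
noncomputable def hadamardConv (u v : ℂ → ℂ) (z : ℂ) : ℂ :=
  ∑' n : ℕ, taylorCoeffZero u n * taylorCoeffZero v n * z ^ n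

open Set Filter Topology Complex Metric MeasureTheory
open scoped ENNReal Real ComplexConjugate

/-!
For a harmonic map `f = h + conj g` and a direction `ν`, the real part of the holomorphic function
`q = e^{-iν} h + e^{iν} g` is a component of `f`. Suppose that `f` is univalent with convex image.
Half planes cut the image in connected pieces, and curves in the disk with interlaced ends on the
circle meet, so the boundary values of `re q` rise on one arc of the circle and fall on the
complementary one. This makes `re q` monotone along the flow of a vector field
`i (c + c₀ z + c̄ z²)` of the disk that vanishes at a maximum and at a minimum on the circle: for a
function that is `1` on an arc containing the maximum but not the minimum and `0` elsewhere this is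
a direct computation, and boundary values of the above shape are superpositions of such functions.
To have boundary values at our disposal, `f` is first restricted to preimages of compactly contained
convex domains, which are parametrized by Riemann maps.

As `ν` increases by `π`, the number `c₀` changes sign, so there is a direction with `c₀ = 0`. In
this direction Carathéodory's inequality bounds the `n`-th Taylor coefficient of `q'` by
`(n + 1) |q'(0)|`. If `f` is sense-preserving, then `X = e^{-iν} h'` and `Y = e^{iν} g'` satisfy
`|Y| < |X|`, so `X / (X + Y)` has real part at least `1/2` and coefficients at most `1`. In the
normalized case multiplication by `q' = X + Y` gives `|hₙ| ≤ (n + 1) / 2` and `|gₙ| ≤ (n - 1) / 2`.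

On the other hand, `∑ (n - α) |aₙ| + ∑ (n + α) |bₙ| ≤ 2 (1 - α)` implies starlikeness of order `α`:
for the angular derivative `A = z ∂f - z̄ ∂̄f` it gives `|A - (1 + α) f| < |A + (1 - α) f|`, which
means `re (A / f) > α`. For the coefficients of `L(f)` the bounds on `hₙ` and `gₙ` turn this sum
into a combination of the values at `1` of `W₁`, `W₂` and their derivatives.
-/

/-! ### Interlaced curves in the disk -/

lemma one_sub_exp_mul_I (θ : ℝ) :
    1 - exp (θ * I) = (2 * Real.sin (θ / 2) : ℝ) * exp (((θ - π) / 2 : ℝ) * I) := by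
  have hθ : (θ : ℂ) * I = (θ / 2 : ℝ) * I + (θ / 2 : ℝ) * I := by push_cast; ring
  have hsub : (((θ - π) / 2 : ℝ) : ℂ) * I = (θ / 2 : ℝ) * I - π / 2 * I := by push_cast; ring
  have hsq := sin_sq_add_cos_sq ((θ / 2 : ℝ) : ℂ)
  rw [hθ, hsub, exp_add, exp_sub, exp_pi_div_two_mul_I, exp_mul_I, div_I]
  push_cast at hsq ⊢
  linear_combination -hsq + sin (θ / 2 : ℂ) ^ 2 * I_sq

lemma arg_one_sub_exp_mul_I {θ : ℝ} (h₀ : 0 < θ) (h₁ : θ < 2 * π) :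
    (1 - exp (θ * I)).arg = (θ - π) / 2 := by
  have hsin := Real.sin_pos_of_pos_of_lt_pi (half_pos h₀) (by linarith)
  rw [one_sub_exp_mul_I, arg_real_mul _ (by positivity), exp_mul_I,
    arg_cos_add_sin_mul_I ⟨by linarith, by linarith⟩]

lemma exp_mul_I_ne_exp_mul_I {a b : ℝ} (hab : a < b) (hba : b < a + 2 * π) :
    exp (a * I) ≠ exp (b * I) := by
  intro h
  have hsin := Real.sin_pos_of_pos_of_lt_pi (x := (b - a) / 2) (by linarith) (by linarith)
  have hone : exp ((b - a : ℝ) * I) = 1 := by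
    rw [ofReal_sub, sub_mul, exp_sub, ← h, div_self (exp_ne_zero _)]
  have hzero := one_sub_exp_mul_I (b - a)
  rw [hone, sub_self, eq_comm] at hzero
  simp [exp_ne_zero, hsin.ne', -ofReal_sin, -ofReal_div, -ofReal_sub] at hzero

lemma re_one_sub_pos {z : ℂ} (hz : ‖z‖ ≤ 1) (hne : z ≠ 1) : 0 < (1 - z).re := by
  have hsq : z.re * z.re + z.im * z.im ≤ 1 := by
    rw [← normSq_apply, ← Complex.sq_norm]
    exact pow_le_one₀ (norm_nonneg z) hz
  rw [sub_re, one_re, sub_pos]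
  refine lt_of_le_of_ne ((re_le_norm z).trans hz) fun hre => hne (Complex.ext hre ?_)
  rw [hre] at hsq
  rw [one_im]
  nlinarith

/-- The inscribed angle theorem: seen from the point `exp (x * I)` of the circle, a curve in the
closed disk from `exp (a * I)` to `exp (b * I)` turns by half of the central angle `b - a`. -/
lemma im_log_lift_sub {a b x : ℝ} (ha : x < a) (ha' : a < x + 2 * π) (hb : x < b)
    (hb' : b < x + 2 * π) (w : Path (exp (a * I)) (exp (b * I))) (hw : ∀ t, ‖w t‖ ≤ 1)
    (hne : ∀ t, w t ≠ exp (x * I)) {L : unitInterval → ℂ} (hL : Continuous L)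
    (hexp : ∀ t, exp (L t) = exp (x * I) - w t) : (L 1).im - (L 0).im = (b - a) / 2 := by
  have hrot : ∀ c : ℝ, exp (-(x * I)) * exp (c * I) = exp ((c - x : ℝ) * I) := fun c => by
    rw [← exp_add]; push_cast; ring_nf
  have hfactor : ∀ z, exp (x * I) * (1 - exp (-(x * I)) * z) = exp (x * I) - z := fun z => by
    rw [mul_sub, ← mul_assoc, ← exp_add]; simp
  have hslit : ∀ t, 1 - exp (-(x * I)) * w t ∈ slitPlane := fun t => by
    refine Or.inl (re_one_sub_pos ?_ fun h => hne t ?_)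
    · rw [norm_mul, ← neg_mul, ← ofReal_neg, norm_exp_ofReal_mul_I, one_mul]
      exact hw t
    · simpa [h, sub_eq_zero, eq_comm (a := (0 : ℂ)), eq_comm (a := w t)] using hfactor (w t)
  have hconst := isCoveringMap_exp.const_of_comp
    (g := fun t => L t - log (1 - exp (-(x * I)) * w t))
    (hL.sub (Continuous.clog (by fun_prop) hslit))
    (fun s t => Subtype.ext <| by
      have h : ∀ t, exp (L t - log (1 - exp (-(x * I)) * w t)) = exp (x * I) := fun t => by
        rw [exp_sub, exp_log (slitPlane_ne_zero (hslit t)), hexp, ← hfactor,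
          mul_div_cancel_right₀ _ (slitPlane_ne_zero (hslit t))]
      exact (h s).trans (h t).symm) 1 0
  have him := congrArg im hconst
  simp only [sub_im, log_im, w.source, w.target, hrot] at him
  rw [arg_one_sub_exp_mul_I (by linarith) (by linarith),
    arg_one_sub_exp_mul_I (by linarith) (by linarith)] at him
  linarith

/-- If the curves did not meet, the sum of the variations of the argument of `γ s - β t` along the
sides of the square would be both `0` and `2 * π`. -/
theorem exists_eq_of_interlaced {s₁ s₂ s₃ s₄ : ℝ} (h₁₂ : s₁ < s₂) (h₂₃ : s₂ < s₃) (h₃₄ : s₃ < s₄)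
    (h₄₁ : s₄ < s₁ + 2 * π) (γ : Path (exp (s₁ * I)) (exp (s₃ * I)))
    (β : Path (exp (s₂ * I)) (exp (s₄ * I))) (hγ : ∀ t, ‖γ t‖ ≤ 1) (hβ : ∀ t, ‖β t‖ ≤ 1) :
    ∃ s t, γ s = β t := by
  by_contra! hne
  have hper : ∀ s : ℝ, exp (s * I) = exp ((s + 2 * π : ℝ) * I) := fun s => by
    push_cast; rw [add_mul, exp_add, exp_two_pi_mul_I, mul_one]
  have := (convex_univ (𝕜 := ℝ) (E := ℝ × ℝ)).contractibleSpace univ_nonempty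
  obtain ⟨L, hL, hexp⟩ := exists_continuousOn_eqOn_exp_comp (U := (univ : Set (ℝ × ℝ)))
    (SimplyConnectedSpace.ofContractible _) isOpen_univ
    (g := fun p => γ.extend p.1 - β.extend p.2) (by fun_prop) (by
      rintro ⟨p, -, hp⟩
      exact hne _ _ (sub_eq_zero.1 hp))
  rw [continuousOn_univ] at hL
  replace hexp : ∀ s t : unitInterval, exp (L (s, t)) = γ s - β t := fun s t => by
    simpa using hexp (mem_univ (s.1, t.1))
  have hleft := im_log_lift_sub h₁₂ (by linarith) (by linarith) h₄₁ β hβ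
    (fun t => by simpa using (hne 0 t).symm) (L := fun t => L (0, t)) (by fun_prop)
    (fun t => by simpa using hexp 0 t)
  have hright := im_log_lift_sub (x := s₃) (a := s₂ + 2 * π) (by linarith) (by linarith) h₃₄
    (by linarith) (β.cast (hper s₂).symm rfl) hβ (fun t => by simpa using (hne 1 t).symm)
    (L := fun t => L (1, t)) (by fun_prop) (fun t => by simpa using hexp 1 t)
  have hbottom := im_log_lift_sub (x := s₂) (a := s₁ + 2 * π) (by linarith) (by linarith) h₂₃
    (by linarith) (γ.cast (hper s₁).symm rfl) hγ (fun s => by simpa using hne s 0)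
    (L := fun s => L (s, 0) + π * I) (by fun_prop)
    (fun s => by simpa [exp_add] using congrArg Neg.neg (hexp s 0))
  have htop := im_log_lift_sub (x := s₄) (a := s₁ + 2 * π) (b := s₃ + 2 * π) (by linarith)
    (by linarith) (by linarith) (by linarith) (γ.cast (hper s₁).symm (hper s₃).symm) hγ
    (fun s => by simpa using hne s 1) (L := fun s => L (s, 1) + π * I) (by fun_prop)
    (fun s => by simpa [exp_add] using congrArg Neg.neg (hexp s 1))
  simp only [add_im, Icc.coe_zero, Icc.coe_one] at hleft hright hbottom htop
  linarith [Real.pi_pos]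

lemma exists_joinedIn_of_eventually_radius_mem {A : Set ℂ} {t : ℝ}
    (h : ∀ᶠ r : ℝ in 𝓝[<] 1, r * exp (t * I) ∈ A) :
    ∃ x ∈ A, JoinedIn (insert (exp (t * I)) A) (exp (t * I)) x := by
  obtain ⟨r₀, hr₀, hr⟩ := (mem_nhdsLT_iff_exists_Ioo_subset).1 h
  obtain ⟨r₁, hr₁⟩ := nonempty_Ioo.2 (mem_Iio.1 hr₀)
  have hmem : ∀ r ∈ Ioc r₀ 1, (r : ℂ) * exp (t * I) ∈ insert (exp (t * I)) A := fun r h => by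
    rcases h.2.eq_or_lt with rfl | h1
    · simp
    · exact mem_insert_of_mem _ (hr ⟨h.1, h1⟩)
  refine ⟨r₁ * exp (t * I), hr hr₁, JoinedIn.of_segment_subset ?_⟩
  rintro _ ⟨a, b, ha, hb, hab, rfl⟩
  have hcomb : a • exp (t * I) + b • (r₁ * exp (t * I)) = (a + b * r₁ : ℝ) * exp (t * I) := by
    simp only [real_smul]; push_cast; ring
  obtain rfl : a = 1 - b := by linarith
  rw [hcomb]
  exact hmem _ ⟨by nlinarith [hr₁.1, hr₁.2], by nlinarith [hr₁.2]⟩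

lemma exists_path_of_eventually_radius_mem {A : Set ℂ}
    (hA : ∀ x ∈ A, ∀ y ∈ A, JoinedIn A x y) {s t : ℝ}
    (hs : ∀ᶠ r : ℝ in 𝓝[<] 1, r * exp (s * I) ∈ A)
    (ht : ∀ᶠ r : ℝ in 𝓝[<] 1, r * exp (t * I) ∈ A) :
    ∃ γ : Path (exp (s * I)) (exp (t * I)), ∀ x, γ x ∈ A ∪ {exp (s * I), exp (t * I)} := by
  obtain ⟨x, hx, hxs⟩ := exists_joinedIn_of_eventually_radius_mem hs
  obtain ⟨y, hy, hyt⟩ := exists_joinedIn_of_eventually_radius_mem ht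
  exact ((hxs.mono (by grind)).trans ((hA x hx y hy).mono (by grind))).trans
    (hyt.symm.mono (by grind))

theorem not_disjoint_of_interlaced_radii {A B : Set ℂ} (hA : A ⊆ ball 0 1) (hB : B ⊆ ball 0 1)
    (hAj : ∀ x ∈ A, ∀ y ∈ A, JoinedIn A x y) (hBj : ∀ x ∈ B, ∀ y ∈ B, JoinedIn B x y)
    {t₁ t₂ t₃ t₄ : ℝ} (h₁₂ : t₁ < t₂) (h₂₃ : t₂ < t₃) (h₃₄ : t₃ < t₄) (h₄₁ : t₄ < t₁ + 2 * π)
    (h₁ : ∀ᶠ r : ℝ in 𝓝[<] 1, r * exp (t₁ * I) ∈ A)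
    (h₂ : ∀ᶠ r : ℝ in 𝓝[<] 1, r * exp (t₂ * I) ∈ B)
    (h₃ : ∀ᶠ r : ℝ in 𝓝[<] 1, r * exp (t₃ * I) ∈ A)
    (h₄ : ∀ᶠ r : ℝ in 𝓝[<] 1, r * exp (t₄ * I) ∈ B) : ¬Disjoint A B := by
  intro hAB
  obtain ⟨γ, hγ⟩ := exists_path_of_eventually_radius_mem hAj h₁ h₃
  obtain ⟨β, hβ⟩ := exists_path_of_eventually_radius_mem hBj h₂ h₄
  have hnorm : ∀ {C : Set ℂ}, C ⊆ ball 0 1 → ∀ {s t : ℝ} {z : ℂ},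
      z ∈ C ∪ {exp (s * I), exp (t * I)} → ‖z‖ ≤ 1 := by
    rintro C hC s t z (hz | rfl | rfl)
    · exact (mem_ball_zero_iff.1 (hC hz)).le
    all_goals rw [norm_exp_ofReal_mul_I]
  have hnotMem : ∀ {C : Set ℂ}, C ⊆ ball 0 1 → ∀ x : ℝ, exp (x * I) ∉ C := fun hC x hx => by
    simpa [norm_exp_ofReal_mul_I] using hC hx
  obtain ⟨s, t, hst⟩ := exists_eq_of_interlaced h₁₂ h₂₃ h₃₄ h₄₁ γ β (fun x => hnorm hA (hγ x))
    (fun x => hnorm hB (hβ x))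
  rcases hst ▸ hγ s with hs | hs | hs <;> rcases hβ t with ht | ht | ht
  · exact disjoint_left.1 hAB hs ht
  · exact hnotMem hA _ (ht ▸ hs)
  · exact hnotMem hA _ (ht ▸ hs)
  · exact hnotMem hB _ (hs ▸ ht)
  · exact exp_mul_I_ne_exp_mul_I h₁₂ (by linarith) (hs.symm.trans ht)
  · exact exp_mul_I_ne_exp_mul_I (by linarith) h₄₁ (hs.symm.trans ht)
  · exact hnotMem hB _ (hs ▸ ht)
  · exact exp_mul_I_ne_exp_mul_I h₂₃ (by linarith) (ht.symm.trans hs)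
  · exact exp_mul_I_ne_exp_mul_I h₃₄ (by linarith) (hs.symm.trans ht)

/-! ### The Riemann mapping theorem for bounded domains -/

lemma equicontinuousAt_of_norm_le {ι : Type*} {U : Set ℂ} (hU : IsOpen U) {F : ι → ℂ → ℂ}
    (hF : ∀ i, DifferentiableOn ℂ (F i) U) {M : ℝ} (hM : ∀ i, ∀ z ∈ U, ‖F i z‖ ≤ M) {z : ℂ}
    (hz : z ∈ U) : EquicontinuousAt F z := by
  obtain ⟨ρ, hρ, hball⟩ := Metric.isOpen_iff.1 hU z hz
  refine Metric.equicontinuousAt_of_continuity_modulus (fun w => 2 * M / ρ * dist w z) ?_ F ?_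
  · have h : Continuous fun w => 2 * M / ρ * dist w z := by fun_prop
    simpa using h.tendsto z
  · filter_upwards [ball_mem_nhds z hρ] with w hw i
    rw [dist_comm]
    refine dist_le_div_mul_dist_of_mapsTo_ball ((hF i).mono hball) (fun x hx => ?_) hw
    rw [mem_closedBall, dist_eq_norm]
    linarith [norm_sub_le (F i x) (F i z), hM i x (hball hx), hM i z hz]

theorem exists_tendstoLocallyUniformlyOn_of_norm_le {ι : Type*} (𝒰 : Ultrafilter ι) {U : Set ℂ}
    (hU : IsOpen U) {F : ι → ℂ → ℂ} (hF : ∀ i, DifferentiableOn ℂ (F i) U) {M : ℝ}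
    (hM : ∀ i, ∀ z ∈ U, ‖F i z‖ ≤ M) : ∃ f : ℂ → ℂ, TendstoLocallyUniformlyOn F f 𝒰 U := by
  have hlim : ∀ z ∈ U, ∃ y, Tendsto (fun i => F i z) 𝒰 (𝓝 y) := fun z hz => by
    obtain ⟨y, -, hy⟩ := (isCompact_closedBall (0 : ℂ) M).ultrafilter_le_nhds
      (𝒰.map fun i => F i z) (by
        rw [le_principal_iff, Ultrafilter.mem_coe, Ultrafilter.mem_map]
        exact univ_mem' fun i => by simpa using hM i z hz)
    exact ⟨y, hy⟩
  choose! f hf using hlim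
  refine ⟨f, (tendstoLocallyUniformlyOn_iff_forall_isCompact hU).2 fun K hKU hK => ?_⟩
  have hpi := (EquicontinuousOn.tendsto_uniformOnFun_iff_pi' (𝔖 := {K})
    (by simpa using hK) (by
      rintro _ rfl z hz
      exact (equicontinuousAt_of_norm_le hU hF hM (hKU hz)).equicontinuousWithinAt _) 𝒰 f).2
    (tendsto_pi_nhds.2 fun z => hf z (hKU (by simpa using z.2)))
  exact UniformOnFun.tendsto_iff_tendstoUniformlyOn.1 hpi K rfl

lemma le_norm_of_forall_mem_sphere_le_norm {F : ℂ → ℂ} {z : ℂ} {r m : ℝ} (hr : 0 < r) (hm : 0 < m)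
    (hF : DifferentiableOn ℂ F (closedBall z r)) (h0 : ∀ w ∈ closedBall z r, F w ≠ 0)
    (hsphere : ∀ w ∈ sphere z r, m ≤ ‖F w‖) : m ≤ ‖F z‖ := by
  have hd : DiffContOnCl ℂ (fun w => (F w)⁻¹) (ball z r) := by
    refine DifferentiableOn.diffContOnCl ?_
    rw [closure_ball _ hr.ne']
    exact hF.inv h0
  have hle := norm_le_of_forall_mem_frontier_norm_le isBounded_ball hd (C := m⁻¹) (fun w hw => by
    rw [frontier_ball _ hr.ne'] at hw
    rw [norm_inv]
    exact inv_anti₀ hm (hsphere w hw)) (subset_closure (mem_ball_self hr))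
  rwa [norm_inv, inv_le_inv₀ (norm_pos_iff.2 (h0 z (mem_closedBall_self hr.le))) hm] at hle

theorem ne_zero_or_eqOn_zero_of_tendstoLocallyUniformlyOn {ι : Type*} {l : Filter ι} [l.NeBot]
    {U : Set ℂ} (hU : IsOpen U) (hUc : IsPreconnected U) {F : ι → ℂ → ℂ} {f : ℂ → ℂ}
    (hlim : TendstoLocallyUniformlyOn F f l U) (hF : ∀ i, DifferentiableOn ℂ (F i) U)
    (h0 : ∀ i, ∀ z ∈ U, F i z ≠ 0) : (∀ z ∈ U, f z ≠ 0) ∨ EqOn f 0 U := by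
  by_contra! hcon
  obtain ⟨⟨z₀, hz₀, hfz⟩, hne⟩ := hcon
  have hfd : DifferentiableOn ℂ f U := hlim.differentiableOn (Eventually.of_forall hF) hU
  have hfa : AnalyticOnNhd ℂ f U := hfd.analyticOnNhd hU
  have hisolated : ∀ᶠ z in 𝓝[≠] z₀, f z ≠ 0 :=
    (hfa z₀ hz₀).eventually_eq_zero_or_eventually_ne_zero.resolve_left fun h =>
      hne (hfa.eqOn_zero_of_preconnected_of_eventuallyEq_zero hUc hz₀ h)
  obtain ⟨r, hr, hball⟩ := Metric.nhds_basis_closedBall.eventually_iff.1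
    ((eventually_nhdsWithin_iff.1 hisolated).and (hU.mem_nhds hz₀))
  have hcb : closedBall z₀ r ⊆ U := fun z hz => (hball hz).2
  obtain ⟨w, hw, hmin⟩ := (isCompact_sphere z₀ r).exists_isMinOn
    (NormedSpace.sphere_nonempty.2 hr.le)
    (hfd.continuousOn.mono (sphere_subset_closedBall.trans hcb)).norm
  have hm : 0 < ‖f w‖ :=
    norm_pos_iff.2 ((hball (sphere_subset_closedBall hw)).1 (ne_of_mem_sphere hw hr.ne'))
  obtain ⟨i, hi⟩ := (Metric.tendstoUniformlyOn_iff.1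
    ((tendstoLocallyUniformlyOn_iff_tendstoUniformlyOn_of_compact
      (isCompact_closedBall z₀ r)).1 (hlim.mono hcb)) (‖f w‖ / 3) (by positivity)).exists
  have hle := le_norm_of_forall_mem_sphere_le_norm hr (m := 2 * ‖f w‖ / 3) (by positivity)
    ((hF i).mono hcb) (fun z hz => h0 i z (hcb hz)) fun z hz => by
      have hdist := hi z (sphere_subset_closedBall hz)
      have hwz : ‖f w‖ ≤ ‖f z‖ := hmin hz
      rw [dist_eq_norm] at hdist
      linarith [norm_sub_norm_le (f z) (F i z)]
  have hdist₀ := hi z₀ (mem_closedBall_self hr.le)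
  rw [hfz, dist_zero_left] at hdist₀
  linarith

theorem injOn_or_eqOn_const_of_tendstoLocallyUniformlyOn {ι : Type*} {l : Filter ι} [l.NeBot]
    {U : Set ℂ} (hU : IsOpen U) (hUc : IsPreconnected U) {F : ι → ℂ → ℂ} {f : ℂ → ℂ}
    (hlim : TendstoLocallyUniformlyOn F f l U) (hF : ∀ i, DifferentiableOn ℂ (F i) U)
    (hinj : ∀ i, InjOn (F i) U) : InjOn f U ∨ ∃ c, EqOn f (fun _ => c) U := by
  by_contra! hcon
  obtain ⟨hninj, hnconst⟩ := hcon
  simp only [InjOn, not_forall] at hninj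
  obtain ⟨z₁, hz₁, z₂, hz₂, heq, hne⟩ := hninj
  obtain ⟨r, hr, hball⟩ := Metric.nhds_basis_ball.eventually_iff.1
    ((hU.eventually_mem hz₂).and (eventually_ne_nhds (Ne.symm hne)))
  have hB : ball z₂ r ⊆ U := fun z hz => (hball hz).1
  have hfd : DifferentiableOn ℂ f U := hlim.differentiableOn (Eventually.of_forall hF) hU
  have hconst : TendstoLocallyUniformlyOn (fun i _ => F i z₁) (fun _ => f z₁) l (ball z₂ r) :=
    fun u hu z _ => ⟨univ, univ_mem, by
      filter_upwards [(hlim.tendsto_at hz₁).eventually (UniformSpace.ball_mem_nhds _ hu)]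
        with i hi w _ using hi⟩
  rcases ne_zero_or_eqOn_zero_of_tendstoLocallyUniformlyOn isOpen_ball
    (convex_ball z₂ r).isPreconnected ((hlim.mono hB).sub hconst)
    (fun i => ((hF i).mono hB).sub_const _)
    (fun i z hz h => (hball hz).2 (hinj i (hB hz) hz₁ (sub_eq_zero.1 h))) with h | h
  · exact h z₂ (mem_ball_self hr) (by simp [heq])
  · refine hnconst (f z₁) ((hfd.analyticOnNhd hU).eqOn_of_preconnected_of_eventuallyEq
      analyticOnNhd_const hUc hz₂ ?_)
    filter_upwards [ball_mem_nhds z₂ hr] with z hz using sub_eq_zero.1 (h hz)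

/-- The automorphism of the unit disk that sends `a` to `0`. -/
noncomputable def diskMobius (a z : ℂ) : ℂ := (z - a) / (1 - conj a * z)

lemma one_sub_conj_mul_ne_zero {a z : ℂ} (ha : ‖a‖ < 1) (hz : ‖z‖ < 1) : 1 - conj a * z ≠ 0 := by
  intro h
  have hnorm : ‖a‖ * ‖z‖ = 1 := by
    rw [← RCLike.norm_conj a, ← norm_mul, ← sub_eq_zero.1 h, norm_one]
  nlinarith [norm_nonneg a, norm_nonneg z]

lemma norm_diskMobius_lt_one {a z : ℂ} (ha : ‖a‖ < 1) (hz : ‖z‖ < 1) : ‖diskMobius a z‖ < 1 := by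
  have hsq : ‖1 - conj a * z‖ ^ 2 - ‖z - a‖ ^ 2 = (1 - ‖a‖ ^ 2) * (1 - ‖z‖ ^ 2) := by
    simp only [Complex.sq_norm, normSq_apply, sub_re, sub_im, mul_re, mul_im, conj_re, conj_im,
      one_re, one_im]
    ring
  have hpos : 0 < (1 - ‖a‖ ^ 2) * (1 - ‖z‖ ^ 2) := by
    apply mul_pos <;> nlinarith [norm_nonneg a, norm_nonneg z]
  rw [diskMobius, norm_div, div_lt_one (norm_pos_iff.2 (one_sub_conj_mul_ne_zero ha hz))]
  exact lt_of_pow_lt_pow_left₀ 2 (norm_nonneg _) (by linarith)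

lemma hasDerivAt_diskMobius {a z : ℂ} (ha : ‖a‖ < 1) (hz : ‖z‖ < 1) :
    HasDerivAt (diskMobius a) ((1 - ‖a‖ ^ 2) / (1 - conj a * z) ^ 2) z := by
  have h := ((hasDerivAt_id z).sub_const a).div
    (((hasDerivAt_id z).const_mul (conj a)).const_sub 1) (one_sub_conj_mul_ne_zero ha hz)
  convert! h using 1
  rw [← mul_conj', id]
  ring

lemma diskMobius_injOn {a : ℂ} (ha : ‖a‖ < 1) : InjOn (diskMobius a) (ball 0 1) := by
  intro z hz w hw h
  rw [mem_ball_zero_iff] at hz hw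
  rw [diskMobius, diskMobius, div_eq_div_iff (one_sub_conj_mul_ne_zero ha hz)
    (one_sub_conj_mul_ne_zero ha hw)] at h
  refine sub_eq_zero.1 ((mul_eq_zero.1 ?_).resolve_right (one_sub_conj_mul_ne_zero ha ha))
  linear_combination h

lemma diskMobius_eq_zero_iff {a z : ℂ} (ha : ‖a‖ < 1) (hz : ‖z‖ < 1) :
    diskMobius a z = 0 ↔ z = a := by
  rw [diskMobius, div_eq_zero_iff, or_iff_left (one_sub_conj_mul_ne_zero ha hz), sub_eq_zero]

lemma hasDerivAt_of_sq_eq {s g : ℂ → ℂ} {z g' : ℂ} (hs : ContinuousAt s z)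
    (hsg : ∀ w, s w ^ 2 = g w) (hg : HasDerivAt g g' z) (h0 : s z ≠ 0) :
    HasDerivAt s (g' / (2 * s z)) z := by
  rw [hasDerivAt_iff_tendsto_slope] at hg ⊢
  have hsum : Tendsto (fun w => s w + s z) (𝓝[≠] z) (𝓝 (2 * s z)) := by
    rw [two_mul]
    exact (hs.tendsto.add_const (s z)).mono_left nhdsWithin_le_nhds
  have hsum0 : 2 * s z ≠ 0 := mul_ne_zero two_ne_zero h0
  refine (hg.div hsum hsum0).congr' ?_
  filter_upwards [hsum.eventually_ne hsum0] with w hw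
  simp only [slope_def_field, Pi.div_apply, ← hsg]
  rw [div_right_comm, sq_sub_sq, mul_div_cancel_left₀ _ hw]

/-- Injective holomorphic maps of `U` into the unit disk. An injective holomorphic map has no
critical points; this is recorded as a field because it is immediate for all maps used here. -/
structure IsDiskEmbedding (U : Set ℂ) (ψ : ℂ → ℂ) : Prop where
  differentiableOn : DifferentiableOn ℂ ψ U
  mapsTo : MapsTo ψ U (ball 0 1)
  injOn : InjOn ψ U
  deriv_ne_zero : ∀ z ∈ U, deriv ψ z ≠ 0

namespace IsDiskEmbedding

variable {U : Set ℂ} {ψ : ℂ → ℂ}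

lemma norm_lt_one (h : IsDiskEmbedding U ψ) {z : ℂ} (hz : z ∈ U) : ‖ψ z‖ < 1 :=
  mem_ball_zero_iff.1 (h.mapsTo hz)

lemma hasDerivAt (h : IsDiskEmbedding U ψ) (hU : IsOpen U) {z : ℂ} (hz : z ∈ U) :
    HasDerivAt ψ (deriv ψ z) z :=
  (h.differentiableOn.differentiableAt (hU.mem_nhds hz)).hasDerivAt

lemma norm_deriv_le (h : IsDiskEmbedding U ψ) {z : ℂ} {r : ℝ} (hr : 0 < r) (hz : ψ z = 0)
    (hU : ball z r ⊆ U) : ‖deriv ψ z‖ ≤ 1 / r :=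
  norm_deriv_le_div_of_mapsTo_ball (h.differentiableOn.mono hU)
    (fun w hw => by rw [hz]; exact ball_subset_closedBall (h.mapsTo (hU hw))) hr

lemma deriv_diskMobius_comp (h : IsDiskEmbedding U ψ) (hU : IsOpen U) {a z : ℂ} (ha : ‖a‖ < 1)
    (hz : z ∈ U) : deriv (fun z => diskMobius a (ψ z)) z =
      (1 - ‖a‖ ^ 2) / (1 - conj a * ψ z) ^ 2 * deriv ψ z :=
  ((hasDerivAt_diskMobius ha (h.norm_lt_one hz)).comp z (h.hasDerivAt hU hz)).deriv

lemma diskMobius_comp (h : IsDiskEmbedding U ψ) (hU : IsOpen U) {a : ℂ} (ha : ‖a‖ < 1) :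
    IsDiskEmbedding U fun z => diskMobius a (ψ z) where
  differentiableOn z hz := ((hasDerivAt_diskMobius ha (h.norm_lt_one hz)).comp z
    (h.hasDerivAt hU hz)).differentiableAt.differentiableWithinAt
  mapsTo z hz := mem_ball_zero_iff.2 (norm_diskMobius_lt_one ha (h.norm_lt_one hz))
  injOn := (diskMobius_injOn ha).comp h.injOn h.mapsTo
  deriv_ne_zero z hz := by
    rw [h.deriv_diskMobius_comp hU ha hz, ← mul_conj']
    exact mul_ne_zero (div_ne_zero (by simpa [mul_comm] using one_sub_conj_mul_ne_zero ha ha)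
      (pow_ne_zero _ (one_sub_conj_mul_ne_zero ha (h.norm_lt_one hz)))) (h.deriv_ne_zero z hz)

lemma const_mul (h : IsDiskEmbedding U ψ) {c : ℂ} (hc : ‖c‖ = 1) :
    IsDiskEmbedding U fun z => c * ψ z where
  differentiableOn := h.differentiableOn.const_mul c
  mapsTo z hz := by simpa [hc] using h.mapsTo hz
  injOn x hx y hy hxy := h.injOn hx hy (mul_left_cancel₀ (norm_ne_zero_iff.1 (by simp [hc])) hxy)
  deriv_ne_zero z hz := by
    rw [deriv_const_mul_field]
    exact mul_ne_zero (norm_ne_zero_iff.1 (by simp [hc])) (h.deriv_ne_zero z hz)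

lemma exists_sqrt (h : IsDiskEmbedding U ψ) (hU : IsOpen U) (hUs : IsSimplyConnected U)
    (h0 : ∀ z ∈ U, ψ z ≠ 0) : ∃ s, IsDiskEmbedding U s ∧ (∀ z, s z ^ 2 = ψ z) ∧
      ∀ z ∈ U, deriv s z = deriv ψ z / (2 * s z) := by
  obtain ⟨s, hsc, hs⟩ := exists_continuousOn_pow_eq hUs hU h.differentiableOn.continuousOn
    (by rintro ⟨z, hz, hgz⟩; exact h0 z hz hgz) two_ne_zero
  have hs0 : ∀ z ∈ U, s z ≠ 0 := fun z hz hsz => h0 z hz (by rw [← hs z, hsz]; simp)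
  have hsd : ∀ z ∈ U, HasDerivAt s (deriv ψ z / (2 * s z)) z := fun z hz =>
    hasDerivAt_of_sq_eq (hsc.continuousAt (hU.mem_nhds hz)) hs (h.hasDerivAt hU hz) (hs0 z hz)
  refine ⟨s, ⟨fun z hz => (hsd z hz).differentiableAt.differentiableWithinAt, fun z hz => ?_,
    fun x hx y hy hxy => h.injOn hx hy (by rw [← hs, ← hs, hxy]), fun z hz => ?_⟩, hs,
    fun z hz => (hsd z hz).deriv⟩
  · rw [mem_ball_zero_iff, ← sq_lt_one_iff₀ (norm_nonneg _), ← norm_pow, hs]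
    exact h.norm_lt_one hz
  · rw [(hsd z hz).deriv]
    exact div_ne_zero (h.deriv_ne_zero z hz) (mul_ne_zero two_ne_zero (hs0 z hz))

/-- Following `ψ` by the automorphism `diskMobius w`, a square root and another automorphism
multiplies the derivative at `z₀` by a factor of modulus `(1 + ‖w‖) / (2 √‖w‖) > 1`. -/
lemma exists_norm_deriv_gt (h : IsDiskEmbedding U ψ) (hU : IsOpen U) (hUs : IsSimplyConnected U)
    {z₀ : ℂ} (hz₀ : z₀ ∈ U) (hψ : ψ z₀ = 0) {w : ℂ} (hw : w ∈ ball (0 : ℂ) 1) (hwU : w ∉ ψ '' U) :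
    ∃ ψ₂, IsDiskEmbedding U ψ₂ ∧ ψ₂ z₀ = 0 ∧ ‖deriv ψ z₀‖ < ‖deriv ψ₂ z₀‖ := by
  rw [mem_ball_zero_iff] at hw
  have hMob := h.diskMobius_comp hU hw
  have hMob0 : ∀ z ∈ U, diskMobius w (ψ z) ≠ 0 := fun z hz h0 =>
    hwU ⟨z, hz, (diskMobius_eq_zero_iff hw (h.norm_lt_one hz)).1 h0⟩
  obtain ⟨s, hs, hsq, hs'⟩ := hMob.exists_sqrt hU hUs hMob0
  have hs1 := hs.norm_lt_one hz₀
  refine ⟨fun z => diskMobius (s z₀) (s z), hs.diskMobius_comp hU hs1, by simp [diskMobius], ?_⟩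
  have hnorm : ‖s z₀‖ ^ 2 = ‖w‖ := by rw [← norm_pow, hsq, hψ]; simp [diskMobius]
  have hderiv : deriv (fun z => diskMobius (s z₀) (s z)) z₀ =
      (1 + ‖s z₀‖ ^ 2) / (2 * s z₀) * deriv ψ z₀ := by
    have hne := one_sub_conj_mul_ne_zero hs1 hs1
    have hne₀ : s z₀ ≠ 0 := fun h0 => hMob0 z₀ hz₀ (by rw [← hsq, h0]; simp)
    rw [conj_mul'] at hne
    rw [hs.deriv_diskMobius_comp hU hs1 hz₀, hs' z₀ hz₀, h.deriv_diskMobius_comp hU hw hz₀, hψ,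
      ← hnorm, conj_mul']
    push_cast
    field_simp
    ring
  have hpos : 0 < ‖s z₀‖ := norm_pos_iff.2 fun h0 => hMob0 z₀ hz₀ (by rw [← hsq, h0]; simp)
  have hgt : 1 < (1 + ‖s z₀‖ ^ 2) / (2 * ‖s z₀‖) := by
    rw [one_lt_div (by positivity)]
    nlinarith [mul_pos (sub_pos.2 hs1) (sub_pos.2 hs1)]
  have hcast : ‖(1 + ‖s z₀‖ ^ 2 : ℂ)‖ = 1 + ‖s z₀‖ ^ 2 := by
    exact_mod_cast Complex.norm_of_nonneg (by positivity : 0 ≤ 1 + ‖s z₀‖ ^ 2)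
  rw [hderiv, norm_mul, norm_div, norm_mul, hcast, Complex.norm_ofNat]
  exact lt_mul_of_one_lt_left (norm_pos_iff.2 (h.deriv_ne_zero z₀ hz₀)) hgt

lemma of_tendstoLocallyUniformlyOn {ι : Type*} {l : Filter ι} [l.NeBot] (hU : IsOpen U)
    (hUc : IsPreconnected U) {F : ι → ℂ → ℂ} (hF : ∀ i, IsDiskEmbedding U (F i))
    (hlim : TendstoLocallyUniformlyOn F ψ l U) {z₀ : ℂ} (hz₀ : z₀ ∈ U) (h0 : deriv ψ z₀ ≠ 0) :
    IsDiskEmbedding U ψ := by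
  have hFd := fun i => (hF i).differentiableOn
  have hψd := hlim.differentiableOn (Eventually.of_forall hFd) hU
  have hderiv : ∀ z ∈ U, deriv ψ z ≠ 0 :=
    (ne_zero_or_eqOn_zero_of_tendstoLocallyUniformlyOn hU hUc
      (hlim.deriv (Eventually.of_forall hFd) hU) (fun i => (hFd i).deriv hU)
      (fun i => (hF i).deriv_ne_zero)).resolve_right fun h => h0 (h hz₀)
  refine ⟨hψd, fun z hz => ?_, ?_, hderiv⟩
  · have himage : ψ '' U ⊆ closedBall 0 1 := by
      rintro _ ⟨y, hy, rfl⟩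
      exact mem_closedBall_zero_iff.2 (le_of_tendsto (hlim.tendsto_at hy).norm
        (Eventually.of_forall fun i => ((hF i).norm_lt_one hy).le))
    have hnhds : ψ '' U ∈ 𝓝 (ψ z) := by
      rw [← (hψd.analyticOnNhd hU z hz).hasStrictDerivAt.map_nhds_eq (hderiv z hz)]
      exact image_mem_map (hU.mem_nhds hz)
    rw [← interior_closedBall _ one_ne_zero, mem_interior_iff_mem_nhds]
    exact mem_of_superset hnhds himage
  · refine (injOn_or_eqOn_const_of_tendstoLocallyUniformlyOn hU hUc hlim hFd
      fun i => (hF i).injOn).resolve_right ?_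
    rintro ⟨c, hc⟩
    exact h0 (by rw [(hc.eventuallyEq_of_mem (hU.mem_nhds hz₀)).deriv_eq, deriv_const])

lemma exists_extremal (hU : IsOpen U) (hUc : IsPreconnected U) (h0 : (0 : ℂ) ∈ U)
    (hUb : U ⊆ ball 0 1) : ∃ ψ, IsDiskEmbedding U ψ ∧ ψ 0 = 0 ∧
      ∀ ψ₂, IsDiskEmbedding U ψ₂ → ψ₂ 0 = 0 → ‖deriv ψ₂ 0‖ ≤ ‖deriv ψ 0‖ := by
  obtain ⟨r, hr, hrU⟩ := Metric.isOpen_iff.1 hU 0 h0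
  set S : Set ℝ := (fun ψ => ‖deriv ψ 0‖) '' {ψ | IsDiskEmbedding U ψ ∧ ψ 0 = 0}
  have h1S : (1 : ℝ) ∈ S :=
    ⟨id, ⟨⟨differentiableOn_id, hUb, injOn_id _, by simp⟩, rfl⟩, by simp⟩
  have hbdd : BddAbove S :=
    ⟨1 / r, by rintro _ ⟨ψ, ⟨hψ, hψ0⟩, rfl⟩; exact hψ.norm_deriv_le hr hψ0 hrU⟩
  obtain ⟨x, -, hxt, hxS⟩ := exists_seq_tendsto_sSup ⟨1, h1S⟩ hbdd
  choose F hF hFx using hxS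
  have hFd := fun i => (hF i).1.differentiableOn
  obtain ⟨ψ, hlim⟩ := exists_tendstoLocallyUniformlyOn_of_norm_le (hyperfilter ℕ) hU hFd
    (fun i z hz => ((hF i).1.norm_lt_one hz).le)
  have hderiv : ‖deriv ψ 0‖ = sSup S := by
    refine tendsto_nhds_unique
      ((hlim.deriv (Eventually.of_forall hFd) hU).tendsto_at h0).norm ?_
    simp only [Function.comp, hFx]
    exact hxt.mono_left Nat.hyperfilter_le_atTop
  have hne : deriv ψ 0 ≠ 0 :=
    norm_pos_iff.1 (by rw [hderiv]; exact zero_lt_one.trans_le (le_csSup hbdd h1S))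
  have hψ0 : ψ 0 = 0 := tendsto_nhds_unique (hlim.tendsto_at h0) (by
    simp only [fun i => (hF i).2]
    exact tendsto_const_nhds)
  exact ⟨ψ, of_tendstoLocallyUniformlyOn hU hUc (fun i => (hF i).1) hlim h0 hne, hψ0,
    fun ψ₂ h₂ h₂0 => hderiv ▸ le_csSup hbdd ⟨ψ₂, ⟨h₂, h₂0⟩, rfl⟩⟩

lemma differentiableOn_of_leftInvOn (h : IsDiskEmbedding U ψ) (hU : IsOpen U) {φ : ℂ → ℂ}
    (hφ : LeftInvOn φ ψ U) : DifferentiableOn ℂ φ (ψ '' U) := by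
  rintro _ ⟨z, hz, rfl⟩
  have hstrict := (h.differentiableOn.analyticOnNhd hU z hz).hasStrictDerivAt
  exact (hstrict.to_local_left_inverse (h.deriv_ne_zero z hz)
    (mem_of_superset (hU.mem_nhds hz) hφ)).hasDerivAt.differentiableAt.differentiableWithinAt

end IsDiskEmbedding

theorem exists_riemannMap {U : Set ℂ} (hU : IsOpen U) (hUs : IsSimplyConnected U)
    (h0 : (0 : ℂ) ∈ U) (hUb : U ⊆ ball 0 1) :
    ∃ φ ψ : ℂ → ℂ, DifferentiableOn ℂ φ (ball 0 1) ∧ DifferentiableOn ℂ ψ U ∧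
      MapsTo φ (ball 0 1) U ∧ MapsTo ψ U (ball 0 1) ∧ LeftInvOn ψ φ (ball 0 1) ∧
      LeftInvOn φ ψ U ∧ φ 0 = 0 ∧ ψ 0 = 0 ∧ ∃ ρ : ℝ, 0 < ρ ∧ deriv ψ 0 = ρ := by
  obtain ⟨ψ, h, hψ0, hext⟩ := IsDiskEmbedding.exists_extremal hU
    hUs.isPathConnected.isConnected.isPreconnected h0 hUb
  have hd0 := h.deriv_ne_zero 0 h0
  set c : ℂ := ‖deriv ψ 0‖ / deriv ψ 0 with hc
  have hcn : ‖c‖ = 1 := by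
    rw [hc, norm_div, norm_real, norm_norm, div_self (norm_ne_zero_iff.2 hd0)]
  have hcψ := h.const_mul hcn
  have hcψ0 : c * ψ 0 = 0 := by rw [hψ0, mul_zero]
  have hsurj : ∀ w ∈ ball (0 : ℂ) 1, ∃ z ∈ U, c * ψ z = w := by
    intro w hw
    by_contra hcon
    obtain ⟨ψ₂, h₂, h₂0, hlt⟩ := hcψ.exists_norm_deriv_gt hU hUs h0 hcψ0 hw hcon
    rw [deriv_const_mul_field, norm_mul, hcn, one_mul] at hlt
    exact hlt.not_ge (hext ψ₂ h₂ h₂0)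
  choose! φ hφU hφ using hsurj
  have hφψ : LeftInvOn φ (fun z => c * ψ z) U := fun z hz =>
    hcψ.injOn (hφU _ (hcψ.mapsTo hz)) hz (hφ _ (hcψ.mapsTo hz))
  have hφ0 : φ 0 = 0 := by simpa [hψ0] using hφψ h0
  refine ⟨φ, fun z => c * ψ z, (hcψ.differentiableOn_of_leftInvOn hU hφψ).mono
    fun w hw => ⟨φ w, hφU w hw, hφ w hw⟩, hcψ.differentiableOn, hφU, hcψ.mapsTo, hφ, hφψ,
    hφ0, hcψ0, ‖deriv ψ 0‖, norm_pos_iff.2 hd0, ?_⟩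
  rw [deriv_const_mul_field, hc, div_mul_cancel₀ _ hd0]

/-! ### Radial limits of univalent maps with finite area -/

lemma exists_tendsto_nhdsLT_of_hasDerivAt_of_integrableOn {E : Type*} [NormedAddCommGroup E]
    [NormedSpace ℝ E] [CompleteSpace E] {f f' : ℝ → E} {a b : ℝ} (hab : a < b)
    (hf : ∀ x ∈ Ioo a b, HasDerivAt f (f' x) x) (hint : IntegrableOn f' (Ioo a b)) :
    ∃ y, Tendsto f (𝓝[<] b) (𝓝 y) := by
  obtain ⟨c, hac, hcb⟩ := exists_between hab
  have hcb_int : IntervalIntegrable f' volume c b := by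
    rw [intervalIntegrable_iff_integrableOn_Ioo_of_le hcb.le]
    exact hint.mono_set (Ioo_subset_Ioo_left hac.le)
  have hcont := intervalIntegral.continuousOn_primitive_interval' hcb_int left_mem_uIcc
  rw [uIcc_of_le hcb.le] at hcont
  have hprimitive : Tendsto (fun r => ∫ x in c..r, f' x) (𝓝[<] b) (𝓝 (∫ x in c..b, f' x)) := by
    refine (hcont b (right_mem_Icc.2 hcb.le)).tendsto.mono_left ?_
    rw [← nhdsWithin_Ioo_eq_nhdsLT hcb]
    exact nhdsWithin_mono _ Ioo_subset_Icc_self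
  refine ⟨f c + ∫ x in c..b, f' x, (hprimitive.const_add _).congr' ?_⟩
  filter_upwards [Ioo_mem_nhdsLT hcb] with r hr
  rw [intervalIntegral.integral_eq_sub_of_hasDerivAt (f := f), add_sub_cancel]
  · rw [uIcc_of_le hr.1.le]
    exact fun x hx => hf x ⟨hac.trans_le hx.1, hx.2.trans_lt hr.2⟩
  · refine hcb_int.mono_set ?_
    rw [uIcc_of_le hr.1.le, uIcc_of_le hcb.le]
    exact Icc_subset_Icc_right hr.2.le

lemma abs_det_restrictScalars_smul_one (a : ℂ) :
    |(a • (1 : ℂ →L[ℝ] ℂ)).det| = ‖a‖ ^ 2 := by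
  have hmul : ((a • (1 : ℂ →L[ℝ] ℂ) : ℂ →L[ℝ] ℂ) : ℂ →ₗ[ℝ] ℂ) = LinearMap.mul ℝ ℂ a := by
    ext; simp
  have hdet : LinearMap.det (LinearMap.mul ℝ ℂ a) = normSq a :=
    (Algebra.norm_apply ℝ a).symm.trans (Algebra.norm_complex_apply a)
  rw [ContinuousLinearMap.det, hmul, hdet, abs_of_nonneg (normSq_nonneg _), normSq_eq_norm_sq]

lemma lintegral_norm_deriv_sq_eq_volume_image {φ : ℂ → ℂ} {U : Set ℂ} (hU : IsOpen U)
    (hφ : DifferentiableOn ℂ φ U) (hinj : InjOn φ U) :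
    ∫⁻ z in U, ENNReal.ofReal (‖deriv φ z‖ ^ 2) = volume (φ '' U) := by
  simpa only [abs_det_restrictScalars_smul_one] using
    lintegral_abs_det_fderiv_eq_addHaar_image volume hU.measurableSet
      (fun z hz => ((hφ.differentiableAt
        (hU.mem_nhds hz)).hasDerivAt.complexToReal_fderiv).hasFDerivWithinAt) hinj

lemma ofReal_mul_mem_ball_one {r : ℝ} {e : ℂ} (hr : r ∈ Ioo 0 1) (he : ‖e‖ = 1) :
    (r : ℂ) * e ∈ ball (0 : ℂ) 1 := by
  rw [mem_ball_zero_iff, norm_mul, he, mul_one, norm_real, Real.norm_of_nonneg hr.1.le]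
  exact hr.2

lemma exists_radial_limit_of_lintegral_norm_deriv_sq {φ : ℂ → ℂ}
    (hφ : DifferentiableOn ℂ φ (ball 0 1)) {e : ℂ} (he : ‖e‖ = 1)
    (h : ∫⁻ r in Ioo (1 / 2 : ℝ) 1, ENNReal.ofReal (‖deriv φ (r * e)‖ ^ 2) ≠ ∞) :
    ∃ y, Tendsto (fun r : ℝ => φ (r * e)) (𝓝[<] 1) (𝓝 y) := by
  have hmeas : Measurable fun r : ℝ => deriv φ (r * e) * e :=
    ((measurable_deriv φ).comp (by fun_prop)).mul_const e
  refine exists_tendsto_nhdsLT_of_hasDerivAt_of_integrableOn (f' := fun r => deriv φ (r * e) * e)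
    (a := 1 / 2) (by norm_num) (fun r hr => ?_) ⟨hmeas.aestronglyMeasurable, ?_⟩
  · have hmem := ofReal_mul_mem_ball_one (Ioo_subset_Ioo_left (by norm_num) hr) he
    have hlin : HasDerivAt (fun r : ℝ => (r : ℂ) * e) e r := by
      simpa using (ofRealCLM.hasDerivAt (x := r)).mul_const e
    exact (hφ.differentiableAt (isOpen_ball.mem_nhds hmem)).hasDerivAt.comp r hlin
  rw [hasFiniteIntegral_iff_norm]
  calc ∫⁻ r in Ioo (1 / 2 : ℝ) 1, ENNReal.ofReal ‖deriv φ (r * e) * e‖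
      ≤ ∫⁻ r in Ioo (1 / 2 : ℝ) 1, (1 + ENNReal.ofReal (‖deriv φ (r * e)‖ ^ 2)) := by
        refine lintegral_mono fun r => ?_
        rw [← ENNReal.ofReal_one, ← ENNReal.ofReal_add zero_le_one (by positivity), norm_mul, he,
          mul_one]
        exact ENNReal.ofReal_le_ofReal (by nlinarith [sq_nonneg (‖deriv φ (r * e)‖ - 1)])
    _ = volume (Ioo (1 / 2 : ℝ) 1)
        + ∫⁻ r in Ioo (1 / 2 : ℝ) 1, ENNReal.ofReal (‖deriv φ (r * e)‖ ^ 2) := by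
        rw [lintegral_add_left measurable_const, setLIntegral_one]
    _ < ∞ := ENNReal.add_lt_top.2 ⟨measure_Ioo_lt_top, h.lt_top⟩

lemma ae_lintegral_radius_lt_top {F : ℂ → ℝ≥0∞} (hF : Measurable F) (h : ∫⁻ z, F z ≠ ∞) :
    ∀ᵐ t : ℝ ∂volume.restrict (Ioo (-π) π),
      ∫⁻ r in Ioi (0 : ℝ), ENNReal.ofReal r * F (r * exp (t * I)) < ∞ := by
  have hpolar : ∀ p : ℝ × ℝ, Complex.polarCoord.symm p = p.1 * exp (p.2 * I) := fun p => by
    rw [Complex.polarCoord_symm_apply, exp_mul_I, ofReal_cos, ofReal_sin]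
  have hmeas : Measurable fun p : ℝ × ℝ => ENNReal.ofReal p.1 * F (p.1 * exp (p.2 * I)) :=
    measurable_fst.ennreal_ofReal.mul (hF.comp (by fun_prop))
  rw [← Complex.lintegral_comp_polarCoord_symm] at h
  simp only [hpolar, smul_eq_mul] at h
  rw [show polarCoord.target = Ioi (0 : ℝ) ×ˢ Ioo (-π) π from rfl,
    Measure.volume_eq_prod, ← Measure.prod_restrict, lintegral_prod_symm _ hmeas.aemeasurable] at h
  exact ae_lt_top hmeas.lintegral_prod_left' h

lemma ae_of_ae_restrict_Ioc_of_periodic {P : ℝ → Prop} {T : ℝ} (hT : 0 < T)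
    (hP : Function.Periodic P T) (t₀ : ℝ) (h : ∀ᵐ t ∂volume.restrict (Ioc t₀ (t₀ + T)), P t) :
    ∀ᵐ t, P t := by
  rw [ae_iff, Measure.restrict_apply' measurableSet_Ioc] at h
  refine (isAddFundamentalDomain_Ioc hT t₀).measure_zero_of_invariant _ ?_ h
  rintro ⟨_, k, rfl⟩
  ext t
  have := hP.sub_zsmul_eq k (x := t)
  simp_all [mem_vadd_set_iff_neg_vadd_mem, AddSubgroup.vadd_def, neg_add_eq_sub]

theorem ae_exists_radial_limit {φ : ℂ → ℂ} (hφ : DifferentiableOn ℂ φ (ball 0 1))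
    (hinj : InjOn φ (ball 0 1)) (harea : volume (φ '' ball 0 1) ≠ ∞) :
    ∀ᵐ t : ℝ, ∃ y, Tendsto (fun r : ℝ => φ (r * exp (t * I))) (𝓝[<] 1) (𝓝 y) := by
  set F : ℂ → ℝ≥0∞ := (ball 0 1).indicator fun z => ENNReal.ofReal (‖deriv φ z‖ ^ 2) with hF_def
  have hF : Measurable F :=
    ((measurable_deriv φ).norm.pow_const 2).ennreal_ofReal.indicator measurableSet_ball
  rw [← lintegral_norm_deriv_sq_eq_volume_image isOpen_ball hφ hinj,
    ← lintegral_indicator measurableSet_ball] at harea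
  refine ae_of_ae_restrict_Ioc_of_periodic Real.two_pi_pos (fun t => ?_) (-π) ?_
  · simp only [ofReal_add, ofReal_mul, ofReal_ofNat, exp_mul_I_periodic (t : ℂ)]
  rw [show -π + 2 * π = π by ring, ← Measure.restrict_congr_set Ioo_ae_eq_Ioc]
  filter_upwards [ae_lintegral_radius_lt_top hF harea] with t ht
  refine exists_radial_limit_of_lintegral_norm_deriv_sq hφ (norm_exp_ofReal_mul_I t) ?_
  have hle : ∫⁻ r in Ioo (1 / 2 : ℝ) 1, ENNReal.ofReal (‖deriv φ (r * exp (t * I))‖ ^ 2)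
      ≤ 2 * ∫⁻ r in Ioi (0 : ℝ), ENNReal.ofReal r * F (r * exp (t * I)) := by
    have hmeas : Measurable fun r : ℝ => ENNReal.ofReal r * F (r * exp (t * I)) :=
      measurable_id.ennreal_ofReal.mul (hF.comp (by fun_prop))
    rw [← lintegral_const_mul _ hmeas]
    refine (setLIntegral_mono' measurableSet_Ioo fun r hr => ?_).trans
      (lintegral_mono_set fun r hr => lt_trans (by norm_num) hr.1)
    have hmem := ofReal_mul_mem_ball_one (Ioo_subset_Ioo_left (by norm_num) hr)
      (norm_exp_ofReal_mul_I t)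
    rw [hF_def, indicator_of_mem hmem, ← mul_assoc]
    refine le_mul_of_one_le_left zero_le ?_
    rw [← ENNReal.ofReal_ofNat, ← ENNReal.ofReal_mul (by norm_num), ENNReal.one_le_ofReal]
    linarith [hr.1]
  exact (hle.trans_lt (ENNReal.mul_lt_top (by simp) ht)).ne

/-! ### Functions of the circle that rise on one arc and fall on the other -/

/-- The vector field `c + c₀ z + c̄ z²`; `i` times this field generates a one-parameter group of
automorphisms of the unit disk, with fixed points on the circle if `‖c‖ = 1` and `|c₀| ≤ 2`. -/
noncomputable def diskField (c₀ : ℝ) (c z : ℂ) : ℂ := c + c₀ * z + conj c * z ^ 2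

/-- For `p = i q'` this says that `re q` increases along the flow of `i (c + c₀ z + c̄ z²)` on the
unit disk, for some unimodular `c`. -/
def HasDiskField (p : ℂ → ℂ) (c₀ : ℝ) : Prop :=
  ∃ c : ℂ, ‖c‖ = 1 ∧ ∀ z ∈ ball (0 : ℂ) 1, 0 ≤ (p z * diskField c₀ c z).re

lemma exists_hasDiskField_of_tendsto {ι : Type*} {l : Filter ι} [l.NeBot] {p : ι → ℂ → ℂ}
    {p₀ : ℂ → ℂ} (hp : ∀ z ∈ ball (0 : ℂ) 1, Tendsto (fun i => p i z) l (𝓝 (p₀ z))) {C : Set ℝ}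
    (hC : IsCompact C) (h : ∀ i, ∃ c₀ ∈ C, HasDiskField (p i) c₀) :
    ∃ c₀ ∈ C, HasDiskField p₀ c₀ := by
  choose a ha c hc hpos using h
  set 𝒰 := Ultrafilter.of l
  obtain ⟨⟨a₀, c₀⟩, hmem₀, hlim⟩ := (hC.prod (isCompact_sphere (0 : ℂ) 1)).ultrafilter_le_nhds
    (𝒰.map fun i => (a i, c i)) (le_principal_iff.2 (Ultrafilter.mem_map.2
      (univ_mem' fun i => ⟨ha i, by simpa using hc i⟩)))
  have hlim : Tendsto (fun i => (a i, c i)) 𝒰 (𝓝 (a₀, c₀)) := hlim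
  rw [nhds_prod_eq, tendsto_prod_iff'] at hlim
  refine ⟨a₀, hmem₀.1, c₀, by simpa using hmem₀.2, fun z hz => ?_⟩
  have hfield : Tendsto (fun i => diskField (a i) (c i) z) 𝒰 (𝓝 (diskField a₀ c₀ z)) :=
    (hlim.2.add (((continuous_ofReal.tendsto a₀).comp hlim.1).mul_const z)).add
      (((continuous_conj.tendsto c₀).comp hlim.2).mul_const _)
  have hprod := ((hp z hz).mono_left (Ultrafilter.of_le l)).mul hfield
  exact ge_of_tendsto ((continuous_re.tendsto _).comp hprod)
    (Eventually.of_forall fun i => hpos i z hz)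

lemma exp_mul_I_sub_ne_zero {z : ℂ} (hz : z ∈ ball (0 : ℂ) 1) (t : ℝ) : exp (t * I) - z ≠ 0 := by
  intro h
  rw [← sub_eq_zero.1 h, mem_ball_zero_iff, norm_exp_ofReal_mul_I] at hz
  exact lt_irrefl _ hz

lemma re_inv_sub_mul_diskField {ζ z : ℂ} (hζ : ‖ζ‖ = 1) (hz : ζ - z ≠ 0) (c₀ : ℝ) (c : ℂ) :
    ((ζ - z)⁻¹ * diskField c₀ c z).re =
      (c₀ + 2 * (conj c * ζ).re) * (((ζ + z) / (ζ - z)).re / 2) - c₀ / 2 - (conj c * z).re := by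
  have hunit : ζ * conj ζ = 1 := by rw [mul_conj, normSq_eq_norm_sq, hζ]; simp
  have hre : ((2 * (conj c * ζ).re : ℝ) : ℂ) = conj c * ζ + c * conj ζ := by
    rw [← Complex.add_conj, map_mul, conj_conj]
  have hsplit : (ζ - z)⁻¹ * diskField c₀ c z =
      (((c₀ + 2 * (conj c * ζ).re) / 2 : ℝ) : ℂ) * (1 + (ζ + z) / (ζ - z))
        - c₀ - conj c * (z + ζ) := by
    rw [ofReal_div, ofReal_add, hre, diskField, ofReal_ofNat]
    field_simp
    linear_combination (-2 * c) * hunit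
  rw [hsplit, sub_re, sub_re, re_ofReal_mul, add_re, one_re, ofReal_re, mul_add (conj c), add_re]
  ring

lemma re_add_div_sub_nonneg {ζ z : ℂ} (hζ : ‖ζ‖ = 1) (hz : z ∈ ball (0 : ℂ) 1) :
    0 ≤ ((ζ + z) / (ζ - z)).re := by
  have h := le_re_herglotzRieszKernel (c := 0) (z := ζ) (by simpa using hζ) hz
  simp only [sub_zero] at h
  have hz1 : ‖z‖ < 1 := by simpa using hz
  exact (div_nonneg (by linarith) (by positivity)).trans h

lemma neg_two_mul_cos_add_two_mul_cos (t b a : ℝ) :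
    -2 * Real.cos ((a - b) / 2) + 2 * Real.cos (t - (a + b) / 2)
      = 4 * (Real.sin ((t - b) / 2) * Real.sin ((a - t) / 2)) := by
  rw [show (a - b) / 2 = (t - b) / 2 + (a - t) / 2 by ring,
    show t - (a + b) / 2 = (t - b) / 2 - (a - t) / 2 by ring, Real.cos_add, Real.cos_sub]
  ring

/-- The kernel that recovers the derivative of a holomorphic function from the boundary values of
its real part. -/
noncomputable def derivKernel (z : ℂ) (t : ℝ) : ℂ := exp (t * I) / (exp (t * I) - z) ^ 2

lemma continuous_derivKernel {z : ℂ} (hz : z ∈ ball (0 : ℂ) 1) : Continuous (derivKernel z) := by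
  unfold derivKernel
  exact Continuous.div (by fun_prop) (by fun_prop) fun t =>
    pow_ne_zero _ (exp_mul_I_sub_ne_zero hz t)

lemma exp_add_two_pi_mul_I (t : ℝ) : exp ((t + 2 * π : ℝ) * I) = exp (t * I) := by
  push_cast
  exact exp_mul_I_periodic t

lemma derivKernel_periodic (z : ℂ) : Function.Periodic (derivKernel z) (2 * π) := fun t => by
  simp only [derivKernel, exp_add_two_pi_mul_I]

lemma hasDerivAt_inv_exp_mul_I_sub {z : ℂ} (hz : z ∈ ball (0 : ℂ) 1) (t : ℝ) :
    HasDerivAt (fun t : ℝ => (exp (t * I) - z)⁻¹) (-I * derivKernel z t) t := by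
  have hlin : HasDerivAt (fun t : ℝ => (t : ℂ) * I) I t := by
    simpa using (ofRealCLM.hasDerivAt (x := t)).mul_const I
  convert! (hlin.cexp.sub_const z).inv (exp_mul_I_sub_ne_zero hz t) using 1
  rw [derivKernel]
  ring

lemma I_mul_integral_derivKernel {z : ℂ} (hz : z ∈ ball (0 : ℂ) 1) (a b : ℝ) :
    I * ∫ t in a..b, derivKernel z t = (exp (a * I) - z)⁻¹ - (exp (b * I) - z)⁻¹ := by
  have h := intervalIntegral.integral_eq_sub_of_hasDerivAt
    (fun t _ => hasDerivAt_inv_exp_mul_I_sub hz t) (a := a) (b := b)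
    ((continuous_const.mul (continuous_derivKernel hz)).intervalIntegrable _ _)
  rw [intervalIntegral.integral_const_mul] at h
  linear_combination -h

lemma re_inv_exp_mul_I_sub_mul_diskField {z : ℂ} (hz : z ∈ ball (0 : ℂ) 1) (a b t : ℝ) :
    ((exp (t * I) - z)⁻¹
        * diskField (-2 * Real.cos ((a - b) / 2)) (exp (((a + b) / 2 : ℝ) * I)) z).re =
      2 * (Real.sin ((t - b) / 2) * Real.sin ((a - t) / 2))
        * ((exp (t * I) + z) / (exp (t * I) - z)).re
        + (Real.cos ((a - b) / 2) - (conj (exp (((a + b) / 2 : ℝ) * I)) * z).re) := by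
  have hcos : (conj (exp (((a + b) / 2 : ℝ) * I)) * exp (t * I)).re
      = Real.cos (t - (a + b) / 2) := by
    rw [← exp_conj, ← exp_add, map_mul, conj_ofReal, conj_I, ← exp_ofReal_mul_I_re]
    congr 2
    push_cast
    ring
  rw [re_inv_sub_mul_diskField (norm_exp_ofReal_mul_I _) (exp_mul_I_sub_ne_zero hz t), hcos,
    neg_two_mul_cos_add_two_mul_cos]
  ring

lemma re_I_mul_integral_derivKernel_mul_diskField_nonneg {z : ℂ} (hz : z ∈ ball (0 : ℂ) 1)
    {a b σ ρ : ℝ} (hbσ : b ≤ σ) (hσa : σ ≤ a) (haρ : a ≤ ρ) (hρb : ρ ≤ b + 2 * π) :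
    0 ≤ (I * (∫ t in σ..ρ, derivKernel z t)
      * diskField (-2 * Real.cos ((a - b) / 2)) (exp (((a + b) / 2 : ℝ) * I)) z).re := by
  rw [I_mul_integral_derivKernel hz, sub_mul, sub_re, re_inv_exp_mul_I_sub_mul_diskField hz,
    re_inv_exp_mul_I_sub_mul_diskField hz, add_sub_add_right_eq_sub, sub_nonneg]
  have hsin : ∀ {x : ℝ}, 0 ≤ x → x ≤ 2 * π → 0 ≤ Real.sin (x / 2) := fun h₀ h₁ =>
    Real.sin_nonneg_of_nonneg_of_le_pi (by linarith) (by linarith)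
  have hsin' : ∀ {x : ℝ}, x ≤ 0 → -(2 * π) ≤ x → Real.sin (x / 2) ≤ 0 := fun h₀ h₁ =>
    Real.sin_nonpos_of_nonpos_of_neg_pi_le (by linarith) (by linarith)
  have hσ := mul_nonneg (mul_nonneg (hsin (x := σ - b) (by linarith) (by linarith))
    (hsin (x := a - σ) (by linarith) (by linarith)))
    (re_add_div_sub_nonneg (norm_exp_ofReal_mul_I σ) hz)
  have hρ := mul_nonpos_of_nonpos_of_nonneg (mul_nonpos_of_nonneg_of_nonpos
    (hsin (x := ρ - b) (by linarith) (by linarith))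
    (hsin' (x := a - ρ) (by linarith) (by linarith)))
    (re_add_div_sub_nonneg (norm_exp_ofReal_mul_I ρ) hz)
  linarith

/-- There are no four points in cyclic order on the circle at which the `2π`-periodic function `u`,
restricted to the angles in `G`, is alternately below and above some level. -/
def IsUnimodalOnCircle (u : ℝ → ℝ) (G : Set ℝ) : Prop :=
  ∀ ⦃t₁⦄, t₁ ∈ G → ∀ ⦃t₂⦄, t₂ ∈ G → ∀ ⦃t₃⦄, t₃ ∈ G → ∀ ⦃t₄⦄, t₄ ∈ G →
    t₁ < t₂ → t₂ < t₃ → t₃ < t₄ → t₄ < t₁ + 2 * π →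
    ∀ c, ¬(u t₁ < c ∧ c < u t₂ ∧ u t₃ < c ∧ c < u t₄)

lemma IsUnimodalOnCircle.exists_superlevel_arc {u : ℝ → ℝ} {G : Set ℝ}
    (h : IsUnimodalOnCircle u G) (hu : Function.Periodic u (2 * π)) {a b c : ℝ} (haG : a ∈ G)
    (hbG : b ∈ G) (hba : b < a) (hab : a < b + 2 * π) (hbc : u b ≤ c) (hca : c < u a) :
    ∃ σ ρ, b ≤ σ ∧ σ ≤ a ∧ a ≤ ρ ∧ ρ ≤ b + 2 * π ∧ ∀ t ∈ G, t ∈ Icc b (b + 2 * π) →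
      (t ∈ Ioo σ ρ → c < u t) ∧ (c < u t → t ∈ Icc σ ρ) := by
  set S := {t | t ∈ G ∧ t ∈ Icc b (b + 2 * π) ∧ c < u t}
  have haS : a ∈ S := ⟨haG, ⟨hba.le, hab.le⟩, hca⟩
  have hbelow : BddBelow S := ⟨b, fun t ht => ht.2.1.1⟩
  have habove : BddAbove S := ⟨b + 2 * π, fun t ht => ht.2.1.2⟩
  refine ⟨sInf S, sSup S, le_csInf ⟨a, haS⟩ fun t ht => ht.2.1.1, csInf_le hbelow haS,
    le_csSup habove haS, csSup_le ⟨a, haS⟩ fun t ht => ht.2.1.2, fun t htG ht => ⟨fun hσρ => ?_,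
      fun hct => ⟨csInf_le hbelow ⟨htG, ht, hct⟩, le_csSup habove ⟨htG, ht, hct⟩⟩⟩⟩
  obtain ⟨s₁, ⟨hs₁G, hs₁, hcs₁⟩, hs₁t⟩ := exists_lt_of_csInf_lt ⟨a, haS⟩ hσρ.1
  obtain ⟨s₂, ⟨hs₂G, hs₂, hcs₂⟩, hts₂⟩ := exists_lt_of_lt_csSup ⟨a, haS⟩ hσρ.2
  by_contra! htc
  obtain ⟨d, hcd, hd⟩ := exists_between (lt_min hcs₁ hcs₂)
  have hbs₁ : b < s₁ := lt_of_le_of_ne hs₁.1 (by rintro rfl; exact hbc.not_gt hcs₁)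
  have hs₂b : s₂ < b + 2 * π :=
    lt_of_le_of_ne hs₂.2 (by rintro rfl; exact hbc.not_gt (hu b ▸ hcs₂))
  exact h hbG hs₁G htG hs₂G hbs₁ hs₁t hts₂ hs₂b d ⟨hbc.trans_lt hcd, hd.trans_le (min_le_left _ _),
    htc.trans_lt hcd, hd.trans_le (min_le_right _ _)⟩

lemma max_min_eq_add_integral_indicator {m M : ℝ} (hmM : m ≤ M) (x : ℝ) :
    max m (min x M) = m + ∫ c in Ioc m M, (Iio x).indicator (1 : ℝ → ℝ) c := by
  rw [integral_indicator_one measurableSet_Iio, measureReal_restrict_apply measurableSet_Iio]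
  rcases le_or_gt x M with hx | hx
  · have hinter : Iio x ∩ Ioc m M = Ioo m x := by grind
    rw [hinter, Real.volume_real_Ioo, min_eq_left hx]
    grind
  · rw [inter_eq_right.2 fun c hc => hc.2.trans_lt hx, Real.volume_real_Ioc_of_le hmM,
      min_eq_right hx.le, max_eq_right hmM, add_sub_cancel]

lemma integral_mul_max_min_nonneg {α : Type*} [MeasurableSpace α] {μ : Measure α}
    [SFinite μ] {κ u : α → ℝ} (hκ : Integrable κ μ) (hu : AEMeasurable u μ)
    (hκ₀ : ∫ t, κ t ∂μ = 0) {m M : ℝ} (hmM : m ≤ M)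
    (h : ∀ c ∈ Ioo m M, 0 ≤ ∫ t in {t | c < u t}, κ t ∂μ) :
    0 ≤ ∫ t, κ t * max m (min (u t) M) ∂μ := by
  have hnull : NullMeasurableSet {p : α × ℝ | p.2 < u p.1} (μ.prod (volume.restrict (Ioc m M))) :=
    nullMeasurableSet_lt measurable_snd.aemeasurable hu.comp_fst
  have hint : Integrable (fun p : α × ℝ => κ p.1 * (Iio (u p.1)).indicator (1 : ℝ → ℝ) p.2)
      (μ.prod (volume.restrict (Ioc m M))) := by
    refine ((hκ.comp_fst _).indicator₀ hnull).congr (Eventually.of_forall fun p => ?_)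
    by_cases hp : p.2 < u p.1 <;> simp [indicator, hp]
  calc (0 : ℝ) ≤ ∫ c in Ioc m M, ∫ t in {t | c < u t}, κ t ∂μ := by
        rw [integral_Ioc_eq_integral_Ioo]
        exact setIntegral_nonneg measurableSet_Ioo h
    _ = ∫ c in Ioc m M, ∫ t, κ t * (Iio (u t)).indicator (1 : ℝ → ℝ) c ∂μ := by
        refine integral_congr_ae (Eventually.of_forall fun c => ?_)
        dsimp only
        rw [← integral_indicator₀ (nullMeasurableSet_lt aemeasurable_const hu)]
        congr 1 with t
        by_cases ht : c < u t <;> simp [indicator, ht]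
    _ = ∫ t, (∫ c in Ioc m M, κ t * (Iio (u t)).indicator (1 : ℝ → ℝ) c) ∂μ :=
        (integral_integral_swap hint).symm
    _ = ∫ t, κ t * max m (min (u t) M) ∂μ := by
        have hlayer := hint.integral_prod_left
        simp only [integral_const_mul] at hlayer ⊢
        simp only [max_min_eq_add_integral_indicator hmM, mul_add]
        rw [integral_add (hκ.mul_const m) hlayer, integral_mul_const, hκ₀, zero_mul, zero_add]

lemma intervalIntegrable_derivKernel_mul {z : ℂ} (hz : z ∈ ball (0 : ℂ) 1) {v : ℝ → ℝ}
    (hv : AEStronglyMeasurable v volume) {M : ℝ} (hM : ∀ᵐ t, |v t| ≤ M) (a b : ℝ) :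
    IntervalIntegrable (fun t => derivKernel z t * (v t : ℂ)) volume a b := by
  have hk := (continuous_derivKernel hz).intervalIntegrable (μ := volume) a b
  rw [intervalIntegrable_iff] at hk ⊢
  exact hk.mul_bdd (continuous_ofReal.comp_aestronglyMeasurable hv).restrict
    (ae_restrict_of_ae (hM.mono fun t ht => by simpa using ht))

lemma integral_derivKernel_period {z : ℂ} (hz : z ∈ ball (0 : ℂ) 1) (b : ℝ) :
    ∫ t in b..b + 2 * π, derivKernel z t = 0 := by
  have h := I_mul_integral_derivKernel hz b (b + 2 * π)
  rwa [exp_add_two_pi_mul_I, sub_self, mul_eq_zero, or_iff_right I_ne_zero] at h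

lemma re_I_mul_integral_mul {k : ℝ → ℂ} {v : ℝ → ℝ} {a b : ℝ}
    (h : IntervalIntegrable (fun t => k t * (v t : ℂ)) volume a b) (D : ℂ) :
    (I * (∫ t in a..b, k t * (v t : ℂ)) * D).re = ∫ t in a..b, (I * k t * D).re * v t := by
  rw [mul_right_comm, ← intervalIntegral.integral_const_mul]
  refine (reCLM.intervalIntegral_comp_comm (h.const_mul (I * D))).symm.trans ?_
  refine intervalIntegral.integral_congr fun t _ => ?_
  simp only [reCLM_apply]
  rw [← re_mul_ofReal]
  ring_nf

lemma IsUnimodalOnCircle.integral_superlevel_nonneg {u : ℝ → ℝ} {G : Set ℝ}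
    (h : IsUnimodalOnCircle u G) (hu : Function.Periodic u (2 * π)) (hG : ∀ᵐ t, t ∈ G)
    {a b c : ℝ} (haG : a ∈ G) (hbG : b ∈ G) (hba : b < a) (hab : a < b + 2 * π) (hbc : u b ≤ c)
    (hca : c < u a) {z : ℂ} (hz : z ∈ ball (0 : ℂ) 1) :
    0 ≤ ∫ t in {t | c < u t}, (I * derivKernel z t * diskField (-2 * Real.cos ((a - b) / 2))
      (exp (((a + b) / 2 : ℝ) * I)) z).re ∂volume.restrict (Ioc b (b + 2 * π)) := by
  obtain ⟨σ, ρ, hbσ, hσa, haρ, hρb, harc⟩ := h.exists_superlevel_arc hu haG hbG hba hab hbc hca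
  have hae : ({t | c < u t} ∩ Ioc b (b + 2 * π) : Set ℝ) =ᵐ[volume] Ioc σ ρ := by
    filter_upwards [hG, Measure.ae_ne volume σ, Measure.ae_ne volume ρ] with t htG hσ hρ
    apply propext
    have := harc t htG
    change (c < u t ∧ t ∈ Ioc b (b + 2 * π)) ↔ t ∈ Ioc σ ρ
    grind
  rw [Measure.restrict_restrict' measurableSet_Ioc, setIntegral_congr_set hae,
    ← intervalIntegral.integral_of_le (hσa.trans haρ)]
  have hint : IntervalIntegrable (fun t => derivKernel z t * ((1 : ℝ) : ℂ)) volume σ ρ := by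
    simpa using (continuous_derivKernel hz).intervalIntegrable _ _
  have hre := re_I_mul_integral_mul hint (diskField (-2 * Real.cos ((a - b) / 2))
      (exp (((a + b) / 2 : ℝ) * I)) z)
  simp only [ofReal_one, mul_one] at hre
  exact hre ▸ re_I_mul_integral_derivKernel_mul_diskField_nonneg hz hbσ hσa haρ hρb

lemma IsUnimodalOnCircle.re_integral_clamp_nonneg {u : ℝ → ℝ} {G : Set ℝ}
    (h : IsUnimodalOnCircle u G) (hu : Function.Periodic u (2 * π)) (hG : ∀ᵐ t, t ∈ G)
    (hmeas : AEStronglyMeasurable u volume) {a b : ℝ} (haG : a ∈ G) (hbG : b ∈ G) (hba : b < a)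
    (hab : a < b + 2 * π) (huba : u b ≤ u a) {z : ℂ} (hz : z ∈ ball (0 : ℂ) 1) :
    0 ≤ (I * (∫ t in b..b + 2 * π, derivKernel z t * (max (u b) (min (u t) (u a)) : ℝ))
      * diskField (-2 * Real.cos ((a - b) / 2)) (exp (((a + b) / 2 : ℝ) * I)) z).re := by
  have hb2 : b ≤ b + 2 * π := (hba.trans hab).le
  have hmeas_clamp : AEStronglyMeasurable (fun t => max (u b) (min (u t) (u a))) volume :=
    aestronglyMeasurable_const.sup (hmeas.inf aestronglyMeasurable_const)
  have hclamp : ∀ᵐ t, |max (u b) (min (u t) (u a))| ≤ max |u b| |u a| :=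
    Eventually.of_forall fun t => abs_le_max_abs_abs (le_max_left _ _)
      (max_le huba (min_le_right _ _))
  rw [re_I_mul_integral_mul (intervalIntegrable_derivKernel_mul hz hmeas_clamp hclamp _ _),
    intervalIntegral.integral_of_le hb2]
  set D := diskField (-2 * Real.cos ((a - b) / 2)) (exp (((a + b) / 2 : ℝ) * I)) z
  have hκcont : Continuous fun t => (I * derivKernel z t * D).re :=
    continuous_re.comp (by have := continuous_derivKernel hz; fun_prop)
  refine integral_mul_max_min_nonneg (hκcont.integrableOn_Ioc) hmeas.aemeasurable.restrict ?_ huba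
    fun c hc => h.integral_superlevel_nonneg hu hG haG hbG hba hab hc.1.le hc.2 hz
  have hre := re_I_mul_integral_mul (k := derivKernel z) (v := 1) (a := b) (b := b + 2 * π)
    (by simpa using (continuous_derivKernel hz).intervalIntegrable _ _) D
  simp only [Pi.one_apply, ofReal_one, mul_one, integral_derivKernel_period hz, mul_zero,
    zero_mul, zero_re] at hre
  rw [← intervalIntegral.integral_of_le hb2, ← hre]

lemma neg_two_mul_cos_mem_Icc (x : ℝ) : -2 * Real.cos x ∈ Icc (-2 : ℝ) 2 :=
  ⟨by linarith [Real.cos_le_one x], by linarith [Real.neg_one_le_cos x]⟩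

lemma IsUnimodalOnCircle.exists_hasDiskField_integral_clamp {u : ℝ → ℝ} {G : Set ℝ}
    (h : IsUnimodalOnCircle u G) (hu : Function.Periodic u (2 * π))
    (hGper : Function.Periodic (· ∈ G) (2 * π)) (hG : ∀ᵐ t, t ∈ G)
    (hmeas : AEStronglyMeasurable u volume) {a b : ℝ} (haG : a ∈ G) (hbG : b ∈ G) :
    ∃ c₀ ∈ Icc (-2 : ℝ) 2, HasDiskField (fun z => I * ∫ t in (0 : ℝ)..2 * π,
      derivKernel z t * (max (u b) (min (u t) (u a)) : ℝ)) c₀ := by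
  have hshift : ∀ z : ℂ, ∀ m M : ℝ,
      ∫ t in (0 : ℝ)..2 * π, derivKernel z t * (max m (min (u t) M) : ℝ) =
        ∫ t in b..b + 2 * π, derivKernel z t * (max m (min (u t) M) : ℝ) := fun z m M => by
    have hper : Function.Periodic (fun t => derivKernel z t * (max m (min (u t) M) : ℝ)) (2 * π) :=
      fun t => by simp only [derivKernel_periodic z t, hu t]
    simpa using hper.intervalIntegral_add_eq 0 b
  rcases le_or_gt (u a) (u b) with huab | huba
  · refine ⟨0, by norm_num, 1, by simp, fun z hz => ?_⟩
    have hconst : ∀ t, max (u b) (min (u t) (u a)) = u b := fun t =>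
      max_eq_left ((min_le_right _ _).trans huab)
    have hzero : ∫ t in (0 : ℝ)..2 * π, derivKernel z t = 0 := by
      simpa using integral_derivKernel_period hz 0
    simp only [hconst, intervalIntegral.integral_mul_const, hzero, zero_mul, mul_zero, zero_re,
      le_refl]
  obtain ⟨a', ha', haa'⟩ := Function.Periodic.exists_mem_Ioc
    (f := fun t => (t ∈ G, u t)) (fun t => Prod.ext (hGper t) (hu t)) Real.two_pi_pos a b
  obtain ⟨haG', hua'⟩ := Prod.ext_iff.1 haa'
  dsimp only at haG' hua'
  refine ⟨_, neg_two_mul_cos_mem_Icc ((a' - b) / 2), exp (((a' + b) / 2 : ℝ) * I),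
    norm_exp_ofReal_mul_I _, fun z hz => ?_⟩
  have hne : a' ≠ b + 2 * π := by
    rintro rfl
    exact huba.ne' (hua'.trans (hu b))
  simp only [hshift, hua']
  exact h.re_integral_clamp_nonneg hu hG hmeas (haG' ▸ haG) hbG ha'.1 (lt_of_le_of_ne ha'.2 hne)
    (hua' ▸ huba.le) hz

lemma IsUnimodalOnCircle.exists_hasDiskField_integral {u : ℝ → ℝ} {G : Set ℝ}
    (h : IsUnimodalOnCircle u G) (hu : Function.Periodic u (2 * π))
    (hGper : Function.Periodic (· ∈ G) (2 * π)) (hG : ∀ᵐ t, t ∈ G)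
    (hmeas : AEStronglyMeasurable u volume) {M : ℝ} (hM : ∀ t ∈ G, |u t| ≤ M) :
    ∃ c₀ ∈ Icc (-2 : ℝ) 2,
      HasDiskField (fun z => I * ∫ t in (0 : ℝ)..2 * π, derivKernel z t * u t) c₀ := by
  have hne : (u '' G).Nonempty := Set.Nonempty.image u hG.exists
  have hbelow : BddBelow (u '' G) := ⟨-M, forall_mem_image.2 fun t ht => (abs_le.1 (hM t ht)).1⟩
  have habove : BddAbove (u '' G) := ⟨M, forall_mem_image.2 fun t ht => (abs_le.1 (hM t ht)).2⟩
  obtain ⟨m, -, hm, hmG⟩ := exists_seq_tendsto_sInf hne hbelow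
  obtain ⟨s, -, hs, hsG⟩ := exists_seq_tendsto_sSup hne habove
  choose b hbG hb using hmG
  choose a haG ha using hsG
  refine exists_hasDiskField_of_tendsto (l := atTop) (fun z hz => Tendsto.const_mul I ?_)
    isCompact_Icc fun n => h.exists_hasDiskField_integral_clamp hu hGper hG hmeas (haG n) (hbG n)
  have hk := (continuous_derivKernel hz).norm.intervalIntegrable (μ := volume) 0 (2 * π)
  refine intervalIntegral.tendsto_integral_filter_of_dominated_convergence
    (fun t => ‖derivKernel z t‖ * M) (Eventually.of_forall fun n => ?_)
    (Eventually.of_forall fun n => hG.mono fun t ht _ => ?_) (hk.mul_const M)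
    (hG.mono fun t ht _ => ?_)
  · exact ((continuous_derivKernel hz).aestronglyMeasurable.mul
      (continuous_ofReal.comp_aestronglyMeasurable
        (aestronglyMeasurable_const.sup (hmeas.inf aestronglyMeasurable_const)))).restrict
  · rw [norm_mul, norm_real, Real.norm_eq_abs]
    gcongr
    have := abs_le.1 (hM t ht)
    have := abs_le.1 (hM _ (haG n))
    have := abs_le.1 (hM _ (hbG n))
    exact abs_le.2 ⟨by grind, by grind⟩
  · refine Tendsto.const_mul _ ((continuous_ofReal.tendsto _).comp ?_)
    have hlim : Tendsto (fun n => max (u (b n)) (min (u t) (u (a n)))) atTop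
        (𝓝 (max (sInf (u '' G)) (min (u t) (sSup (u '' G))))) := by
      simp only [hb, ha]
      exact hm.max (tendsto_const_nhds.min hs)
    rwa [min_eq_left (le_csSup habove (mem_image_of_mem u ht)),
      max_eq_right (csInf_le hbelow (mem_image_of_mem u ht))] at hlim

/-! ### Boundary values of the real part -/

lemma eq_of_hasDerivAt_of_eventually_re_eq {f g : ℂ → ℂ} {f' g' w : ℂ} (hf : HasDerivAt f f' w)
    (hg : HasDerivAt g g' w) (h : ∀ᶠ z in 𝓝 w, (f z).re = (g z).re) : f' = g' := by
  have hre : ∀ {k : ℂ → ℂ} {k' : ℂ}, HasDerivAt k k' w → HasFDerivAt (fun z => (k z).re) _ w :=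
    fun hk => reCLM.hasFDerivAt.comp w (hk.hasFDerivAt.restrictScalars ℝ)
  have heq := (hre hf).unique ((hre hg).congr_of_eventuallyEq h)
  have h_one := DFunLike.congr_fun heq 1
  have h_I := DFunLike.congr_fun heq I
  exact Complex.ext (by simpa using h_one) (by simpa using h_I)

lemma deriv_eq_circleAverage_re {f : ℂ → ℂ} {R : ℝ} {w : ℂ} (hf : DiffContOnCl ℂ f (ball 0 R))
    (hw : w ∈ ball 0 R) :
    deriv f w = Real.circleAverage (fun ζ => (2 * ζ / (ζ - w) ^ 2) • ((f ζ).re : ℂ)) 0 R := by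
  have hR : 0 < R := pos_of_mem_ball hw
  have hcont : ContinuousOn f (sphere 0 R) := by
    have h := hf.continuousOn
    rw [closure_ball 0 hR.ne'] at h
    exact h.mono sphere_subset_closedBall
  have hint : CircleIntegrable f 0 R := hcont.circleIntegrable hR.le
  have hre : CircleIntegrable (fun ζ => (f ζ).re) 0 R :=
    (continuous_re.comp_continuousOn hcont).circleIntegrable hR.le
  have hre_coe : CircleIntegrable (fun ζ => ((f ζ).re : ℂ)) 0 R :=
    ((continuous_ofReal.comp continuous_re).comp_continuousOn hcont).circleIntegrable hR.le
  refine eq_of_hasDerivAt_of_eventually_re_eq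
    (hf.differentiableAt isOpen_ball hw).hasDerivAt
    (hasDerivAt_circleAverage_herglotzRieszKernel_smul hre_coe hw) ?_
  filter_upwards [isOpen_ball.mem_nhds hw] with z hz
  have hker : ContinuousOn (re ∘ herglotzRieszKernel 0 z) (sphere 0 |R|) :=
    continuous_re.comp_continuousOn (continuousOn_herglotzRieszKernel_sphere hz)
  rw [re_circleAverage_herglotzRieszKernel_smul hre hz, ← reCLM_apply,
    ← hf.circleAverage_re_herglotzRieszKernel_smul hz,
    ← reCLM.circleAverage_comp_comm (hint.continuousOn_smul hker)]
  congr 1 with ζ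
  simp

lemma ofReal_mul_exp_mul_I_mem_ball {r : ℝ} (hr : r ∈ Ioo (0 : ℝ) 1) (t : ℝ) :
    (r : ℂ) * exp (t * I) ∈ ball (0 : ℂ) 1 :=
  ofReal_mul_mem_ball_one hr (norm_exp_ofReal_mul_I t)

lemma mul_deriv_eq_integral_derivKernel {q : ℂ → ℂ} (hq : DifferentiableOn ℂ q (ball 0 1)) {z : ℂ}
    (hz : z ∈ ball (0 : ℂ) 1) {r : ℝ} (hr : r ∈ Ioo (0 : ℝ) 1) :
    (r : ℂ) * deriv q (r * z) = (1 / π : ℂ) *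
      ∫ t in (0 : ℝ)..2 * π, derivKernel z t * ((q (r * exp (t * I))).re : ℂ) := by
  have hcl : closure (ball (0 : ℂ) r) ⊆ ball 0 1 :=
    closure_ball_subset_closedBall.trans (closedBall_subset_ball hr.2)
  have hrz : (r : ℂ) * z ∈ ball 0 r := by
    rw [mem_ball_zero_iff, norm_mul, norm_real, Real.norm_of_nonneg hr.1.le]
    exact mul_lt_of_lt_one_right hr.1 (by simpa using hz)
  have hr0 : (r : ℂ) ≠ 0 := ofReal_ne_zero.2 hr.1.ne'
  have hker : ∀ t : ℝ, 2 * circleMap 0 r t / (circleMap 0 r t - r * z) ^ 2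
      = 2 / r * derivKernel z t := fun t => by
    have := exp_mul_I_sub_ne_zero hz t
    rw [circleMap_zero, ← mul_sub, derivKernel]
    field_simp
  rw [deriv_eq_circleAverage_re (DifferentiableOn.mono hq hcl).diffContOnCl hrz,
    Real.circleAverage_def]
  simp only [hker]
  simp only [smul_eq_mul, circleMap_zero, mul_assoc, intervalIntegral.integral_const_mul,
    real_smul, ofReal_inv, ofReal_mul, ofReal_ofNat]
  generalize (∫ t in (0 : ℝ)..2 * π, derivKernel z t * ((q (r * exp (t * I))).re : ℂ)) = J
  field_simp

/-- The real part of the radial boundary values of `q` (a junk value where the limit does not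
exist). -/
noncomputable def boundaryRe (q : ℂ → ℂ) (t : ℝ) : ℝ :=
  limUnder (𝓝[<] (1 : ℝ)) fun r : ℝ => (q (r * exp (t * I))).re

/-- The angles at which the real part of `q` has a radial limit at the unit circle. -/
def radialLimitSet (q : ℂ → ℂ) : Set ℝ :=
  {t | Tendsto (fun r : ℝ => (q (r * exp (t * I))).re) (𝓝[<] 1) (𝓝 (boundaryRe q t))}

lemma boundaryRe_periodic (q : ℂ → ℂ) : Function.Periodic (boundaryRe q) (2 * π) := fun t => by
  simp only [boundaryRe, exp_add_two_pi_mul_I]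

lemma radialLimitSet_periodic (q : ℂ → ℂ) : Function.Periodic (· ∈ radialLimitSet q) (2 * π) :=
  fun t => by
    simp only [radialLimitSet, mem_ofPred_eq, exp_add_two_pi_mul_I, boundaryRe_periodic q t]

lemma mem_radialLimitSet_of_tendsto {q : ℂ → ℂ} {t : ℝ} {y : ℂ}
    (h : Tendsto (fun r : ℝ => q (r * exp (t * I))) (𝓝[<] 1) (𝓝 y)) : t ∈ radialLimitSet q :=
  tendsto_nhds_limUnder ⟨y.re, (continuous_re.tendsto y).comp h⟩

lemma abs_boundaryRe_le {q : ℂ → ℂ} {M : ℝ} (hM : ∀ z ∈ ball (0 : ℂ) 1, ‖q z‖ ≤ M) {t : ℝ}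
    (ht : t ∈ radialLimitSet q) : |boundaryRe q t| ≤ M := by
  refine le_of_tendsto (Tendsto.abs ht) ?_
  filter_upwards [Ioo_mem_nhdsLT zero_lt_one] with r hr
  exact (abs_re_le_norm _).trans (hM _ (ofReal_mul_exp_mul_I_mem_ball hr t))

lemma continuous_re_radial {q : ℂ → ℂ} (hq : ContinuousOn q (ball 0 1)) {r : ℝ}
    (hr : r ∈ Ioo (0 : ℝ) 1) : Continuous fun t : ℝ => (q (r * exp (t * I))).re :=
  continuous_re.comp (hq.comp_continuous (by fun_prop) (ofReal_mul_exp_mul_I_mem_ball hr))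

lemma aestronglyMeasurable_boundaryRe {q : ℂ → ℂ} (hq : ContinuousOn q (ball 0 1))
    (hlim : ∀ᵐ t, t ∈ radialLimitSet q) : AEStronglyMeasurable (boundaryRe q) volume := by
  obtain ⟨r, -, hr, hr1⟩ := exists_seq_strictMono_tendsto' (zero_lt_one (α := ℝ))
  have hr1' : Tendsto r atTop (𝓝[<] 1) :=
    tendsto_nhdsWithin_iff.2 ⟨hr1, Eventually.of_forall fun n => (hr n).2⟩
  exact aestronglyMeasurable_of_tendsto_ae atTop
    (fun n => (continuous_re_radial hq (hr n)).aestronglyMeasurable)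
    (hlim.mono fun t (ht : Tendsto _ _ _) => ht.comp hr1')

lemma deriv_eq_integral_boundaryRe {q : ℂ → ℂ} {M : ℝ} (hq : DifferentiableOn ℂ q (ball 0 1))
    (hM : ∀ z ∈ ball (0 : ℂ) 1, ‖q z‖ ≤ M) (hlim : ∀ᵐ t, t ∈ radialLimitSet q) {z : ℂ}
    (hz : z ∈ ball (0 : ℂ) 1) :
    deriv q z = (1 / π : ℂ) * ∫ t in (0 : ℝ)..2 * π, derivKernel z t * (boundaryRe q t : ℂ) := by
  have hk := continuous_derivKernel hz
  have hradii : Ioo (0 : ℝ) 1 ∈ 𝓝[<] (1 : ℝ) := Ioo_mem_nhdsLT zero_lt_one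
  have hderiv : Tendsto (fun r : ℝ => (r : ℂ) * deriv q (r * z)) (𝓝[<] 1) (𝓝 (deriv q z)) := by
    have hcont : ContinuousAt (deriv q) (((1 : ℝ) : ℂ) * z) := by
      rw [ofReal_one, one_mul]
      exact (hq.deriv isOpen_ball).continuousOn.continuousAt (isOpen_ball.mem_nhds hz)
    have hcomp : ContinuousAt (fun r : ℝ => (r : ℂ) * deriv q (r * z)) 1 :=
      continuous_ofReal.continuousAt.mul
        (ContinuousAt.comp (f := fun r : ℝ => (r : ℂ) * z) hcont (by fun_prop))
    simpa using hcomp.tendsto.mono_left (nhdsWithin_le_nhds (s := Iio 1))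
  have hint : Tendsto (fun r : ℝ => ∫ t in (0 : ℝ)..2 * π,
      derivKernel z t * ((q (r * exp (t * I))).re : ℂ)) (𝓝[<] 1)
      (𝓝 (∫ t in (0 : ℝ)..2 * π, derivKernel z t * (boundaryRe q t : ℂ))) := by
    refine intervalIntegral.tendsto_integral_filter_of_dominated_convergence
      (fun t => ‖derivKernel z t‖ * M) ?_ ?_ (hk.norm.intervalIntegrable _ _ |>.mul_const M)
      (hlim.mono fun t ht _ => (((continuous_ofReal.tendsto _).comp ht)).const_mul _)
    · filter_upwards [hradii] with r hr
      exact (hk.mul (continuous_ofReal.comp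
        (continuous_re_radial hq.continuousOn hr))).aestronglyMeasurable
    · filter_upwards [hradii] with r hr
      refine Eventually.of_forall fun t _ => ?_
      rw [norm_mul, norm_real]
      gcongr
      exact (abs_re_le_norm _).trans (hM _ (ofReal_mul_exp_mul_I_mem_ball hr t))
  refine tendsto_nhds_unique hderiv ((hint.const_mul _).congr' ?_)
  filter_upwards [hradii] with r hr
  exact (mul_deriv_eq_integral_derivKernel hq hz hr).symm

lemma isUnimodalOnCircle_boundaryRe {q : ℂ → ℂ}
    (hup : ∀ c : ℝ, ∀ x ∈ ball (0 : ℂ) 1 ∩ {z | c < (q z).re},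
      ∀ y ∈ ball (0 : ℂ) 1 ∩ {z | c < (q z).re}, JoinedIn (ball (0 : ℂ) 1 ∩ {z | c < (q z).re}) x y)
    (hdown : ∀ c : ℝ, ∀ x ∈ ball (0 : ℂ) 1 ∩ {z | (q z).re < c},
      ∀ y ∈ ball (0 : ℂ) 1 ∩ {z | (q z).re < c},
      JoinedIn (ball (0 : ℂ) 1 ∩ {z | (q z).re < c}) x y) :
    IsUnimodalOnCircle (boundaryRe q) (radialLimitSet q) := by
  rintro t₁ ht₁ t₂ ht₂ t₃ ht₃ t₄ ht₄ h₁₂ h₂₃ h₃₄ h₄₁ c ⟨hc₁, hc₂, hc₃, hc₄⟩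
  have habove : ∀ {t}, t ∈ radialLimitSet q → c < boundaryRe q t → ∀ᶠ r : ℝ in 𝓝[<] 1,
      (r : ℂ) * exp (t * I) ∈ ball (0 : ℂ) 1 ∩ {z | c < (q z).re} := fun ht hc => by
    filter_upwards [Tendsto.eventually_const_lt hc ht, Ioo_mem_nhdsLT zero_lt_one] with r h hr
    exact ⟨ofReal_mul_exp_mul_I_mem_ball hr _, h⟩
  have hbelow : ∀ {t}, t ∈ radialLimitSet q → boundaryRe q t < c → ∀ᶠ r : ℝ in 𝓝[<] 1,
      (r : ℂ) * exp (t * I) ∈ ball (0 : ℂ) 1 ∩ {z | (q z).re < c} := fun ht hc => by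
    filter_upwards [Tendsto.eventually_lt_const hc ht, Ioo_mem_nhdsLT zero_lt_one] with r h hr
    exact ⟨ofReal_mul_exp_mul_I_mem_ball hr _, h⟩
  refine not_disjoint_of_interlaced_radii inter_subset_left inter_subset_left (hdown c) (hup c)
    h₁₂ h₂₃ h₃₄ h₄₁ (hbelow ht₁ hc₁) (habove ht₂ hc₂) (hbelow ht₃ hc₃) (habove ht₄ hc₄) ?_
  exact disjoint_left.2 fun z hz hz' => lt_asymm (show (q z).re < c from hz.2) hz'.2

theorem exists_hasDiskField_of_joinedIn_levels {q : ℂ → ℂ} {M : ℝ}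
    (hq : DifferentiableOn ℂ q (ball 0 1)) (hM : ∀ z ∈ ball (0 : ℂ) 1, ‖q z‖ ≤ M)
    (hlim : ∀ᵐ t : ℝ, ∃ y, Tendsto (fun r : ℝ => q (r * exp (t * I))) (𝓝[<] 1) (𝓝 y))
    (hup : ∀ c : ℝ, ∀ x ∈ ball (0 : ℂ) 1 ∩ {z | c < (q z).re},
      ∀ y ∈ ball (0 : ℂ) 1 ∩ {z | c < (q z).re}, JoinedIn (ball (0 : ℂ) 1 ∩ {z | c < (q z).re}) x y)
    (hdown : ∀ c : ℝ, ∀ x ∈ ball (0 : ℂ) 1 ∩ {z | (q z).re < c},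
      ∀ y ∈ ball (0 : ℂ) 1 ∩ {z | (q z).re < c},
      JoinedIn (ball (0 : ℂ) 1 ∩ {z | (q z).re < c}) x y) :
    ∃ c₀ ∈ Icc (-2 : ℝ) 2, HasDiskField (fun z => I * deriv q z) c₀ := by
  have hG : ∀ᵐ t, t ∈ radialLimitSet q :=
    hlim.mono fun t ⟨y, hy⟩ => mem_radialLimitSet_of_tendsto hy
  have hunimodal := isUnimodalOnCircle_boundaryRe hup hdown
  obtain ⟨c₀, hc₀, c, hc, hpos⟩ := hunimodal.exists_hasDiskField_integral
    (boundaryRe_periodic q) (radialLimitSet_periodic q) hG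
    (aestronglyMeasurable_boundaryRe hq.continuousOn hG) fun t ht => abs_boundaryRe_le hM ht
  refine ⟨c₀, hc₀, c, hc, fun z hz => ?_⟩
  have hscale : I * deriv q z * diskField c₀ c z = ((1 / π : ℝ) : ℂ) *
      (I * (∫ t in (0 : ℝ)..2 * π, derivKernel z t * boundaryRe q t) * diskField c₀ c z) := by
    rw [deriv_eq_integral_boundaryRe hq hM hG hz]
    push_cast
    ring
  rw [hscale, re_ofReal_mul]
  exact mul_nonneg (by positivity) (hpos z hz)

/-! ### Convex harmonic mappings -/

lemma tendsto_id_of_tendsto_deriv_zero {ι : Type*} (𝒰 : Ultrafilter ι) {F : ι → ℂ → ℂ}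
    (hF : ∀ i, DifferentiableOn ℂ (F i) (ball 0 1)) (hm : ∀ i, MapsTo (F i) (ball 0 1) (ball 0 1))
    (h0 : ∀ i, F i 0 = 0) (hd : Tendsto (fun i => deriv (F i) 0) 𝒰 (𝓝 1)) {z : ℂ}
    (hz : z ∈ ball (0 : ℂ) 1) :
    Tendsto (fun i => F i z) 𝒰 (𝓝 z) ∧ Tendsto (fun i => deriv (F i) z) 𝒰 (𝓝 1) := by
  have hnorm : ∀ i, ∀ z ∈ ball (0 : ℂ) 1, ‖F i z‖ ≤ 1 := fun i z hz => by
    simpa using ball_subset_closedBall (hm i hz)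
  obtain ⟨Φ, hlim⟩ := exists_tendstoLocallyUniformlyOn_of_norm_le 𝒰 isOpen_ball hF hnorm
  have hlimd := hlim.deriv (Eventually.of_forall hF) isOpen_ball
  have h0_mem : (0 : ℂ) ∈ ball (0 : ℂ) 1 := mem_ball_self one_pos
  have hΦ0 : Φ 0 = 0 := tendsto_nhds_unique (hlim.tendsto_at h0_mem) (by simp [h0])
  have hΦd : deriv Φ 0 = 1 := tendsto_nhds_unique (hlimd.tendsto_at h0_mem) hd
  have hid : EqOn Φ id (ball 0 1) := fun z hz => by
    have hschwarz := affine_of_mapsTo_ball_of_norm_dslope_eq_div (R₂ := 1)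
      (hlim.differentiableOn (Eventually.of_forall hF) isOpen_ball)
      (fun z hz => by
        simpa [hΦ0] using le_of_tendsto (hlim.tendsto_at hz).norm
          (Eventually.of_forall fun i => hnorm i z hz))
      h0_mem (by simp [dslope_same, hΦd]) hz
    simpa [hΦ0, dslope_same, hΦd] using hschwarz
  refine ⟨by simpa [hid hz] using hlim.tendsto_at hz, ?_⟩
  simpa [(hid.eventuallyEq_of_mem (isOpen_ball.mem_nhds hz)).deriv_eq] using hlimd.tendsto_at hz

/-- Sense-preserving univalent harmonic mappings `h + conj g` of the unit disk with convex image: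
the class `IsHarmonicConvexZero` without its normalization at the origin. -/
structure IsHarmonicConvex (h g : ℂ → ℂ) : Prop where
  holo_h : DifferentiableOn ℂ h (ball 0 1)
  holo_g : DifferentiableOn ℂ g (ball 0 1)
  sense_preserving : ∀ z ∈ ball (0 : ℂ) 1, ‖deriv g z‖ < ‖deriv h z‖
  univalent : InjOn (harmonicMap h g) (ball 0 1)
  convex_image : Convex ℝ (harmonicMap h g '' ball 0 1)

lemma map_nhds_harmonicMap {h g : ℂ → ℂ} {z : ℂ} (hh : AnalyticAt ℂ h z) (hg : AnalyticAt ℂ g z)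
    (hsp : ‖deriv g z‖ < ‖deriv h z‖) :
    map (harmonicMap h g) (𝓝 z) = 𝓝 (harmonicMap h g z) := by
  have hderiv : HasStrictFDerivAt (harmonicMap h g) (deriv h z • (1 : ℂ →L[ℝ] ℂ) +
      (conjCLE : ℂ →L[ℝ] ℂ).comp (deriv g z • (1 : ℂ →L[ℝ] ℂ))) z :=
    hh.hasStrictDerivAt.complexToReal_fderiv.add
      ((conjCLE : ℂ →L[ℝ] ℂ).hasStrictFDerivAt.comp z hg.hasStrictDerivAt.complexToReal_fderiv)
  refine hderiv.map_nhds_eq_of_surj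
    (LinearMap.range_eq_top.2 (LinearMap.surjective_of_injective ?_))
  refine (injective_iff_map_eq_zero _).2 fun v hv => ?_
  by_contra hv0
  have hconj : deriv h z * v = -conj (deriv g z * v) := by
    rw [eq_neg_iff_add_eq_zero]
    simpa using hv
  have hnorm : ‖deriv h z‖ * ‖v‖ = ‖deriv g z‖ * ‖v‖ := by
    rw [← norm_mul, hconj, norm_neg, RCLike.norm_conj, norm_mul]
  exact hsp.ne' (mul_right_cancel₀ (norm_ne_zero_iff.2 hv0) hnorm)

lemma isSimplyConnected_of_leftInvOn_of_convex {E X : Type*} [AddCommGroup E] [Module ℝ E]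
    [TopologicalSpace E] [ContinuousAdd E] [ContinuousSMul ℝ E] [TopologicalSpace X] {O : Set E}
    {U : Set X} {f : X → E} {k : E → X} (hO : Convex ℝ O) (hne : O.Nonempty)
    (hk : ContinuousOn k O) (hkm : MapsTo k O U) (hf : ContinuousOn f U) (hfm : MapsTo f U O)
    (hfk : LeftInvOn f k O) (hkf : LeftInvOn k f U) : IsSimplyConnected U := by
  have e : O ≃ₜ U :=
    { toFun := fun x => ⟨k x, hkm x.2⟩
      invFun := fun x => ⟨f x, hfm x.2⟩
      left_inv := fun x => Subtype.ext (hfk x.2)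
      right_inv := fun x => Subtype.ext (hkf x.2)
      continuous_toFun := (continuousOn_iff_continuous_domRestrict.1 hk).subtype_mk _
      continuous_invFun := (continuousOn_iff_continuous_domRestrict.1 hf).subtype_mk _ }
  have : ContractibleSpace O := hO.contractibleSpace hne
  have : ContractibleSpace U := e.symm.contractibleSpace
  exact SimplyConnectedSpace.ofContractible _

lemma joinedIn_inter_preimage_of_leftInvOn_of_convex {E X : Type*} [AddCommGroup E] [Module ℝ E]
    [TopologicalSpace E] [ContinuousAdd E] [ContinuousSMul ℝ E] [TopologicalSpace X] {O H : Set E}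
    {U : Set X} {f : X → E} {k : E → X} (hO : Convex ℝ O) (hH : Convex ℝ H)
    (hk : ContinuousOn k O) (hkm : MapsTo k O U) (hfm : MapsTo f U O)
    (hfk : LeftInvOn f k O) (hkf : LeftInvOn k f U) {x y : X} (hx : x ∈ U ∩ f ⁻¹' H)
    (hy : y ∈ U ∩ f ⁻¹' H) : JoinedIn (U ∩ f ⁻¹' H) x y := by
  have hsegment : JoinedIn (O ∩ H) (f x) (f y) := JoinedIn.of_segment_subset
    ((hO.inter hH).segment_subset ⟨hfm hx.1, hx.2⟩ ⟨hfm hy.1, hy.2⟩)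
  have hlift := hsegment.map_continuousOn (hk.mono inter_subset_left)
  rw [hkf hx.1, hkf hy.1] at hlift
  refine hlift.mono ?_
  rintro _ ⟨w, hw, rfl⟩
  exact ⟨hkm hw.1, by rw [mem_preimage, hfk hw.1]; exact hw.2⟩

lemma exists_isCompact_convex_between {E : Type*} [NormedAddCommGroup E] [NormedSpace ℝ E]
    [FiniteDimensional ℝ E] {Ω L : Set E} (hΩ : IsOpen Ω) (hΩc : Convex ℝ Ω) (hL : IsCompact L)
    (hLΩ : L ⊆ Ω) : ∃ K, IsCompact K ∧ Convex ℝ K ∧ L ⊆ interior K ∧ K ⊆ Ω := by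
  suffices ∃ t : Set E, t.Finite ∧ t ⊆ Ω ∧ L ⊆ interior (convexHull ℝ t) by
    obtain ⟨t, ht, htΩ, hLt⟩ := this
    exact ⟨convexHull ℝ t, ht.isCompact_convexHull ℝ, convex_convexHull ℝ t, hLt,
      convexHull_min htΩ hΩc⟩
  refine hL.induction_on (p := fun L => ∃ t : Set E, t.Finite ∧ t ⊆ Ω ∧
    L ⊆ interior (convexHull ℝ t)) ⟨∅, by simp⟩ ?_ ?_ ?_
  · rintro s s' hs ⟨t, ht, htΩ, hst⟩
    exact ⟨t, ht, htΩ, hs.trans hst⟩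
  · rintro s s' ⟨t, ht, htΩ, hst⟩ ⟨t', ht', htΩ', hst'⟩
    exact ⟨t ∪ t', ht.union ht', union_subset htΩ htΩ', union_subset
      (hst.trans (interior_mono (convexHull_mono subset_union_left)))
      (hst'.trans (interior_mono (convexHull_mono subset_union_right)))⟩
  · intro w hw
    obtain ⟨u, hwu, huΩ⟩ :=
      (convex_singleton w).exists_subset_interior_convexHull_finset_of_isCompact
        isCompact_singleton (t := Ω) (by simpa using hΩ.mem_nhds (hLΩ hw))
    exact ⟨_, mem_nhdsWithin_of_mem_nhds (isOpen_interior.mem_nhds (hwu rfl)), u, u.finite_toSet,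
      (subset_convexHull ℝ _).trans huΩ, Subset.rfl⟩

/-- The holomorphic function whose real part is the component of `h + conj g` in the direction
`exp (i ν)`. -/
noncomputable def directionalPart (h g : ℂ → ℂ) (ν : ℝ) (z : ℂ) : ℂ :=
  exp ((-ν : ℝ) * I) * h z + exp (ν * I) * g z

lemma re_directionalPart (h g : ℂ → ℂ) (ν : ℝ) (z : ℂ) :
    (directionalPart h g ν z).re = (exp ((-ν : ℝ) * I) * harmonicMap h g z).re := by
  have hconj : exp ((-ν : ℝ) * I) = conj (exp (ν * I)) := by
    rw [← exp_conj]
    simp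
  rw [directionalPart, harmonicMap, mul_add, add_re, add_re, add_right_inj, hconj, ← map_mul,
    conj_re]

lemma convex_preimage_re_mul (e : ℂ) {s : Set ℝ} (hs : Convex ℝ s) :
    Convex ℝ {w : ℂ | (e * w).re ∈ s} :=
  hs.linear_preimage (reLm ∘ₗ LinearMap.mulLeft ℝ e)

lemma ae_exists_radial_limit_comp {φ q : ℂ → ℂ} {L : Set ℂ} (hφ : DifferentiableOn ℂ φ (ball 0 1))
    (hinj : InjOn φ (ball 0 1)) (hL : IsCompact L) (hφL : MapsTo φ (ball 0 1) L)
    (hq : ContinuousOn q L) :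
    ∀ᵐ t : ℝ, ∃ y, Tendsto (fun r : ℝ => q (φ (r * exp (t * I)))) (𝓝[<] 1) (𝓝 y) := by
  have harea : volume (φ '' ball 0 1) ≠ ∞ :=
    ((measure_mono hφL.image_subset).trans_lt hL.measure_lt_top).ne
  filter_upwards [ae_exists_radial_limit hφ hinj harea] with t ⟨y, hy⟩
  have hmem : ∀ᶠ r : ℝ in 𝓝[<] 1, φ (r * exp (t * I)) ∈ L := by
    filter_upwards [Ioo_mem_nhdsLT zero_lt_one] with r hr
    exact hφL (ofReal_mul_exp_mul_I_mem_ball hr t)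
  exact ⟨q y, (hq y (hL.isClosed.mem_of_tendsto hy hmem)).tendsto.comp
    (tendsto_nhdsWithin_iff.2 ⟨hy, hmem⟩)⟩

lemma exists_riemannMap_deriv_mem_Icc {U : Set ℂ} (hU : IsOpen U) (hUs : IsSimplyConnected U)
    {r : ℝ} (hr : 0 < r) (hrU : ball 0 r ⊆ U) (hUb : U ⊆ ball 0 1) :
    ∃ φ ψ : ℂ → ℂ, DifferentiableOn ℂ φ (ball 0 1) ∧ DifferentiableOn ℂ ψ U ∧
      MapsTo φ (ball 0 1) U ∧ MapsTo ψ U (ball 0 1) ∧ LeftInvOn ψ φ (ball 0 1) ∧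
      LeftInvOn φ ψ U ∧ φ 0 = 0 ∧ ∃ ρ ∈ Icc r 1, deriv φ 0 = (ρ : ℂ) := by
  have h0 : (0 : ℂ) ∈ U := hrU (mem_ball_self hr)
  have h0_mem : (0 : ℂ) ∈ ball (0 : ℂ) 1 := hUb h0
  obtain ⟨φ, ψ, hφ, hψ, hφU, hψm, hψφ, hφψ, hφ0, hψ0, ρ, hρ, hψρ⟩ := exists_riemannMap hU hUs h0 hUb
  have hchain : deriv ψ 0 * deriv φ 0 = 1 := by
    have hψ' : HasDerivAt ψ (deriv ψ 0) (φ 0) := by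
      rw [hφ0]
      exact (hψ.differentiableAt (hU.mem_nhds h0)).hasDerivAt
    have hcomp : HasDerivAt (ψ ∘ φ) (deriv ψ 0 * deriv φ 0) 0 :=
      hψ'.comp 0 (hφ.differentiableAt (isOpen_ball.mem_nhds h0_mem)).hasDerivAt
    exact hcomp.unique ((hasDerivAt_id 0).congr_of_eventuallyEq
      (hψφ.eqOn.eventuallyEq_of_mem (isOpen_ball.mem_nhds h0_mem)))
  have hφρ : deriv φ 0 = ((ρ⁻¹ : ℝ) : ℂ) := by
    rw [hψρ] at hchain
    rw [ofReal_inv]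
    exact eq_inv_of_mul_eq_one_right hchain
  have hle : ρ⁻¹ ≤ 1 := by
    have hschwarz := norm_deriv_le_one_of_mapsTo_ball hφ (fun z hz => by
      rw [hφ0]
      exact ball_subset_closedBall (hUb (hφU hz))) one_pos
    rwa [hφρ, norm_real, Real.norm_of_nonneg (inv_nonneg.2 hρ.le)] at hschwarz
  have hge : ρ ≤ 1 / r := by
    have hschwarz := norm_deriv_le_div_of_mapsTo_ball (hψ.mono hrU) (fun z hz => by
      rw [hψ0]
      exact ball_subset_closedBall (hψm (hrU hz))) hr
    rwa [hψρ, norm_real, Real.norm_of_nonneg hρ.le] at hschwarz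
  exact ⟨φ, ψ, hφ, hψ, hφU, hψm, hψφ, hφψ, hφ0, ρ⁻¹,
    ⟨(le_inv_comm₀ hr hρ).2 (by simpa using hge), hle⟩, hφρ⟩

namespace IsHarmonicConvex

variable {h g : ℂ → ℂ}

lemma continuousOn (hf : IsHarmonicConvex h g) : ContinuousOn (harmonicMap h g) (ball 0 1) :=
  hf.holo_h.continuousOn.add (continuous_conj.comp_continuousOn hf.holo_g.continuousOn)

lemma map_nhds (hf : IsHarmonicConvex h g) {z : ℂ} (hz : z ∈ ball (0 : ℂ) 1) :
    map (harmonicMap h g) (𝓝 z) = 𝓝 (harmonicMap h g z) :=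
  map_nhds_harmonicMap (hf.holo_h.analyticOnNhd isOpen_ball z hz)
    (hf.holo_g.analyticOnNhd isOpen_ball z hz) (hf.sense_preserving z hz)

lemma isOpen_image (hf : IsHarmonicConvex h g) : IsOpen (harmonicMap h g '' ball 0 1) := by
  refine isOpen_iff_mem_nhds.2 ?_
  rintro _ ⟨z, hz, rfl⟩
  rw [← hf.map_nhds hz]
  exact image_mem_map (isOpen_ball.mem_nhds hz)

lemma exists_leftInvOn_continuousOn (hf : IsHarmonicConvex h g) :
    ∃ k : ℂ → ℂ, LeftInvOn k (harmonicMap h g) (ball 0 1) ∧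
      LeftInvOn (harmonicMap h g) k (harmonicMap h g '' ball 0 1) ∧
      MapsTo k (harmonicMap h g '' ball 0 1) (ball 0 1) ∧
      ContinuousOn k (harmonicMap h g '' ball 0 1) := by
  have hinv := hf.univalent.leftInvOn_invFunOn
  refine ⟨Function.invFunOn (harmonicMap h g) (ball 0 1), hinv, hinv.rightInvOn_image,
    fun w hw => Function.invFunOn_mem hw, ?_⟩
  rintro _ ⟨z, hz, rfl⟩
  refine ContinuousAt.continuousWithinAt ?_
  rw [ContinuousAt, hinv hz, ← hf.map_nhds hz, tendsto_map'_iff]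
  refine tendsto_id.congr' ?_
  filter_upwards [isOpen_ball.mem_nhds hz] with w hw
  exact (hinv hw).symm

lemma differentiableOn_directionalPart (hf : IsHarmonicConvex h g) (ν : ℝ) :
    DifferentiableOn ℂ (directionalPart h g ν) (ball 0 1) :=
  (hf.holo_h.const_mul _).add (hf.holo_g.const_mul _)

/-- The disk field is found on the preimage of a convex domain `interior K` with `K` compactly
contained in the image, parametrized by a Riemann map `φ`: half planes cut connected pieces out of
`interior K`, and all functions involved extend continuously past the boundary of the preimage. -/
lemma exists_hasDiskField_comp (hf : IsHarmonicConvex h g) {K : Set ℂ} (hK : IsCompact K)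
    (hKc : Convex ℝ K) (hKΩ : K ⊆ harmonicMap h g '' ball 0 1) {φ ψ : ℂ → ℂ}
    (hφ : DifferentiableOn ℂ φ (ball 0 1))
    (hφU : MapsTo φ (ball 0 1) (ball 0 1 ∩ harmonicMap h g ⁻¹' interior K))
    (hψ : ContinuousOn ψ (ball 0 1 ∩ harmonicMap h g ⁻¹' interior K))
    (hψm : MapsTo ψ (ball 0 1 ∩ harmonicMap h g ⁻¹' interior K) (ball 0 1))
    (hψφ : LeftInvOn ψ φ (ball 0 1))
    (hφψ : LeftInvOn φ ψ (ball 0 1 ∩ harmonicMap h g ⁻¹' interior K)) (ν : ℝ) :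
    ∃ c₀ ∈ Icc (-2 : ℝ) 2,
      HasDiskField (fun z => I * deriv (fun w => directionalPart h g ν (φ w)) z) c₀ := by
  obtain ⟨k, hkf, hfk, hkm, hkc⟩ := hf.exists_leftInvOn_continuousOn
  have hOΩ := interior_subset.trans hKΩ
  have hkU : MapsTo k (interior K) (ball 0 1 ∩ harmonicMap h g ⁻¹' interior K) := fun w hw =>
    ⟨hkm (hOΩ hw), by rwa [mem_preimage, hfk (hOΩ hw)]⟩
  have hφm : MapsTo φ (ball 0 1) (ball 0 1) := fun z hz => (hφU hz).1
  have hq := (hf.differentiableOn_directionalPart ν).comp hφ hφm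
  have hkK : k '' K ⊆ ball 0 1 := (hkm.mono_left hKΩ).image_subset
  have hL : IsCompact (k '' K) := hK.image_of_continuousOn (hkc.mono hKΩ)
  have hφL : MapsTo φ (ball 0 1) (k '' K) := fun z hz =>
    ⟨harmonicMap h g (φ z), interior_subset (hφU hz).2, hkf (hφm hz)⟩
  have hqL := (hf.differentiableOn_directionalPart ν).continuousOn.mono hkK
  obtain ⟨M, hM⟩ := hL.exists_bound_of_continuousOn hqL
  have hjoin : ∀ s : Set ℝ, Convex ℝ s →
      ∀ x ∈ ball (0 : ℂ) 1 ∩ {z | (directionalPart h g ν (φ z)).re ∈ s},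
      ∀ y ∈ ball (0 : ℂ) 1 ∩ {z | (directionalPart h g ν (φ z)).re ∈ s},
      JoinedIn (ball (0 : ℂ) 1 ∩ {z | (directionalPart h g ν (φ z)).re ∈ s}) x y := by
    intro s hs x hx y hy
    simp only [re_directionalPart] at hx hy ⊢
    exact joinedIn_inter_preimage_of_leftInvOn_of_convex (f := fun z => harmonicMap h g (φ z))
      (k := fun w => ψ (k w)) hKc.interior (convex_preimage_re_mul _ hs)
      (hψ.comp (hkc.mono hOΩ) hkU) (hψm.comp hkU) (fun z hz => (hφU hz).2)
      (fun w hw => by simp only [hφψ (hkU hw), hfk (hOΩ hw)])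
      (fun z hz => by simp only [hkf (hφm hz), hψφ hz]) hx hy
  exact exists_hasDiskField_of_joinedIn_levels hq (fun z hz => hM _ (hφL hz))
    (ae_exists_radial_limit_comp hφ hψφ.injOn hL hφL hqL)
    (fun c => hjoin (Ioi c) (convex_Ioi c)) (fun c => hjoin (Iio c) (convex_Iio c))

lemma exists_riemannMap_hasDiskField (hf : IsHarmonicConvex h g) (ν : ℝ) {r : ℝ}
    (hr : r ∈ Ioo (0 : ℝ) 1) :
    ∃ φ : ℂ → ℂ, DifferentiableOn ℂ φ (ball 0 1) ∧ MapsTo φ (ball 0 1) (ball 0 1) ∧ φ 0 = 0 ∧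
      (∃ ρ ∈ Icc r 1, deriv φ 0 = (ρ : ℂ)) ∧ ∃ c₀ ∈ Icc (-2 : ℝ) 2,
        HasDiskField (fun z => I * deriv (fun w => directionalPart h g ν (φ w)) z) c₀ := by
  have hball : closedBall (0 : ℂ) r ⊆ ball 0 1 := closedBall_subset_ball hr.2
  obtain ⟨K, hK, hKc, hLK, hKΩ⟩ := exists_isCompact_convex_between hf.isOpen_image hf.convex_image
    ((isCompact_closedBall (0 : ℂ) r).image_of_continuousOn (hf.continuousOn.mono hball))
    (image_mono hball)
  obtain ⟨k, hkf, hfk, hkm, hkc⟩ := hf.exists_leftInvOn_continuousOn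
  have hOΩ := interior_subset.trans hKΩ
  set U := ball (0 : ℂ) 1 ∩ harmonicMap h g ⁻¹' interior K
  have hU : IsOpen U := hf.continuousOn.isOpen_inter_preimage isOpen_ball isOpen_interior
  have hrU : ball 0 r ⊆ U := fun z hz =>
    ⟨hball (ball_subset_closedBall hz), hLK (mem_image_of_mem _ (ball_subset_closedBall hz))⟩
  have hUs : IsSimplyConnected U := isSimplyConnected_of_leftInvOn_of_convex hKc.interior
    ⟨_, (hrU (mem_ball_self hr.1)).2⟩ (hkc.mono hOΩ)
    (fun w hw => ⟨hkm (hOΩ hw), by rwa [mem_preimage, hfk (hOΩ hw)]⟩)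
    (hf.continuousOn.mono inter_subset_left) (fun z hz => hz.2) (hfk.mono hOΩ)
    (hkf.mono inter_subset_left)
  obtain ⟨φ, ψ, hφ, hψ, hφU, hψm, hψφ, hφψ, hφ0, hderiv⟩ :=
    exists_riemannMap_deriv_mem_Icc hU hUs hr.1 hrU inter_subset_left
  exact ⟨φ, hφ, fun z hz => (hφU hz).1, hφ0, hderiv,
    hf.exists_hasDiskField_comp hK hKc hKΩ hφ hφU hψ.continuousOn hψm hψφ hφψ ν⟩

theorem exists_hasDiskField (hf : IsHarmonicConvex h g) (ν : ℝ) :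
    ∃ c₀ ∈ Icc (-2 : ℝ) 2, HasDiskField (fun z => I * deriv (directionalPart h g ν) z) c₀ := by
  obtain ⟨r, -, hr, hr1⟩ := exists_seq_strictMono_tendsto' (zero_lt_one (α := ℝ))
  choose φ hφ hφm hφ0 hderiv hfield using fun n => hf.exists_riemannMap_hasDiskField ν (hr n)
  choose ρ hρ hφρ using hderiv
  have hρ1 : Tendsto ρ atTop (𝓝 1) := tendsto_of_tendsto_of_tendsto_of_le_of_le hr1
    tendsto_const_nhds (fun n => (hρ n).1) (fun n => (hρ n).2)
  have hd : Tendsto (fun n => deriv (φ n) 0) (hyperfilter ℕ) (𝓝 1) := by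
    simpa only [hφρ, Function.comp_def, ofReal_one] using
      ((continuous_ofReal.tendsto 1).comp hρ1).mono_left Nat.hyperfilter_le_atTop
  have hq := hf.differentiableOn_directionalPart ν
  refine exists_hasDiskField_of_tendsto (l := hyperfilter ℕ) (fun z hz => ?_) isCompact_Icc hfield
  obtain ⟨hφz, hφz'⟩ := tendsto_id_of_tendsto_deriv_zero _ hφ hφm hφ0 hd hz
  have hchain : ∀ n, deriv (fun w => directionalPart h g ν (φ n w)) z =
      deriv (directionalPart h g ν) (φ n z) * deriv (φ n) z := fun n =>
    deriv_comp z (hq.differentiableAt (isOpen_ball.mem_nhds (hφm n hz)))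
      ((hφ n).differentiableAt (isOpen_ball.mem_nhds hz))
  simp only [hchain]
  have hcont := (hq.deriv isOpen_ball).continuousOn.continuousAt (isOpen_ball.mem_nhds hz)
  simpa using ((hcont.tendsto.comp hφz).mul hφz').const_mul I

end IsHarmonicConvex

/-! ### Removing the rotational part of a disk field -/

lemma diskField_combination (s t c₀ c₁ : ℝ) (c d z : ℂ) :
    diskField (s * c₀ + t * c₁) (s * c + t * d) z =
      s * diskField c₀ c z + t * diskField c₁ d z := by
  simp only [diskField, map_add, map_mul, conj_ofReal]
  push_cast
  ring

lemma diskField_neg (c₀ : ℝ) (c z : ℂ) : diskField (-c₀) (-c) z = -diskField c₀ c z := by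
  simpa using diskField_combination (-1) 0 c₀ 0 c 0 z

lemma HasDiskField.neg {p : ℂ → ℂ} {c₀ : ℝ} (h : HasDiskField p c₀) :
    HasDiskField (fun z => -p z) (-c₀) := by
  obtain ⟨c, hc, hpos⟩ := h
  refine ⟨-c, by rwa [norm_neg], fun z hz => ?_⟩
  rw [diskField_neg, neg_mul_neg]
  exact hpos z hz

lemma hasDiskField_zero_of_ne_zero {p : ℂ → ℂ} {d : ℂ} (hd : d ≠ 0)
    (h : ∀ z ∈ ball (0 : ℂ) 1, 0 ≤ (p z * diskField 0 d z).re) : HasDiskField p 0 := by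
  have hd' : 0 < ‖d‖ := norm_pos_iff.2 hd
  refine ⟨(‖d‖⁻¹ : ℝ) * d, ?_, fun z hz => ?_⟩
  · rw [norm_mul, norm_real, Real.norm_of_nonneg (by positivity), inv_mul_cancel₀ hd'.ne']
  · have hscale : diskField 0 ((‖d‖⁻¹ : ℝ) * d) z = (‖d‖⁻¹ : ℝ) * diskField 0 d z := by
      simpa using diskField_combination ‖d‖⁻¹ 0 0 0 d 0 z
    rw [hscale, mul_left_comm, re_ofReal_mul]
    exact mul_nonneg (by positivity) (h z hz)

lemma eqOn_const_of_re_eq_zero {F : ℂ → ℂ} (hF : DifferentiableOn ℂ F (ball 0 1))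
    (h : ∀ z ∈ ball (0 : ℂ) 1, (F z).re = 0) : ∀ z ∈ ball (0 : ℂ) 1, F z = F 0 := by
  have h0 : (0 : ℂ) ∈ ball (0 : ℂ) 1 := mem_ball_self one_pos
  rcases (hF.analyticOnNhd isOpen_ball).is_constant_or_isOpen
    (convex_ball (0 : ℂ) 1).isPreconnected with ⟨w, hw⟩ | hopen
  · intro z hz
    rw [hw z hz, hw 0 h0]
  · have hsub : F '' ball 0 1 ⊆ {z : ℂ | z.re ≤ 0} := image_subset_iff.2 fun z hz => (h z hz).le
    have hint := (hopen _ Subset.rfl isOpen_ball).subset_interior_iff.2 hsub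
      (mem_image_of_mem F h0)
    rw [interior_setOfPred_re_le] at hint
    exact absurd (h 0 h0) (ne_of_lt hint)

lemma re_one_sub_sq_div_pos {c₀ : ℝ} (hc₀ : c₀ ∈ Icc (-2 : ℝ) 2) {w : ℂ} (hw : ‖w‖ < 1) :
    0 < ((1 - w ^ 2) / (1 + c₀ * w + w ^ 2)).re := by
  have hpos : 0 < ((1 - w ^ 2) * conj (1 + c₀ * w + w ^ 2)).re := by
    have hre := abs_le.1 (abs_re_le_norm w)
    have hfactor : ((1 - w ^ 2) * conj (1 + c₀ * w + w ^ 2)).re =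
        (1 - ‖w‖ ^ 2) * (1 + ‖w‖ ^ 2 + c₀ * w.re) := by
      rw [← normSq_eq_norm_sq, normSq_apply]
      simp [pow_two]
      ring
    rw [hfactor]
    exact mul_pos (by nlinarith [norm_nonneg w]) (by nlinarith [hc₀.1, hc₀.2])
  have hne : 1 + c₀ * w + w ^ 2 ≠ 0 := fun h => by simp [h] at hpos
  rw [div_eq_mul_inv, inv_def, ← mul_assoc, re_mul_ofReal]
  exact mul_pos hpos (inv_pos.2 (normSq_pos.2 hne))

lemma re_sub_div_diskField_pos {c₀ : ℝ} (hc₀ : c₀ ∈ Icc (-2 : ℝ) 2) {c z : ℂ} (hc : ‖c‖ = 1)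
    (hz : z ∈ ball (0 : ℂ) 1) : 0 < ((c - conj c * z ^ 2) / diskField c₀ c z).re := by
  have hunit : c * conj c = 1 := by rw [mul_conj, normSq_eq_norm_sq, hc]; simp
  have hw : ‖conj c * z‖ < 1 := by simpa [norm_mul, hc] using hz
  have hnum : c - conj c * z ^ 2 = c * (1 - (conj c * z) ^ 2) := by
    linear_combination conj c * z ^ 2 * hunit
  have hden : diskField c₀ c z = c * (1 + c₀ * (conj c * z) + (conj c * z) ^ 2) := by
    rw [diskField]
    linear_combination -(c₀ * z + conj c * z ^ 2) * hunit
  rw [hnum, hden, mul_div_mul_left _ _ (left_ne_zero_of_mul_eq_one hunit)]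
  exact re_one_sub_sq_div_pos hc₀ hw

/-- If `re q` is constant along the flow of a field, then it is monotone along the flow of the
perpendicular hyperbolic field. -/
lemma hasDiskField_zero_of_re_eq_zero {p : ℂ → ℂ} (hp : DifferentiableOn ℂ p (ball 0 1)) {c₀ : ℝ}
    (hc₀ : c₀ ∈ Icc (-2 : ℝ) 2) {c : ℂ} (hc : ‖c‖ = 1)
    (h : ∀ z ∈ ball (0 : ℂ) 1, (p z * diskField c₀ c z).re = 0) : HasDiskField p 0 := by
  set κ := (p 0 * diskField c₀ c 0).im
  have hκ : ∀ z ∈ ball (0 : ℂ) 1, p z * diskField c₀ c z = κ * I := fun z hz => by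
    rw [eqOn_const_of_re_eq_zero (F := fun z => p z * diskField c₀ c z)
      (hp.mul (by unfold diskField; fun_prop)) h z hz]
    exact Complex.ext (by simpa using h 0 (mem_ball_self one_pos)) (by simp [κ])
  obtain ⟨s, hs, hsκ⟩ : ∃ s : ℝ, s ≠ 0 ∧ 0 ≤ -(s * κ) := by
    rcases le_total 0 κ with hκ₀ | hκ₀
    · exact ⟨-1, by norm_num, by linarith⟩
    · exact ⟨1, one_ne_zero, by linarith⟩
  have hc_ne : c ≠ 0 := norm_ne_zero_iff.1 (hc.trans_ne one_ne_zero)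
  refine hasDiskField_zero_of_ne_zero (d := s * I * c) (by simp [hs, hc_ne]) fun z hz => ?_
  have hpos := re_sub_div_diskField_pos hc₀ hc hz
  have hne : diskField c₀ c z ≠ 0 := fun h₀ => by simp [h₀] at hpos
  have hfield : p z * diskField 0 (s * I * c) z =
      (-(s * κ) : ℝ) * ((c - conj c * z ^ 2) / diskField c₀ c z) := by
    rw [mul_div_assoc', eq_div_iff hne, mul_right_comm, hκ z hz, diskField]
    simp only [map_mul, conj_ofReal, conj_I]
    push_cast
    linear_combination s * κ * (c - conj c * z ^ 2) * I_sq
  rw [hfield, re_ofReal_mul]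
  exact mul_nonneg hsκ hpos.le

lemma hasDiskField_zero_of_nonneg_of_nonpos {p : ℂ → ℂ} (hp : DifferentiableOn ℂ p (ball 0 1))
    {c₀ c₁ : ℝ} (hc₀ : c₀ ∈ Icc (0 : ℝ) 2) (hc₁ : c₁ ≤ 0) (h₀ : HasDiskField p c₀)
    (h₁ : HasDiskField p c₁) : HasDiskField p 0 := by
  rcases hc₀.1.eq_or_lt with rfl | hc₀_pos
  · exact h₀
  obtain ⟨c, hc, hpos⟩ := h₀
  obtain ⟨d, hd, hpos'⟩ := h₁
  have hcomb : ∀ z ∈ ball (0 : ℂ) 1,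
      0 ≤ (p z * diskField 0 ((-c₁ : ℝ) * c + c₀ * d) z).re := fun z hz => by
    have hfield := diskField_combination (-c₁) c₀ c₀ c₁ c d z
    rw [show -c₁ * c₀ + c₀ * c₁ = 0 by ring] at hfield
    rw [hfield, mul_add, mul_left_comm, mul_left_comm (p z), add_re, re_ofReal_mul, re_ofReal_mul]
    exact add_nonneg (mul_nonneg (by linarith) (hpos z hz)) (mul_nonneg hc₀.1 (hpos' z hz))
  by_cases he : ((-c₁ : ℝ) : ℂ) * c + c₀ * d = 0
  · have hopp : ((-c₁ : ℝ) : ℂ) * c = c₀ * (-d) := by linear_combination he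
    have hcc : -c₁ = c₀ := by
      simpa [hc, hd, abs_of_nonpos hc₁, abs_of_nonneg hc₀.1] using congrArg norm hopp
    rw [hcc] at hopp
    obtain rfl : c = -d := mul_left_cancel₀ (by exact_mod_cast hc₀_pos.ne') hopp
    obtain rfl := hcc
    refine hasDiskField_zero_of_re_eq_zero hp ⟨by linarith [hc₀.1], hc₀.2⟩ hc fun z hz =>
      le_antisymm ?_ (hpos z hz)
    rw [diskField_neg, mul_neg, neg_re]
    exact neg_nonpos.2 (hpos' z hz)
  · exact hasDiskField_zero_of_ne_zero he hcomb

namespace IsHarmonicConvex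

variable {h g : ℂ → ℂ}

lemma deriv_directionalPart (hf : IsHarmonicConvex h g) (ν : ℝ) {z : ℂ}
    (hz : z ∈ ball (0 : ℂ) 1) :
    deriv (directionalPart h g ν) z =
      exp ((-ν : ℝ) * I) * deriv h z + exp (ν * I) * deriv g z :=
  (((hf.holo_h.differentiableAt (isOpen_ball.mem_nhds hz)).hasDerivAt.const_mul _).add
    ((hf.holo_g.differentiableAt (isOpen_ball.mem_nhds hz)).hasDerivAt.const_mul _)).deriv

lemma deriv_directionalPart_add_pi (hf : IsHarmonicConvex h g) (ν : ℝ) {z : ℂ}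
    (hz : z ∈ ball (0 : ℂ) 1) :
    deriv (directionalPart h g (ν + π)) z = -deriv (directionalPart h g ν) z := by
  have hneg : exp ((-(ν + π) : ℝ) * I) = -exp ((-ν : ℝ) * I) := by
    rw [← exp_sub_pi_mul_I]
    congr 1
    push_cast
    ring
  have hpos : exp ((ν + π : ℝ) * I) = -exp (ν * I) := by
    rw [← exp_add_pi_mul_I]
    congr 1
    push_cast
    ring
  rw [hf.deriv_directionalPart _ hz, hf.deriv_directionalPart _ hz, hneg, hpos]
  ring

lemma isClosed_setOfPred_hasDiskField (hf : IsHarmonicConvex h g) {C : Set ℝ} (hC : IsCompact C) :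
    IsClosed {ν : ℝ | ∃ c₀ ∈ C,
      HasDiskField (fun z => I * deriv (directionalPart h g ν) z) c₀} := by
  refine IsSeqClosed.isClosed fun u ν hu hlim =>
    exists_hasDiskField_of_tendsto (l := atTop) (fun z hz => ?_) hC hu
  simp only [hf.deriv_directionalPart _ hz]
  have hcont : Continuous fun ν : ℝ =>
      I * (exp ((-ν : ℝ) * I) * deriv h z + exp (ν * I) * deriv g z) := by fun_prop
  exact (hcont.tendsto ν).comp hlim

lemma hasDiskField_add_pi (hf : IsHarmonicConvex h g) {ν c₀ : ℝ}
    (hν : HasDiskField (fun z => I * deriv (directionalPart h g ν) z) c₀) :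
    HasDiskField (fun z => I * deriv (directionalPart h g (ν + π)) z) (-c₀) := by
  obtain ⟨c, hc, hpos⟩ := hν.neg
  refine ⟨c, hc, fun z hz => ?_⟩
  simpa only [hf.deriv_directionalPart_add_pi ν hz, mul_neg] using hpos z hz

/-- As `ν` increases by `π`, the sign of the rotational part changes, so it vanishes in between. -/
theorem exists_hasDiskField_zero (hf : IsHarmonicConvex h g) :
    ∃ ν : ℝ, HasDiskField (fun z => I * deriv (directionalPart h g ν) z) 0 := by
  set E : Set ℝ → Set ℝ := fun C =>
    {ν | ∃ c₀ ∈ C, HasDiskField (fun z => I * deriv (directionalPart h g ν) z) c₀}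
  have hcover : ∀ ν, ν ∈ E (Icc 0 2) ∪ E (Icc (-2) 0) := fun ν => by
    obtain ⟨c₀, hc₀, hν⟩ := hf.exists_hasDiskField ν
    rcases le_total 0 c₀ with h₀ | h₀
    · exact Or.inl ⟨c₀, ⟨h₀, hc₀.2⟩, hν⟩
    · exact Or.inr ⟨c₀, ⟨hc₀.1, h₀⟩, hν⟩
  have hne : (E (Icc 0 2)).Nonempty ∧ (E (Icc (-2) 0)).Nonempty := by
    rcases hcover 0 with ⟨c₀, hc₀, hν⟩ | ⟨c₀, hc₀, hν⟩
    · exact ⟨⟨_, c₀, hc₀, hν⟩, _, -c₀, by grind, hf.hasDiskField_add_pi hν⟩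
    · exact ⟨⟨_, -c₀, by grind, hf.hasDiskField_add_pi hν⟩, _, c₀, hc₀, hν⟩
  obtain ⟨ν, -, ⟨c₀, hc₀, h₀⟩, c₁, hc₁, h₁⟩ :=
    isPreconnected_closed_iff.1 isPreconnected_univ _ _
      (hf.isClosed_setOfPred_hasDiskField isCompact_Icc)
      (hf.isClosed_setOfPred_hasDiskField isCompact_Icc)
      (fun ν _ => hcover ν) (hne.1.mono fun _ => And.intro trivial)
      (hne.2.mono fun _ => And.intro trivial)
  exact ⟨ν, hasDiskField_zero_of_nonneg_of_nonpos
    (((hf.differentiableOn_directionalPart ν).deriv isOpen_ball).const_mul I) hc₀ hc₁.2 h₀ h₁⟩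

end IsHarmonicConvex

/-! ### Taylor coefficients -/

section TaylorCoefficients

variable {u v : ℂ → ℂ}

lemma hasSum_taylorCoeffZero {R : ℝ} (hu : DifferentiableOn ℂ u (ball 0 R)) {z : ℂ}
    (hz : z ∈ ball (0 : ℂ) R) : HasSum (fun n => taylorCoeffZero u n * z ^ n) (u z) := by
  refine (hasSum_taylorSeries_on_ball hu hz).congr_fun fun n => ?_
  rw [taylorCoeffZero, sub_zero, smul_eq_mul, smul_eq_mul]
  ring

lemma taylorCoeffZero_eq_of_hasSum {a : ℕ → ℂ}
    (h : ∀ z ∈ ball (0 : ℂ) 1, HasSum (fun n => a n * z ^ n) (u z)) (n : ℕ) :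
    taylorCoeffZero u n = a n := by
  have hseries : HasFPowerSeriesAt u (FormalMultilinearSeries.ofScalars ℂ a) 0 := by
    rw [hasFPowerSeriesAt_iff]
    filter_upwards [ball_mem_nhds (0 : ℂ) one_pos] with z hz
    simpa [FormalMultilinearSeries.coeff_ofScalars, mul_comm] using h z hz
  have hcoeff := congrArg (fun p => p.coeff n)
    (hseries.analyticAt.hasFPowerSeriesAt.eq_formalMultilinearSeries hseries)
  simp only [FormalMultilinearSeries.coeff_ofScalars] at hcoeff
  exact hcoeff

lemma taylorCoeffZero_congr (h : u =ᶠ[𝓝 0] v) (n : ℕ) :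
    taylorCoeffZero u n = taylorCoeffZero v n := by
  rw [taylorCoeffZero, h.iteratedDeriv_eq, taylorCoeffZero]

lemma taylorCoeffZero_zero (u : ℂ → ℂ) : taylorCoeffZero u 0 = u 0 := by
  simp [taylorCoeffZero]

lemma taylorCoeffZero_one (u : ℂ → ℂ) : taylorCoeffZero u 1 = deriv u 0 := by
  simp [taylorCoeffZero]

lemma taylorCoeffZero_const_mul (u : ℂ → ℂ) (c : ℂ) (n : ℕ) :
    taylorCoeffZero (fun z => c * u z) n = c * taylorCoeffZero u n := by
  rw [taylorCoeffZero, iteratedDeriv_const_mul_field, taylorCoeffZero, mul_div_assoc]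

lemma taylorCoeffZero_deriv (u : ℂ → ℂ) (n : ℕ) :
    taylorCoeffZero (deriv u) n = (n + 1) * taylorCoeffZero u (n + 1) := by
  rw [taylorCoeffZero, taylorCoeffZero, iteratedDeriv_succ', Nat.factorial_succ]
  have hn : (n : ℂ) + 1 ≠ 0 := by exact_mod_cast n.succ_ne_zero
  have hfact : (n.factorial : ℂ) ≠ 0 := by exact_mod_cast n.factorial_ne_zero
  push_cast
  field_simp

lemma taylorCoeffZero_const_add (u : ℂ → ℂ) (c : ℂ) {n : ℕ} (hn : 0 < n) :
    taylorCoeffZero (fun z => c + u z) n = taylorCoeffZero u n := by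
  rw [taylorCoeffZero, iteratedDeriv_const_add hn, taylorCoeffZero]

lemma taylorCoeffZero_const_sub (u : ℂ → ℂ) (c : ℂ) {n : ℕ} (hn : 0 < n) :
    taylorCoeffZero (fun z => c - u z) n = -taylorCoeffZero u n := by
  rw [taylorCoeffZero, iteratedDeriv_const_sub hn, taylorCoeffZero, iteratedDeriv_neg, neg_div]

lemma taylorCoeffZero_add (hu : AnalyticAt ℂ u 0) (hv : AnalyticAt ℂ v 0) (n : ℕ) :
    taylorCoeffZero (fun z => u z + v z) n = taylorCoeffZero u n + taylorCoeffZero v n := by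
  rw [taylorCoeffZero, iteratedDeriv_fun_add hu.contDiffAt hv.contDiffAt, add_div,
    taylorCoeffZero, taylorCoeffZero]

lemma taylorCoeffZero_mul (hu : AnalyticAt ℂ u 0) (hv : AnalyticAt ℂ v 0) (n : ℕ) :
    taylorCoeffZero (fun z => u z * v z) n =
      ∑ i ∈ Finset.range (n + 1), taylorCoeffZero u i * taylorCoeffZero v (n - i) := by
  rw [taylorCoeffZero, iteratedDeriv_fun_mul hu.contDiffAt hv.contDiffAt, Finset.sum_div]
  refine Finset.sum_congr rfl fun i hi => ?_
  have hin : i ≤ n := Nat.lt_succ_iff.1 (Finset.mem_range.1 hi)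
  have hfact : (n.factorial : ℂ) = n.choose i * i.factorial * (n - i).factorial := by
    exact_mod_cast (Nat.choose_mul_factorial_mul_factorial hin).symm
  have hchoose : (n.choose i : ℂ) ≠ 0 := by exact_mod_cast (Nat.choose_pos hin).ne'
  rw [taylorCoeffZero, taylorCoeffZero, hfact]
  field_simp

lemma taylorCoeffZero_id_mul_succ (hu : AnalyticAt ℂ u 0) (n : ℕ) :
    taylorCoeffZero (fun z => z * u z) (n + 1) = taylorCoeffZero u n := by
  have hid : ∀ i, taylorCoeffZero (fun z => z) i = if i = 1 then 1 else 0 := fun i => by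
    rw [taylorCoeffZero, iteratedDeriv_fun_id_zero]
    split_ifs with hi <;> simp [hi]
  rw [taylorCoeffZero_mul (u := fun z => z) analyticAt_id hu]
  simp only [hid, ite_mul, one_mul, zero_mul, Finset.sum_ite_eq', Finset.mem_range]
  simp

lemma circleAverage_inv_pow_mul (hu : DifferentiableOn ℂ u (ball 0 1)) {r : ℝ}
    (hr : r ∈ Ioo (0 : ℝ) 1) (k : ℕ) :
    Real.circleAverage (fun ζ => (ζ ^ k)⁻¹ * u ζ) 0 r = taylorCoeffZero u k := by
  have hcauchy := DifferentiableOn.circleIntegral_one_div_sub_center_pow_smul (E := ℂ) hr.1 k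
    (hu.mono (closedBall_subset_ball hr.2))
  rw [Real.circleAverage_eq_circleIntegral hr.1.ne']
  convert! congrArg ((2 * π * I)⁻¹ • ·) hcauchy using 1
  · congr 2 with ζ
    simp only [sub_zero, smul_eq_mul, pow_succ', one_div, mul_inv, mul_assoc]
  · rw [taylorCoeffZero]
    simp only [smul_eq_mul]
    field_simp

lemma circleAverage_pow_mul_eq_zero (hu : DifferentiableOn ℂ u (ball 0 1)) {r : ℝ}
    (hr : r ∈ Ioo (0 : ℝ) 1) {k : ℕ} (hk : 0 < k) :
    Real.circleAverage (fun ζ => ζ ^ k * u ζ) 0 r = 0 := by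
  have hdiff : DifferentiableOn ℂ (fun ζ => ζ ^ k * u ζ) (closure (ball 0 |r|)) :=
    ((differentiableOn_pow k).mul hu).mono (closure_ball_subset_closedBall.trans
      (closedBall_subset_ball (by rw [abs_of_pos hr.1]; exact hr.2)))
  rw [hdiff.diffContOnCl.circleAverage, zero_pow hk.ne', zero_mul]

lemma circleAverage_inv_pow_mul_re (hu : DifferentiableOn ℂ u (ball 0 1)) {r : ℝ}
    (hr : r ∈ Ioo (0 : ℝ) 1) {k : ℕ} (hk : 0 < k) :
    Real.circleAverage (fun ζ => (ζ ^ k)⁻¹ * ((2 * (u ζ).re : ℝ) : ℂ)) 0 r =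
      taylorCoeffZero u k := by
  have hcont : ContinuousOn u (sphere 0 r) :=
    hu.continuousOn.mono (sphere_subset_closedBall.trans (closedBall_subset_ball hr.2))
  have hcont_inv : ContinuousOn (fun ζ : ℂ => (ζ ^ k)⁻¹) (sphere 0 r) :=
    (continuousOn_pow k).inv₀ fun ζ hζ => pow_ne_zero k (ne_of_mem_sphere hζ hr.1.ne')
  have hconj : Real.circleAverage (fun ζ => (ζ ^ k)⁻¹ * conj (u ζ)) 0 r = 0 := by
    have hint : CircleIntegrable (fun ζ => ζ ^ k * u ζ) 0 r :=
      ((continuousOn_pow k).mul hcont).circleIntegrable hr.1.le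
    have hcomm := conjCLE.toContinuousLinearMap.circleAverage_comp_comm hint
    rw [circleAverage_pow_mul_eq_zero hu hr hk, map_zero] at hcomm
    have hon : ∀ ζ ∈ sphere (0 : ℂ) |r|, (ζ ^ k)⁻¹ * conj (u ζ) =
        (((r ^ k) ^ 2)⁻¹ : ℝ) • conj (ζ ^ k * u ζ) := fun ζ hζ => by
      rw [abs_of_pos hr.1, mem_sphere_zero_iff_norm] at hζ
      rw [inv_def, normSq_eq_norm_sq, norm_pow, hζ, map_mul, real_smul]
      ring
    rw [Real.circleAverage_congr_sphere hon]
    exact Real.circleAverage_fun_smul.trans (smul_eq_zero_of_right _ hcomm)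
  simp only [← add_conj, mul_add]
  refine (Real.circleAverage_fun_add ((hcont_inv.mul hcont).circleIntegrable hr.1.le)
    ((hcont_inv.mul (continuous_conj.comp_continuousOn hcont)).circleIntegrable hr.1.le)).trans ?_
  rw [← add_zero (taylorCoeffZero u k)]
  exact congrArg₂ (· + ·) (circleAverage_inv_pow_mul hu hr k) hconj

lemma norm_circleAverage_le {E : Type*} [NormedAddCommGroup E] [NormedSpace ℝ E] (f : ℂ → E)
    (c : ℂ) (R : ℝ) :
    ‖Real.circleAverage f c R‖ ≤ Real.circleAverage (fun ζ => ‖f ζ‖) c R := by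
  rw [Real.circleAverage_def, Real.circleAverage_def, norm_smul, smul_eq_mul,
    Real.norm_of_nonneg (inv_nonneg.2 Real.two_pi_pos.le)]
  gcongr
  exact intervalIntegral.norm_integral_le_integral_norm Real.two_pi_pos.le

lemma pow_mul_norm_taylorCoeffZero_le (hu : DifferentiableOn ℂ u (ball 0 1))
    (hre : ∀ z ∈ ball (0 : ℂ) 1, 0 ≤ (u z).re) {r : ℝ} (hr : r ∈ Ioo (0 : ℝ) 1) {k : ℕ}
    (hk : 0 < k) : r ^ k * ‖taylorCoeffZero u k‖ ≤ 2 * (u 0).re := by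
  have hsubset : closedBall (0 : ℂ) |r| ⊆ ball 0 1 :=
    closedBall_subset_ball (by rw [abs_of_pos hr.1]; exact hr.2)
  have hnorm : ∀ ζ ∈ sphere (0 : ℂ) |r|, ‖(ζ ^ k)⁻¹ * ((2 * (u ζ).re : ℝ) : ℂ)‖ =
      ((r ^ k)⁻¹ * 2) • (u ζ).re := fun ζ hζ => by
    have hre_nonneg := hre ζ (hsubset (sphere_subset_closedBall hζ))
    rw [abs_of_pos hr.1, mem_sphere_zero_iff_norm] at hζ
    rw [norm_mul, norm_inv, norm_pow, hζ, norm_real, Real.norm_of_nonneg (by positivity),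
      smul_eq_mul, mul_assoc]
  have hmean : Real.circleAverage (fun ζ => (u ζ).re) 0 r = (u 0).re := by
    have hint : CircleIntegrable u 0 r :=
      (hu.continuousOn.mono (sphere_subset_closedBall.trans hsubset)).circleIntegrable'
    rw [← (hu.mono (closure_ball_subset_closedBall.trans hsubset)).diffContOnCl.circleAverage]
    exact reCLM.circleAverage_comp_comm hint
  have hle := norm_circleAverage_le (fun ζ => (ζ ^ k)⁻¹ * ((2 * (u ζ).re : ℝ) : ℂ)) 0 r
  rw [circleAverage_inv_pow_mul_re hu hr hk, Real.circleAverage_congr_sphere hnorm,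
    Real.circleAverage_fun_smul, hmean, smul_eq_mul, mul_assoc] at hle
  exact (le_inv_mul_iff₀ (pow_pos hr.1 k)).1 hle

lemma norm_taylorCoeffZero_le_of_le_re (hu : DifferentiableOn ℂ u (ball 0 1)) {m : ℝ}
    (hre : ∀ z ∈ ball (0 : ℂ) 1, m ≤ (u z).re) {k : ℕ} (hk : 0 < k) :
    ‖taylorCoeffZero u k‖ ≤ 2 * ((u 0).re - m) := by
  have hbound : ∀ r ∈ Ioo (0 : ℝ) 1, r ^ k * ‖taylorCoeffZero u k‖ ≤ 2 * ((u 0).re - m) := by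
    intro r hr
    have hle := pow_mul_norm_taylorCoeffZero_le (hu.const_add (-m : ℂ)) (fun z hz => by
      rw [add_re, neg_re, ofReal_re]; linarith [hre z hz]) hr hk
    rwa [taylorCoeffZero_const_add u _ hk, add_re, neg_re, ofReal_re, neg_add_eq_sub] at hle
  have hlim : Tendsto (fun r : ℝ => r ^ k * ‖taylorCoeffZero u k‖) (𝓝[<] 1)
      (𝓝 (1 ^ k * ‖taylorCoeffZero u k‖)) :=
    ((continuous_id.pow k).mul continuous_const).continuousWithinAt
  rw [one_pow, one_mul] at hlim
  exact le_of_tendsto hlim (eventually_of_mem (Ioo_mem_nhdsLT zero_lt_one) hbound)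

lemma norm_taylorCoeffZero_mul_le (hu : AnalyticAt ℂ u 0) (hv : AnalyticAt ℂ v 0) {M : ℝ}
    (hu_coeff : ∀ n, ‖taylorCoeffZero u n‖ ≤ (n + 1) * M)
    (hv_coeff : ∀ n, 0 < n → ‖taylorCoeffZero v n‖ ≤ 1) (n : ℕ) :
    ‖taylorCoeffZero (fun z => u z * v z) n‖ ≤ (n * (n + 1) / 2 + (n + 1) * ‖v 0‖) * M := by
  have hM : 0 ≤ M := by simpa using (norm_nonneg _).trans (hu_coeff 0)
  have hterm : ∀ i ∈ Finset.range n,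
      ‖taylorCoeffZero u i * taylorCoeffZero v (n - i)‖ ≤ ((i + 1 : ℕ) : ℝ) * M := by
    intro i hi
    rw [norm_mul, Nat.cast_succ, ← mul_one (((i : ℝ) + 1) * M)]
    exact mul_le_mul (hu_coeff i) (hv_coeff _ (Nat.sub_pos_of_lt (Finset.mem_range.1 hi)))
      (norm_nonneg _) (by positivity)
  have hgauss : ∑ i ∈ Finset.range n, ((i + 1 : ℕ) : ℝ) = n * (n + 1) / 2 := by
    rw [eq_div_iff two_ne_zero]
    have := Finset.sum_range_id_mul_two (n + 1)
    rw [Finset.sum_range_succ'] at this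
    exact_mod_cast by simpa [mul_comm] using this
  rw [taylorCoeffZero_mul hu hv, Finset.sum_range_succ, Nat.sub_self, taylorCoeffZero_zero v,
    add_mul]
  refine (norm_add_le _ _).trans (add_le_add ?_ ?_)
  · rw [← hgauss, Finset.sum_mul]
    exact norm_sum_le_of_le _ hterm
  · rw [norm_mul, mul_right_comm]
    gcongr
    exact hu_coeff n

end TaylorCoefficients

/-! ### Coefficients of convex harmonic mappings -/

lemma analyticAt_zero_of_differentiableOn {u : ℂ → ℂ} (hu : DifferentiableOn ℂ u (ball 0 1)) :
    AnalyticAt ℂ u 0 :=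
  hu.analyticAt (ball_mem_nhds 0 one_pos)

lemma taylorCoeffZero_mul_diskField_zero {p : ℂ → ℂ} (hp : AnalyticAt ℂ p 0) (c : ℂ) (k : ℕ) :
    taylorCoeffZero (fun z => p z * diskField 0 c z) (k + 1) =
      c * taylorCoeffZero p (k + 1) + conj c * taylorCoeffZero (fun z => z * p z) k := by
  have hzp : AnalyticAt ℂ (fun z => z * p z) 0 := by fun_prop
  have hsplit : (fun z => p z * diskField 0 c z) =
      fun z => c * p z + conj c * (z * (z * p z)) := by
    funext z
    rw [diskField]
    push_cast
    ring
  rw [hsplit, taylorCoeffZero_add (by fun_prop) (by fun_prop), taylorCoeffZero_const_mul,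
    taylorCoeffZero_const_mul, taylorCoeffZero_id_mul_succ hzp]

lemma HasDiskField.norm_taylorCoeffZero_le {p : ℂ → ℂ} (h : HasDiskField p 0)
    (hp : DifferentiableOn ℂ p (ball 0 1)) (n : ℕ) :
    ‖taylorCoeffZero p n‖ ≤ (n + 1) * ‖p 0‖ := by
  obtain ⟨c, hc, hre⟩ := h
  have hp_an := analyticAt_zero_of_differentiableOn hp
  have hfield_le : ∀ k, ‖taylorCoeffZero (fun z => p z * diskField 0 c z) (k + 1)‖ ≤
      2 * ‖p 0‖ := fun k => by
    have hdiff : DifferentiableOn ℂ (fun z => p z * diskField 0 c z) (ball 0 1) := by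
      unfold diskField
      fun_prop
    refine (norm_taylorCoeffZero_le_of_le_re hdiff hre k.succ_pos).trans ?_
    have hle := re_le_norm (p 0 * diskField 0 c 0)
    have hzero : ‖diskField 0 c 0‖ = 1 := by simp [diskField, hc]
    rw [norm_mul, hzero, mul_one] at hle
    linarith
  induction n using Nat.twoStepInduction with
  | zero => simp [taylorCoeffZero_zero]
  | one =>
    have hle := hfield_le 0
    rw [taylorCoeffZero_mul_diskField_zero hp_an, taylorCoeffZero_zero, zero_mul, mul_zero,
      add_zero, norm_mul, hc, one_mul] at hle
    rwa [Nat.cast_one, one_add_one_eq_two]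
  | more n ih _ =>
    have hle := hfield_le (n + 1)
    rw [taylorCoeffZero_mul_diskField_zero hp_an, taylorCoeffZero_id_mul_succ hp_an] at hle
    have htri := norm_le_add_norm_add (c * taylorCoeffZero p (n + 2))
      (conj c * taylorCoeffZero p n)
    rw [norm_mul, norm_mul, norm_conj, hc, one_mul, one_mul] at htri
    push_cast
    linarith

lemma half_le_re_div_add {x y : ℂ} (h : ‖y‖ < ‖x‖) : 1 / 2 ≤ (x / (x + y)).re := by
  have hne : x + y ≠ 0 := fun h0 => h.ne' (by rw [eq_neg_of_add_eq_zero_left h0, norm_neg])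
  have hsq : normSq y < normSq x := by
    rw [normSq_eq_norm_sq, normSq_eq_norm_sq]
    exact pow_lt_pow_left₀ h (norm_nonneg _) two_ne_zero
  rw [div_re, ← add_div, div_le_div_iff₀ two_pos (normSq_pos.2 hne)]
  simp only [normSq_apply, add_re, add_im] at hsq ⊢
  linarith

/-- The quotient `X / (X + Y)` has real part at least `1 / 2`, so its coefficients are bounded
by `1`. -/
lemma norm_taylorCoeffZero_le_of_norm_lt {X Y : ℂ → ℂ} (hX : DifferentiableOn ℂ X (ball 0 1))
    (hY : DifferentiableOn ℂ Y (ball 0 1)) (hlt : ∀ z ∈ ball (0 : ℂ) 1, ‖Y z‖ < ‖X z‖)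
    (hY0 : Y 0 = 0) {M : ℝ} (hsum : ∀ n, ‖taylorCoeffZero (fun z => X z + Y z) n‖ ≤ (n + 1) * M)
    (n : ℕ) : ‖taylorCoeffZero X n‖ ≤ (n + 1) * (n + 2) / 2 * M ∧
      ‖taylorCoeffZero Y n‖ ≤ n * (n + 1) / 2 * M := by
  have hne : ∀ z ∈ ball (0 : ℂ) 1, X z + Y z ≠ 0 := fun z hz h0 =>
    (hlt z hz).ne' (by rw [eq_neg_of_add_eq_zero_left h0, norm_neg])
  have hsum_an : AnalyticAt ℂ (fun z => X z + Y z) 0 :=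
    analyticAt_zero_of_differentiableOn (hX.add hY)
  set B := fun z => X z / (X z + Y z) with hB_def
  have hB : DifferentiableOn ℂ B (ball 0 1) := hX.div (hX.add hY) hne
  have hB_an := analyticAt_zero_of_differentiableOn hB
  have hB0 : B 0 = 1 := by
    have := hne 0 (mem_ball_self one_pos)
    rw [hY0, add_zero] at this
    simp only [hB_def, hY0, add_zero, div_self this]
  have hB_coeff : ∀ k, 0 < k → ‖taylorCoeffZero B k‖ ≤ 1 := fun k hk => by
    refine (norm_taylorCoeffZero_le_of_le_re hB
      (fun z hz => half_le_re_div_add (hlt z hz)) hk).trans_eq ?_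
    rw [hB0, one_re]
    norm_num
  have hB' : AnalyticAt ℂ (fun z => 1 - B z) 0 := analyticAt_const.sub hB_an
  have hB'_coeff : ∀ k, 0 < k → ‖taylorCoeffZero (fun z => 1 - B z) k‖ ≤ 1 := fun k hk => by
    rw [taylorCoeffZero_const_sub B 1 hk, norm_neg]
    exact hB_coeff k hk
  have hX_eq : X =ᶠ[𝓝 0] fun z => (X z + Y z) * B z := by
    filter_upwards [ball_mem_nhds (0 : ℂ) one_pos] with z hz
    rw [hB_def, mul_div_cancel₀ _ (hne z hz)]
  have hY_eq : Y =ᶠ[𝓝 0] fun z => (X z + Y z) * (1 - B z) := by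
    filter_upwards [hX_eq] with z hz
    rw [mul_sub, ← hz]
    ring
  rw [taylorCoeffZero_congr hX_eq, taylorCoeffZero_congr hY_eq]
  constructor
  · refine (norm_taylorCoeffZero_mul_le hsum_an hB_an hsum hB_coeff n).trans_eq ?_
    rw [hB0, norm_one]
    ring
  · refine (norm_taylorCoeffZero_mul_le hsum_an hB' hsum hB'_coeff n).trans_eq ?_
    rw [hB0, sub_self, norm_zero]
    ring

lemma IsHarmonicConvexZero.isHarmonicConvex {h g : ℂ → ℂ} (hf : IsHarmonicConvexZero h g) :
    IsHarmonicConvex h g :=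
  ⟨hf.holo_h, hf.holo_g, hf.sense_preserving, hf.univalent, hf.convex_image⟩

theorem IsHarmonicConvexZero.norm_taylorCoeffZero_le {h g : ℂ → ℂ} (hf : IsHarmonicConvexZero h g)
    (n : ℕ) : ‖taylorCoeffZero h (n + 1)‖ ≤ ((n : ℝ) + 2) / 2 ∧
      ‖taylorCoeffZero g (n + 1)‖ ≤ (n : ℝ) / 2 := by
  obtain ⟨ν, hν⟩ := hf.isHarmonicConvex.exists_hasDiskField_zero
  have hnorm : ∀ t : ℝ, ‖exp (t * I)‖ = 1 := norm_exp_ofReal_mul_I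
  have hX : DifferentiableOn ℂ (fun z => exp ((-ν : ℝ) * I) * deriv h z) (ball 0 1) :=
    (hf.holo_h.deriv isOpen_ball).const_mul _
  have hY : DifferentiableOn ℂ (fun z => exp (ν * I) * deriv g z) (ball 0 1) :=
    (hf.holo_g.deriv isOpen_ball).const_mul _
  have hderiv : ∀ z ∈ ball (0 : ℂ) 1, deriv (directionalPart h g ν) z =
      exp ((-ν : ℝ) * I) * deriv h z + exp (ν * I) * deriv g z :=
    fun z hz => hf.isHarmonicConvex.deriv_directionalPart ν hz
  have hfield := hν.norm_taylorCoeffZero_le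
    (((hf.isHarmonicConvex.differentiableOn_directionalPart ν).deriv isOpen_ball).const_mul I)
  have hsum : ∀ k, ‖taylorCoeffZero (fun z => exp ((-ν : ℝ) * I) * deriv h z +
      exp (ν * I) * deriv g z) k‖ ≤ (k + 1) * (1 : ℝ) := fun k => by
    have hle := hfield k
    rw [taylorCoeffZero_const_mul, norm_mul, norm_mul, norm_I, one_mul, one_mul,
      hderiv 0 (mem_ball_self one_pos), hf.deriv_h_zero, hf.deriv_g_zero, mul_one, mul_zero,
      add_zero, hnorm] at hle
    rwa [taylorCoeffZero_congr (eventually_of_mem (ball_mem_nhds 0 one_pos) hderiv)] at hle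
  have hbound := norm_taylorCoeffZero_le_of_norm_lt hX hY (fun z hz => by
    rw [norm_mul, norm_mul, hnorm, hnorm, one_mul, one_mul]
    exact hf.sense_preserving z hz) (by rw [hf.deriv_g_zero, mul_zero]) hsum n
  have hn : ‖(n : ℂ) + 1‖ = n + 1 := by exact_mod_cast norm_natCast (n + 1)
  simp only [taylorCoeffZero_const_mul, taylorCoeffZero_deriv, norm_mul, hnorm, hn] at hbound
  have hpos : (0 : ℝ) < n + 1 := n.cast_add_one_pos
  exact ⟨le_of_mul_le_mul_left (by linarith [hbound.1]) hpos,
    le_of_mul_le_mul_left (by linarith [hbound.2]) hpos⟩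

/-! ### A criterion for harmonic starlikeness -/

section PowerSeries

variable {u : ℂ → ℂ} {a : ℕ → ℂ}

lemma differentiableOn_of_hasSum {R : ℝ}
    (h : ∀ z ∈ ball (0 : ℂ) R, HasSum (fun n => a n * z ^ n) (u z)) :
    DifferentiableOn ℂ u (ball 0 R) := by
  intro z hz
  obtain ⟨ρ, hzρ, hρR⟩ := exists_between (mem_ball_zero_iff.1 hz)
  have hρ : ‖(ρ : ℂ)‖ = ρ := by rw [norm_real, Real.norm_of_nonneg ((norm_nonneg z).trans hzρ.le)]
  have hsummable : Summable fun n => ‖a n‖ * ρ ^ n := by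
    have := (h ρ (mem_ball_zero_iff.2 (hρ.trans_lt hρR))).summable.norm
    simpa only [norm_mul, norm_pow, hρ] using this
  have hdiff : DifferentiableOn ℂ (fun w => ∑' n, a n * w ^ n) (ball 0 ρ) := by
    refine differentiableOn_tsum_of_summable_norm hsummable (fun n => by fun_prop) isOpen_ball
      fun n w hw => ?_
    rw [norm_mul, norm_pow]
    gcongr
    exact (mem_ball_zero_iff.1 hw).le
  have hu : DifferentiableOn ℂ u (ball 0 ρ) := hdiff.congr fun w hw =>
    (h w (ball_subset_ball hρR.le hw)).tsum_eq.symm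
  exact (hu.differentiableAt
    (isOpen_ball.mem_nhds (mem_ball_zero_iff.2 hzρ))).differentiableWithinAt

lemma hasSum_mul_deriv {R : ℝ} (hR : 1 ≤ R)
    (h : ∀ z ∈ ball (0 : ℂ) R, HasSum (fun n => a n * z ^ n) (u z)) {z : ℂ}
    (hz : z ∈ ball (0 : ℂ) R) : HasSum (fun n : ℕ => n * a n * z ^ n) (z * deriv u z) := by
  have hcoeff : ∀ n, taylorCoeffZero u n = a n :=
    taylorCoeffZero_eq_of_hasSum fun z hz => h z (ball_subset_ball hR hz)
  have hderiv := hasSum_taylorCoeffZero ((differentiableOn_of_hasSum h).deriv isOpen_ball) hz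
  simp only [taylorCoeffZero_deriv, hcoeff] at hderiv
  rw [← hasSum_nat_add_iff' 1, Finset.sum_range_one, Nat.cast_zero, zero_mul, zero_mul, sub_zero]
  refine (hderiv.mul_left z).congr_fun fun n => ?_
  push_cast
  ring

lemma norm_sub_mul_le_of_hasSum {z w : ℂ} (hz : ‖z‖ ≤ 1) (h : HasSum (fun n => a n * z ^ n) w)
    (ha0 : a 0 = 0) {p : ℕ → ℝ} (hp : ∀ n, ‖a (n + 2)‖ ≤ p (n + 2)) {S : ℝ} (hS : HasSum p S) :
    ‖w - a 1 * z‖ ≤ ‖z‖ ^ 2 * (S - p 0 - p 1) := by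
  rw [← hasSum_nat_add_iff' 2] at h hS
  simp only [Finset.sum_range_succ, Finset.sum_range_zero, ha0, zero_mul, zero_add, pow_one,
    ← sub_sub] at h hS
  rw [← h.tsum_eq]
  refine tsum_of_norm_bounded (hS.mul_left (‖z‖ ^ 2)) fun n => ?_
  rw [norm_mul, norm_pow, mul_comm]
  exact mul_le_mul (pow_le_pow_of_le_one (norm_nonneg z) hz (Nat.le_add_left 2 n)) (hp n)
    (norm_nonneg _) (by positivity)

lemma norm_mul_deriv_add_le (h : ∀ z ∈ ball (0 : ℂ) 1, HasSum (fun n => a n * z ^ n) (u z))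
    (ha0 : a 0 = 0) {s : ℝ} (hs : -2 ≤ s) {S : ℝ} (hS : HasSum (fun n : ℕ => (n + s) * ‖a n‖) S)
    {z : ℂ} (hz : z ∈ ball (0 : ℂ) 1) :
    ‖z * deriv u z + s * u z - (1 + s) * a 1 * z‖ ≤ ‖z‖ ^ 2 * (S - (1 + s) * ‖a 1‖) := by
  have hsum : HasSum (fun n : ℕ => (n + s) * a n * z ^ n) (z * deriv u z + s * u z) :=
    ((hasSum_mul_deriv le_rfl h hz).add ((h z hz).mul_left (s : ℂ))).congr_fun fun n => by ring
  have hle := norm_sub_mul_le_of_hasSum (mem_ball_zero_iff.1 hz).le hsum (by rw [ha0, mul_zero])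
    (fun n => ?_) hS
  · simpa only [ha0, norm_zero, mul_zero, sub_zero, Nat.cast_one] using hle
  · have hpos : (0 : ℝ) ≤ (n + 2 : ℕ) + s := by
      push_cast
      linarith [n.cast_nonneg (α := ℝ)]
    rw [norm_mul, ← ofReal_natCast, ← ofReal_add, norm_real, Real.norm_of_nonneg hpos]

end PowerSeries

lemma exists_hasDerivAt_arg {f A : ℝ → ℂ} (hf : ∀ θ, HasDerivAt f (I * A θ) θ)
    (hA : Continuous A) (hf0 : ∀ θ, f θ ≠ 0) :
    ∃ φ : ℝ → ℝ, (∀ θ, HasDerivAt φ (A θ / f θ).re θ) ∧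
      ∀ θ, f θ = (‖f θ‖ : ℂ) * exp ((φ θ : ℂ) * I) := by
  have hf_cont : Continuous f := continuous_iff_continuousAt.2 fun θ => (hf θ).continuousAt
  have hquot : Continuous fun θ => A θ / f θ := hA.div₀ hf_cont hf0
  set F : ℝ → ℂ := fun θ => ∫ t in (0 : ℝ)..θ, A t / f t
  have hF : ∀ θ, HasDerivAt F (A θ / f θ) θ := fun θ =>
    (hquot.integral_hasStrictDerivAt 0 θ).hasDerivAt
  have hconst : ∀ θ, f θ * exp (-(I * F θ)) = f 0 := fun θ => by
    have hderiv : ∀ θ, HasDerivAt (fun θ => f θ * exp (-(I * F θ))) 0 θ := fun θ => by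
      refine ((hf θ).mul ((hF θ).const_mul I).neg.cexp).congr_deriv ?_
      field_simp [hf0 θ]
      ring
    have := is_const_of_deriv_eq_zero (fun θ => (hderiv θ).differentiableAt)
      (fun θ => (hderiv θ).deriv) θ 0
    simpa [F] using this
  have hf_eq : ∀ θ, f θ = f 0 * exp (I * F θ) := fun θ => by
    rw [← hconst θ, mul_assoc, ← Complex.exp_add, neg_add_cancel, Complex.exp_zero, mul_one]
  refine ⟨fun θ => arg (f 0) + (F θ).re, fun θ =>
    (reCLM.hasFDerivAt.comp_hasDerivAt θ (hF θ)).const_add _, fun θ => ?_⟩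
  have hnorm : ‖f θ‖ = ‖f 0‖ * Real.exp (-(F θ).im) := by
    rw [hf_eq, norm_mul, norm_exp, I_mul_re]
  rw [hnorm, hf_eq θ]
  nth_rewrite 1 [← norm_mul_exp_arg_mul_I (f 0)]
  rw [mul_assoc, ofReal_mul, mul_assoc, ofReal_exp, ← Complex.exp_add, ← Complex.exp_add]
  congr 2
  apply Complex.ext <;> simp

/-- The derivative `-i ∂/∂θ` of `harmonicMap h g`, that is, the operator `z ∂ - z̄ ∂̄`. -/
noncomputable def angularDeriv (h g : ℂ → ℂ) (z : ℂ) : ℂ :=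
  z * deriv h z - conj (z * deriv g z)

lemma continuousOn_angularDeriv {h g : ℂ → ℂ} {U : Set ℂ} (hU : IsOpen U)
    (hh : DifferentiableOn ℂ h U) (hg : DifferentiableOn ℂ g U) :
    ContinuousOn (angularDeriv h g) U :=
  (continuousOn_id.mul (hh.deriv hU).continuousOn).sub
    (continuous_conj.comp_continuousOn (continuousOn_id.mul (hg.deriv hU).continuousOn))

lemma hasDerivAt_harmonicMap_circleMap {h g : ℂ → ℂ} {r θ : ℝ}
    (hh : DifferentiableAt ℂ h (circleMap 0 r θ)) (hg : DifferentiableAt ℂ g (circleMap 0 r θ)) :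
    HasDerivAt (fun θ => harmonicMap h g (circleMap 0 r θ))
      (I * angularDeriv h g (circleMap 0 r θ)) θ := by
  have hcomp : ∀ {u : ℂ → ℂ}, DifferentiableAt ℂ u (circleMap 0 r θ) →
      HasDerivAt (fun θ => u (circleMap 0 r θ))
        (circleMap 0 r θ * I * deriv u (circleMap 0 r θ)) θ :=
    fun hu => hu.hasDerivAt.scomp θ (hasDerivAt_circleMap 0 r θ)
  refine ((hcomp hh).add (conjCLE.toContinuousLinearMap.hasFDerivAt.comp_hasDerivAt θ
    (hcomp hg))).congr_deriv ?_
  simp only [angularDeriv, ContinuousLinearEquiv.coe_coe, conjCLE_apply, map_mul, conj_I]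
  ring

lemma ne_zero_and_lt_re_div {A w : ℂ} {α : ℝ}
    (h : ‖A - (1 + α) * w‖ < ‖A + (1 - α) * w‖) : w ≠ 0 ∧ α < (A / w).re := by
  have hw : w ≠ 0 := by
    rintro rfl
    simp at h
  have hsq : normSq (A - (1 + α) * w) < normSq (A + (1 - α) * w) := by
    rw [normSq_eq_norm_sq, normSq_eq_norm_sq]
    exact pow_lt_pow_left₀ h (norm_nonneg _) two_ne_zero
  refine ⟨hw, ?_⟩
  rw [div_re, ← add_div, lt_div_iff₀ (normSq_pos.2 hw)]
  simp only [normSq_apply, add_re, add_im, sub_re, sub_im, mul_re, mul_im, one_re, one_im,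
    ofReal_re, ofReal_im] at hsq ⊢
  linarith

section Criterion

variable {h g : ℂ → ℂ} {a b : ℕ → ℂ} {α : ℝ}

lemma norm_angularDeriv_add_le
    (hh : ∀ z ∈ ball (0 : ℂ) 1, HasSum (fun n => a n * z ^ n) (h z))
    (hg : ∀ z ∈ ball (0 : ℂ) 1, HasSum (fun n => b n * z ^ n) (g z))
    (ha0 : a 0 = 0) (ha1 : a 1 = 1) (hb0 : b 0 = 0) (hb1 : b 1 = 0) {s : ℝ} (hs : |s| ≤ 2)
    {S T : ℝ} (hS : HasSum (fun n : ℕ => (n + s) * ‖a n‖) S)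
    (hT : HasSum (fun n : ℕ => (n - s) * ‖b n‖) T) {z : ℂ} (hz : z ∈ ball (0 : ℂ) 1) :
    ‖angularDeriv h g z + s * harmonicMap h g z - (1 + s) * z‖ ≤
      ‖z‖ ^ 2 * (S + T - (1 + s)) := by
  obtain ⟨hs_ge, hs_le⟩ := abs_le.1 hs
  have h_le := norm_mul_deriv_add_le hh ha0 hs_ge hS hz
  have g_le := norm_mul_deriv_add_le hg hb0 (s := -s) (neg_le_neg hs_le)
    (hT.congr_fun fun n => by rw [sub_eq_add_neg]) hz
  simp only [ha1, norm_one, mul_one] at h_le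
  simp only [hb1, norm_zero, mul_zero, zero_mul, sub_zero] at g_le
  calc _ = ‖z * deriv h z + s * h z - (1 + s) * z -
        conj (z * deriv g z + ((-s : ℝ) : ℂ) * g z)‖ := by
        simp only [angularDeriv, harmonicMap, map_add, map_mul, conj_ofReal]
        push_cast
        ring_nf
    _ ≤ ‖z‖ ^ 2 * (S - (1 + s)) + ‖z‖ ^ 2 * T :=
        norm_sub_le_of_le h_le ((norm_conj _).trans_le g_le)
    _ = _ := by ring

lemma norm_angularDeriv_sub_lt_norm_angularDeriv_add (hα0 : 0 ≤ α) (hα1 : α < 1)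
    (hh : ∀ z ∈ ball (0 : ℂ) 1, HasSum (fun n => a n * z ^ n) (h z))
    (hg : ∀ z ∈ ball (0 : ℂ) 1, HasSum (fun n => b n * z ^ n) (g z))
    (ha0 : a 0 = 0) (ha1 : a 1 = 1) (hb0 : b 0 = 0) (hb1 : b 1 = 0) {A B S T : ℝ}
    (hA : HasSum (fun n => ‖a n‖) A) (hB : HasSum (fun n => ‖b n‖) B)
    (hS : HasSum (fun n : ℕ => (n - α) * ‖a n‖) S) (hT : HasSum (fun n : ℕ => (n + α) * ‖b n‖) T)
    (hle : S + T ≤ 2 * (1 - α)) {z : ℂ} (hz : z ∈ ball (0 : ℂ) 1) (hz0 : z ≠ 0) :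
    ‖angularDeriv h g z - (1 + α) * harmonicMap h g z‖ <
      ‖angularDeriv h g z + (1 - α) * harmonicMap h g z‖ := by
  have sub_le := norm_angularDeriv_add_le hh hg ha0 ha1 hb0 hb1 (s := -(1 + α))
    (abs_le.2 ⟨by linarith, by linarith⟩) ((hS.sub hA).congr_fun fun n => by ring)
    ((hT.add hB).congr_fun fun n => by ring) hz
  have add_le := norm_angularDeriv_add_le hh hg ha0 ha1 hb0 hb1 (s := 1 - α)
    (abs_le.2 ⟨by linarith, by linarith⟩) ((hS.add hA).congr_fun fun n => by ring)
    ((hT.sub hB).congr_fun fun n => by ring) hz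
  rw [ofReal_neg, ofReal_add, ofReal_one, neg_mul, ← sub_eq_add_neg] at sub_le
  rw [ofReal_sub, ofReal_one] at add_le
  have upper := (norm_le_insert' _ _).trans (add_le_add_right sub_le _)
  have lower := (norm_le_insert _ _).trans (add_le_add_right add_le _)
  have norm_upper : ‖(1 + -(1 + α : ℂ)) * z‖ = α * ‖z‖ := by
    rw [norm_mul, show (1 + -(1 + α : ℂ)) = -α by ring, norm_neg, norm_real,
      Real.norm_of_nonneg hα0]
  have norm_lower : ‖(1 + (1 - α : ℂ)) * z‖ = (2 - α) * ‖z‖ := by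
    rw [norm_mul, show (1 + (1 - α : ℂ)) = (2 - α : ℝ) by push_cast; ring, norm_real,
      Real.norm_of_nonneg (by linarith)]
  rw [norm_upper] at upper
  rw [norm_lower] at lower
  have hz_sq : ‖z‖ ^ 2 < ‖z‖ :=
    pow_lt_self_of_lt_one₀ (norm_pos_iff.2 hz0) (mem_ball_zero_iff.1 hz) one_lt_two
  nlinarith [mul_le_mul_of_nonneg_left hle (sq_nonneg ‖z‖)]

lemma summable_norm_of_summable_add_mul {s : ℝ} (hs : -1 < s) (ha0 : a 0 = 0)
    (h : Summable fun n : ℕ => (n + s) * ‖a n‖) : Summable fun n => ‖a n‖ := by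
  have hs' : 0 < 1 + s := by linarith
  refine (summable_mul_left_iff hs'.ne').1 (Summable.of_nonneg_of_le (fun n => ?_) (fun n => ?_) h)
  · positivity
  · rcases n with _ | n
    · simp [ha0]
    · push_cast
      gcongr
      linarith [n.cast_nonneg (α := ℝ)]

theorem isHarmonicStarlike_of_tsum_le (hα0 : 0 ≤ α) (hα1 : α < 1)
    (hh : ∀ z ∈ ball (0 : ℂ) 1, HasSum (fun n => a n * z ^ n) (h z))
    (hg : ∀ z ∈ ball (0 : ℂ) 1, HasSum (fun n => b n * z ^ n) (g z))
    (ha0 : a 0 = 0) (ha1 : a 1 = 1) (hb0 : b 0 = 0) (hb1 : b 1 = 0)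
    (hsa : Summable fun n : ℕ => (n - α) * ‖a n‖) (hsb : Summable fun n : ℕ => (n + α) * ‖b n‖)
    (hle : ∑' n : ℕ, (n - α) * ‖a n‖ + ∑' n : ℕ, (n + α) * ‖b n‖ ≤ 2 * (1 - α)) :
    IsHarmonicStarlike α h g := by
  have hA := summable_norm_of_summable_add_mul (s := -α) (by linarith) ha0
    (by simpa only [sub_eq_add_neg] using hsa)
  have hB := summable_norm_of_summable_add_mul (by linarith) hb0 hsb
  have hh_diff := differentiableOn_of_hasSum hh
  have hg_diff := differentiableOn_of_hasSum hg
  have hg_deriv : deriv g 0 = 0 := by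
    rw [← taylorCoeffZero_one, taylorCoeffZero_eq_of_hasSum hg, hb1]
  refine ⟨⟨hh_diff, hg_diff, ?_, ?_, ?_, ?_⟩, fun r hr0 hr1 => ?_⟩
  · rw [← taylorCoeffZero_zero h, taylorCoeffZero_eq_of_hasSum hh, ha0]
  · rw [← taylorCoeffZero_one, taylorCoeffZero_eq_of_hasSum hh, ha1]
  · rw [← taylorCoeffZero_zero g, taylorCoeffZero_eq_of_hasSum hg, hb0]
  · rw [hg_deriv, norm_zero]
    exact one_pos
  have hmem : ∀ θ, circleMap 0 r θ ∈ ball (0 : ℂ) 1 := fun θ => by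
    rwa [mem_ball_zero_iff, norm_circleMap_zero, abs_of_pos hr0]
  have harg : ∀ θ, harmonicMap h g (circleMap 0 r θ) ≠ 0 ∧
      α < (angularDeriv h g (circleMap 0 r θ) / harmonicMap h g (circleMap 0 r θ)).re :=
    fun θ => ne_zero_and_lt_re_div
    (norm_angularDeriv_sub_lt_norm_angularDeriv_add hα0 hα1 hh hg ha0 ha1 hb0 hb1 hA.hasSum
      hB.hasSum hsa.hasSum hsb.hasSum hle (hmem θ) (circleMap_ne_center hr0.ne'))
  have hnhds : ∀ θ, ball (0 : ℂ) 1 ∈ 𝓝 (circleMap 0 r θ) := fun θ =>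
    isOpen_ball.mem_nhds (hmem θ)
  obtain ⟨φ, hφ, hf⟩ := exists_hasDerivAt_arg (fun θ => hasDerivAt_harmonicMap_circleMap
      (hh_diff.differentiableAt (hnhds θ)) (hg_diff.differentiableAt (hnhds θ)))
    ((continuousOn_angularDeriv isOpen_ball hh_diff hg_diff).comp_continuous
      (continuous_circleMap 0 r) hmem) fun θ => (harg θ).1
  exact ⟨φ, fun θ => (hφ θ).differentiableAt, fun θ =>
    ⟨(harg θ).1, hf θ, (hφ θ).deriv ▸ (harg θ).2⟩⟩

end Criterion

/-! ### Wright functions -/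

lemma rpow_mul_exp_le_Gamma {M x : ℝ} (hM : 0 < M) (hx : 0 < x) :
    M ^ x * (Real.exp (-(M + 1)) / (M + 1)) ≤ Real.Gamma x := by
  have hint := Real.GammaIntegral_convergent hx
  have hsub : Ioc M (M + 1) ⊆ Ioi 0 := fun t ht => hM.trans ht.1
  calc M ^ x * (Real.exp (-(M + 1)) / (M + 1))
      = ∫ _ in Ioc M (M + 1), M ^ x * (Real.exp (-(M + 1)) / (M + 1)) := by
        rw [setIntegral_const, measureReal_def, Real.volume_Ioc, add_sub_cancel_left,
          ENNReal.toReal_ofReal zero_le_one, one_smul]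
    _ ≤ ∫ t in Ioc M (M + 1), Real.exp (-t) * t ^ (x - 1) := by
        refine setIntegral_mono_on (integrableOn_const (by simp)) (hint.mono_set hsub)
          measurableSet_Ioc fun t ⟨ht_gt, ht_le⟩ => ?_
        have ht0 : 0 < t := hM.trans ht_gt
        rw [Real.rpow_sub_one ht0.ne', mul_div_left_comm]
        gcongr
    _ ≤ ∫ t in Ioi 0, Real.exp (-t) * t ^ (x - 1) := by
        refine setIntegral_mono_set hint ?_ hsub.eventuallyLE
        filter_upwards [ae_restrict_mem measurableSet_Ioi] with t ht
        exact mul_nonneg (Real.exp_pos _).le (Real.rpow_nonneg (mem_Ioi.1 ht).le _)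
    _ = Real.Gamma x := (Real.Gamma_eq_integral hx).symm

section Wright

variable {a b c d : ℝ}

lemma Gamma_add_natCast_mul_pos (ha : 0 < a) (hb : 0 ≤ b) (n : ℕ) :
    0 < Real.Gamma (a + n * b) :=
  Real.Gamma_pos_of_pos (by positivity)

lemma exists_mul_pow_le_Gamma_mul_Gamma (ha : 0 < a) (hc : 0 < c) (hb : 0 ≤ b) (hd : 0 ≤ d)
    (hbd : 0 < b + d) {q : ℝ} (hq : 0 < q) :
    ∃ C > 0, ∀ n : ℕ, C * q ^ n ≤ Real.Gamma (a + n * b) * Real.Gamma (c + n * d) := by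
  set M : ℝ := q ^ (b + d)⁻¹
  have hM : 0 < M := Real.rpow_pos_of_pos hq _
  have hMq : M ^ (b + d) = q := Real.rpow_inv_rpow hq.le hbd.ne'
  set E := Real.exp (-(M + 1)) / (M + 1)
  have : 0 < E := by positivity
  refine ⟨M ^ a * M ^ c * E ^ 2, by positivity, fun n => ?_⟩
  calc M ^ a * M ^ c * E ^ 2 * q ^ n = M ^ (a + n * b) * E * (M ^ (c + n * d) * E) := by
        rw [← hMq, Real.rpow_add hM a, Real.rpow_add hM c, Real.rpow_add hM b, mul_pow,
          ← Real.rpow_mul_natCast hM.le, ← Real.rpow_mul_natCast hM.le, mul_comm b, mul_comm d]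
        ring
    _ ≤ Real.Gamma (a + n * b) * Real.Gamma (c + n * d) :=
        mul_le_mul (rpow_mul_exp_le_Gamma hM (by positivity))
          (rpow_mul_exp_le_Gamma hM (by positivity)) (by positivity)
          (Gamma_add_natCast_mul_pos ha hb n).le

lemma summable_pow_div_Gamma_mul_Gamma (ha : 0 < a) (hc : 0 < c) (hb : 0 ≤ b) (hd : 0 ≤ d)
    (hbd : 0 < b + d) {R : ℝ} (hR : 0 ≤ R) :
    Summable fun n : ℕ => R ^ n / (Real.Gamma (a + n * b) * Real.Gamma (c + n * d)) := by
  obtain ⟨C, hC, hle⟩ := exists_mul_pow_le_Gamma_mul_Gamma ha hc hb hd hbd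
    (show 0 < R + 1 by linarith)
  have hgeom : Summable fun n : ℕ => C⁻¹ * (R / (R + 1)) ^ n :=
    (summable_geometric_of_lt_one (by positivity) (by rw [div_lt_one] <;> linarith)).mul_left _
  have hpos : ∀ n : ℕ, 0 < Real.Gamma (a + n * b) * Real.Gamma (c + n * d) := fun n =>
    mul_pos (Gamma_add_natCast_mul_pos ha hb n) (Gamma_add_natCast_mul_pos hc hd n)
  refine Summable.of_nonneg_of_le (fun n => div_nonneg (pow_nonneg hR n) (hpos n).le)
    (fun n => ?_) hgeom
  calc R ^ n / (Real.Gamma (a + n * b) * Real.Gamma (c + n * d)) ≤ R ^ n / (C * (R + 1) ^ n) :=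
        div_le_div_of_nonneg_left (by positivity) (by positivity) (hle n)
    _ = C⁻¹ * (R / (R + 1)) ^ n := by
        rw [div_pow]
        field_simp

/-- The Taylor coefficients at `0` of the normalized Wright function; the shift by one accounts
for its factor `z`. -/
noncomputable def normWrightCoeff (a b c d : ℝ) : ℕ → ℝ
  | 0 => 0
  | n + 1 => Real.Gamma a * Real.Gamma c / (Real.Gamma (a + n * b) * Real.Gamma (c + n * d))

lemma normWrightCoeff_one (ha : 0 < a) (hc : 0 < c) : normWrightCoeff a b c d 1 = 1 := by
  simp only [normWrightCoeff, Nat.cast_zero, zero_mul, add_zero]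
  exact div_self (mul_pos (Real.Gamma_pos_of_pos ha) (Real.Gamma_pos_of_pos hc)).ne'

lemma normWrightCoeff_nonneg (ha : 0 < a) (hc : 0 < c) (hb : 0 ≤ b) (hd : 0 ≤ d) :
    ∀ n, 0 ≤ normWrightCoeff a b c d n
  | 0 => le_rfl
  | n + 1 => div_nonneg (mul_pos (Real.Gamma_pos_of_pos ha) (Real.Gamma_pos_of_pos hc)).le
      (mul_pos (Gamma_add_natCast_mul_pos ha hb n) (Gamma_add_natCast_mul_pos hc hd n)).le

lemma hasSum_normWright (ha : 0 < a) (hc : 0 < c) (hb : 0 ≤ b) (hd : 0 ≤ d) (hbd : 0 < b + d)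
    (z : ℂ) : HasSum (fun n => (normWrightCoeff a b c d n : ℂ) * z ^ n) (normWright a b c d z) := by
  have hsummable : Summable fun n : ℕ =>
      z ^ n / ((Real.Gamma (a + n * b) * Real.Gamma (c + n * d) : ℝ) : ℂ) := by
    refine Summable.of_norm ((summable_pow_div_Gamma_mul_Gamma ha hc hb hd hbd
      (norm_nonneg z)).congr fun n => ?_)
    rw [norm_div, norm_pow, norm_real, Real.norm_of_nonneg
      (mul_pos (Gamma_add_natCast_mul_pos ha hb n) (Gamma_add_natCast_mul_pos hc hd n)).le]
  rw [← hasSum_nat_add_iff' 1, Finset.sum_range_one, normWrightCoeff, ofReal_zero, zero_mul,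
    sub_zero]
  refine (hsummable.hasSum.mul_left (z * ((Real.Gamma a * Real.Gamma c : ℝ) : ℂ))).congr_fun
    fun n => ?_
  rw [normWrightCoeff, ofReal_div]
  ring

end Wright

section Convolution

variable {u W : ℂ → ℂ} {w : ℕ → ℝ}

lemma hasSum_re_apply_one {R : ℝ} (hR : 1 < R)
    (hW : ∀ z ∈ ball (0 : ℂ) R, HasSum (fun n => (w n : ℂ) * z ^ n) (W z)) :
    HasSum w (W 1).re := by
  have h := hasSum_re (hW 1 (mem_ball_zero_iff.2 (by rwa [norm_one])))
  simpa only [one_pow, mul_one, ofReal_re] using h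

lemma hasSum_re_deriv_one {R : ℝ} (hR : 1 < R)
    (hW : ∀ z ∈ ball (0 : ℂ) R, HasSum (fun n => (w n : ℂ) * z ^ n) (W z)) :
    HasSum (fun n : ℕ => n * w n) (deriv W 1).re := by
  have h := hasSum_re_apply_one (w := fun n : ℕ => n * w n) hR (W := fun z => z * deriv W z)
    fun z hz => (hasSum_mul_deriv hR.le hW hz).congr_fun fun n => by push_cast; ring
  simpa only [one_mul] using h

lemma hasSum_re_iteratedDeriv_two_one {R : ℝ} (hR : 1 < R)
    (hW : ∀ z ∈ ball (0 : ℂ) R, HasSum (fun n => (w n : ℂ) * z ^ n) (W z)) :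
    HasSum (fun n : ℕ => n * (n - 1) * w n) (iteratedDeriv 2 W 1).re := by
  have h := hasSum_re_deriv_one (w := fun n : ℕ => n * w n) hR (W := fun z => z * deriv W z)
    fun z hz => (hasSum_mul_deriv hR.le hW hz).congr_fun fun n => by push_cast; ring
  have hderiv : HasDerivAt (deriv W) (iteratedDeriv 2 W 1) 1 := by
    rw [iteratedDeriv_succ, iteratedDeriv_one]
    exact (((differentiableOn_of_hasSum hW).deriv isOpen_ball).differentiableAt
      (isOpen_ball.mem_nhds (mem_ball_zero_iff.2 (by rwa [norm_one])))).hasDerivAt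
  rw [((hasDerivAt_id' (1 : ℂ)).fun_mul hderiv).deriv, one_mul, one_mul, add_re] at h
  have h' := h.sub (hasSum_re_deriv_one hR hW)
  rw [add_sub_cancel_left] at h'
  exact h'.congr_fun fun n => by ring

lemma hasSum_hadamardConv_of_summable {w : ℕ → ℂ}
    (hW : ∀ z ∈ ball (0 : ℂ) 1, HasSum (fun n => w n * z ^ n) (W z))
    (hs : Summable fun n => ‖taylorCoeffZero u n * w n‖) {z : ℂ} (hz : ‖z‖ ≤ 1) :
    HasSum (fun n => taylorCoeffZero u n * w n * z ^ n) (hadamardConv u W z) := by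
  simp only [hadamardConv, taylorCoeffZero_eq_of_hasSum hW]
  refine (Summable.of_norm_bounded hs fun n => ?_).hasSum
  rw [norm_mul _ (z ^ n), norm_pow]
  exact mul_le_of_le_one_right (norm_nonneg _) (pow_le_one₀ (norm_nonneg z) hz)

end Convolution

lemma summable_add_mul_norm_and_tsum_le {c : ℕ → ℂ} {p : ℕ → ℝ} {s S : ℝ} (hs : -1 ≤ s)
    (hp0 : p 0 = 0) (hle : ∀ n, ‖c n‖ ≤ p n) (hS : HasSum (fun n : ℕ => (n + s) * p n) S) :
    (Summable fun n : ℕ => (n + s) * ‖c n‖) ∧ ∑' n : ℕ, (n + s) * ‖c n‖ ≤ S := by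
  have hc0 : ‖c 0‖ = 0 := le_antisymm ((hle 0).trans_eq hp0) (norm_nonneg _)
  have hns : ∀ n : ℕ, 0 ≤ ((n + 1 : ℕ) : ℝ) + s := fun n => by
    push_cast
    linarith [n.cast_nonneg (α := ℝ)]
  have hterm_nonneg : ∀ n : ℕ, 0 ≤ (n + s) * ‖c n‖
    | 0 => by rw [hc0, mul_zero]
    | n + 1 => mul_nonneg (hns n) (norm_nonneg _)
  have hterm_le : ∀ n : ℕ, (n + s) * ‖c n‖ ≤ (n + s) * p n
    | 0 => by rw [hc0, hp0]
    | n + 1 => mul_le_mul_of_nonneg_left (hle _) (hns n)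
  have hsummable := Summable.of_nonneg_of_le hterm_nonneg hterm_le hS.summable
  exact ⟨hsummable, (hsummable.tsum_le_tsum hterm_le hS.summable).trans_eq hS.tsum_eq⟩

namespace IsHarmonicConvexZero

variable {h g W : ℂ → ℂ} {w : ℕ → ℝ}

lemma norm_taylorCoeffZero_mul_le (hf : IsHarmonicConvexZero h g) (hw : ∀ n, 0 ≤ w n)
    (hw0 : w 0 = 0) (n : ℕ) :
    ‖taylorCoeffZero h n * w n‖ ≤ (n + 1) / 2 * w n ∧
      ‖taylorCoeffZero g n * w n‖ ≤ (n - 1) / 2 * w n := by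
  rcases n with _ | n
  · simp [hw0]
  · obtain ⟨h_le, g_le⟩ := hf.norm_taylorCoeffZero_le n
    rw [norm_mul, norm_mul, norm_real, Real.norm_of_nonneg (hw _)]
    push_cast
    rw [add_sub_cancel_right, add_assoc, one_add_one_eq_two]
    exact ⟨mul_le_mul_of_nonneg_right h_le (hw _), mul_le_mul_of_nonneg_right g_le (hw _)⟩

lemma hasSum_hadamardConv (hf : IsHarmonicConvexZero h g) {R : ℝ} (hR : 1 < R)
    (hW : ∀ z ∈ ball (0 : ℂ) R, HasSum (fun n => (w n : ℂ) * z ^ n) (W z)) (hw : ∀ n, 0 ≤ w n)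
    (hw0 : w 0 = 0) {z : ℂ} (hz : ‖z‖ ≤ 1) :
    HasSum (fun n => taylorCoeffZero h n * w n * z ^ n) (hadamardConv h W z) ∧
      HasSum (fun n => taylorCoeffZero g n * w n * z ^ n) (hadamardConv g W z) := by
  have sum₀ := hasSum_re_apply_one hR hW
  have sum₁ := hasSum_re_deriv_one hR hW
  have hW' : ∀ z ∈ ball (0 : ℂ) 1, HasSum (fun n => (w n : ℂ) * z ^ n) (W z) := fun z hz =>
    hW z (ball_subset_ball hR.le hz)
  have hle := hf.norm_taylorCoeffZero_mul_le hw hw0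
  constructor
  · refine hasSum_hadamardConv_of_summable hW' (Summable.of_nonneg_of_le (fun _ => norm_nonneg _)
      (fun n => (hle n).1) (((sum₁.add sum₀).div_const 2).summable.congr fun n => by ring)) hz
  · refine hasSum_hadamardConv_of_summable hW' (Summable.of_nonneg_of_le (fun _ => norm_nonneg _)
      (fun n => (hle n).2) (((sum₁.sub sum₀).div_const 2).summable.congr fun n => by ring)) hz

end IsHarmonicConvexZero

theorem mainTheorem3_general {α : ℝ} (hα0 : 0 ≤ α) (hα1 : α < 1) {V W : ℂ → ℂ} {v w : ℕ → ℝ}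
    {R : ℝ} (hR : 1 < R)
    (hV : ∀ z ∈ ball (0 : ℂ) R, HasSum (fun n => (v n : ℂ) * z ^ n) (V z)) (hv : ∀ n, 0 ≤ v n)
    (hv0 : v 0 = 0) (hv1 : v 1 = 1)
    (hW : ∀ z ∈ ball (0 : ℂ) R, HasSum (fun n => (w n : ℂ) * z ^ n) (W z)) (hw : ∀ n, 0 ≤ w n)
    (hw0 : w 0 = 0) {σ : ℂ} {h g : ℂ → ℂ} (hf : IsHarmonicConvexZero h g)
    (hineq : (iteratedDeriv 2 V 1).re + (2 - α) * ((deriv V 1).re - 1) - α * ((V 1).re - 1)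
      + ‖σ‖ * ((iteratedDeriv 2 W 1).re + α * ((deriv W 1).re - (W 1).re)) ≤ 2 * (1 - α)) :
    IsHarmonicStarlike α (hadamardConv h V) (fun z => σ * hadamardConv g W z) := by
  have hV_sum : HasSum (fun n : ℕ => (n + -α) * ((n + 1) / 2 * v n))
      (((iteratedDeriv 2 V 1).re + (2 - α) * (deriv V 1).re - α * (V 1).re) / 2) :=
    ((((hasSum_re_iteratedDeriv_two_one hR hV).add ((hasSum_re_deriv_one hR hV).mul_left _)).sub
      ((hasSum_re_apply_one hR hV).mul_left _)).div_const 2).congr_fun fun n => by ring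
  have hW_sum : HasSum (fun n : ℕ => (n + α) * (‖σ‖ * ((n - 1) / 2 * w n)))
      (‖σ‖ * ((iteratedDeriv 2 W 1).re + α * ((deriv W 1).re - (W 1).re)) / 2) :=
    ((((hasSum_re_iteratedDeriv_two_one hR hW).add (((hasSum_re_deriv_one hR hW).sub
      (hasSum_re_apply_one hR hW)).mul_left _)).mul_left _).div_const 2).congr_fun
      fun n => by ring
  obtain ⟨hsa, hsa_le⟩ := summable_add_mul_norm_and_tsum_le (by linarith) (by rw [hv0, mul_zero])
    (fun n => (hf.norm_taylorCoeffZero_mul_le hv hv0 n).1) hV_sum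
  obtain ⟨hsb, hsb_le⟩ := summable_add_mul_norm_and_tsum_le (s := α)
    (c := fun n => σ * (taylorCoeffZero g n * w n)) (by linarith)
    (by rw [hw0, mul_zero, mul_zero]) (fun n => (norm_mul_le _ _).trans
      (mul_le_mul_of_nonneg_left (hf.norm_taylorCoeffZero_mul_le hw hw0 n).2 (norm_nonneg σ)))
    hW_sum
  simp only [← sub_eq_add_neg] at hsa hsa_le
  refine isHarmonicStarlike_of_tsum_le hα0 hα1
    (fun z hz => (hf.hasSum_hadamardConv hR hV hv hv0 (mem_ball_zero_iff.1 hz).le).1)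
    (fun z hz => ((hf.hasSum_hadamardConv hR hW hw hw0
      (mem_ball_zero_iff.1 hz).le).2.mul_left σ).congr_fun fun n => by ring)
    (by simp [hv0]) ?_ (by simp [hw0]) ?_ hsa hsb (by linarith)
  · rw [taylorCoeffZero_one, hf.deriv_h_zero, hv1, ofReal_one, one_mul]
  · rw [taylorCoeffZero_one, hf.deriv_g_zero, zero_mul, mul_zero]

/-- Below, `h * W₁` and `σ (g * W₂)` are the analytic and co-analytic parts of `L(f)`. The values of
`W₁`, `W₂` and their derivatives at `1` are real numbers; `.re` reads them as such. -/
theorem mainTheorem3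
    (α : ℝ) (hα0 : 0 ≤ α) (hα1 : α < 1)
    (α₁ β₁ γ₁ δ₁ α₂ β₂ γ₂ δ₂ : ℝ)
    (hα₁ : 0 < α₁) (hγ₁ : 0 < γ₁) (hβ₁ : 0 ≤ β₁) (hδ₁ : 0 ≤ δ₁) (hβδ₁ : 0 < β₁ + δ₁)
    (hα₂ : 0 < α₂) (hγ₂ : 0 < γ₂) (hβ₂ : 0 ≤ β₂) (hδ₂ : 0 ≤ δ₂) (hβδ₂ : 0 < β₂ + δ₂)
    (σ : ℂ) (hσ : ‖σ‖ < 1)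
    (h g : ℂ → ℂ) (hf : IsHarmonicConvexZero h g)
    (hineq :
      (iteratedDeriv 2 (normWright α₁ β₁ γ₁ δ₁) 1).re
        + (2 - α) * ((deriv (normWright α₁ β₁ γ₁ δ₁) 1).re - 1)
        - α * ((normWright α₁ β₁ γ₁ δ₁ 1).re - 1)
        + ‖σ‖ * ((iteratedDeriv 2 (normWright α₂ β₂ γ₂ δ₂) 1).re
            + α * ((deriv (normWright α₂ β₂ γ₂ δ₂) 1).re - (normWright α₂ β₂ γ₂ δ₂ 1).re))
      ≤ 2 * (1 - α)) :
    IsHarmonicStarlike α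
      (hadamardConv h (normWright α₁ β₁ γ₁ δ₁))
      (fun z => σ * hadamardConv g (normWright α₂ β₂ γ₂ δ₂) z) :=
  mainTheorem3_general hα0 hα1 one_lt_two
    (fun z _ => hasSum_normWright hα₁ hγ₁ hβ₁ hδ₁ hβδ₁ z)
    (normWrightCoeff_nonneg hα₁ hγ₁ hβ₁ hδ₁) rfl (normWrightCoeff_one hα₁ hγ₁)
    (fun z _ => hasSum_normWright hα₂ hγ₂ hβ₂ hδ₂ hβδ₂ z)
    (normWrightCoeff_nonneg hα₂ hγ₂ hβ₂ hδ₂) rfl hf hineq
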